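/- **Setting.** Let $T>0$, $M\ge1$, $\Delta t=T/M$, $t_m=m\Delta t$, cash flows $q_0,\dots,q_{M-1}\ge 0$, $r,\mu\in\mathbb R$, $\sigma>0$, $\lambda\ge 0$, $p_{up}\in[0,1]$, $\eta_1>1$, $\eta_2>0$. Let $\rho$ be the Kou density $\rho(\zeta)=p_{up}\eta_1e^{-\eta_1\zeta}\mathbb 1_{\zeta\ge0}+(1-p_{up})\eta_2e^{\eta_2\zeta}\mathbb 1_{\zeta<0}$, $\kappa=\int(e^\zeta-1)\rho(\zeta)\,d\zeta$, and let $g(y-y')=\sum_{\ell\ge0}g_\ell(y-y')$ be the transition density of the log-price over one period, where $g_\ell$ is the contribution of exactly $\ell$ jumps: $g_\ell(x)=e^{-\lambda\Delta t}\frac{(\lambda\Delta t)^\ell}{\ell!}\,\mathbb E[\phi(-x-J_\ell)]$, with $\phi$ the density of $\mathcal N((\mu-\lambda\kappa-\sigma^2/2)\Delta t,\sigma^2\Delta t)$ and $J_\ell$ a sum of $\ell$ i.i.d. variables of density $\rho$. Put $g(\cdot\,;N)=\sum_{\ell=0}^{N}g_\ell$. The payoff is either (Mean–bPoE, $D,\gamma>0$)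 $f(w,W)=\gamma\max(1-\frac{w-D}{W-D},0)-w$, with $\mathrm{opt}=\inf$, or (Mean–CVaR, $\gamma>0$, $0<\alpha<1$) $f(w,W)=\gamma(W+\frac1\alpha\min(w-W,0))+w$, with $\mathrm{opt}=\sup$. The localized domain is $\Omega=[y^\dagger_{\min},y^\dagger_{\max}]\times[0,b_{\max}]$ with $y_{\min}^\dagger<y_{\min}<y_{\max}<y_{\max}^\dagger$ and $b_{\max}\ge e^{y_{\max}+|r|T}$; $\Omega_{in}=(y_{\min},y_{\max})\times[0,b_{\max}]$, $\widetilde\Omega_{in}=\{(s,b):(\ln s,b)\in\Omega_{in}\}$. The threshold domain is a compact interval $\Gamma=[W_{\min},W_{\max}]$, $W_{\min}<W_{\max}$, with $W_{\min}>D$ (bPoE), $W_{\min}\ge0$ (CVaR). **Exact problem.** $\widehat V(y,b,W,T)=f(e^y+b,W)$. For $m=M-1,\dots,0$: (a) $\widehat V(y,b,W,t_{m+1}^-)=\widehat V(y,be^{r\Delta t},W,t_{m+1})$, where for $be^{r\Delta t}>b_{\max}$ the right side means $\frac{be^{r\Delta t}}{b_{\max}}\widehat V(y,b_{\max},W,t_{m+1})$.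 (b) $\widehat V(y,b,W,t_m^+)$ equals $\int_{y^\dagger_{\min}}^{y^\dagger_{\max}}\widehat V(y',b,W,t_{m+1}^-)\,g(y-y')\,dy'$ if $y_{\min}<y<y_{\max}$, $\widehat V(y,b,W,t_{m+1}^-)$ if $y\le y_{\min}$, and $e^{\mu\Delta t}\widehat V(y,b,W,t_{m+1}^-)$ if $y\ge y_{\max}$. Outside $\Omega$ it is extended as a constant in $y$ for $y<y^\dagger_{\min}$ (also for $y=-\infty$), by the factor $e^{y-y^\dagger_{\max}}$ for $y>y^\dagger_{\max}$, and by the factor $b/b_{\max}$ for $b>b_{\max}$. (c) With $w=e^y+b+q_m$, $$\widehat U(y,b,W,t_m^+)=\underset{u\in[0,1]}{\mathrm{opt}}\ \widehat V\big(\ln(uw),(1-u)w,W,t_m^+\big),\qquad \widehat V(y,b,\cdot,t_m)=\underset{W\in\Gamma}{\mathrm{opt}}\ \widehat U(y,b,W,t_m^+).$$ The value function is $V(s,b,t_m)=\widehat V(\ln s,b,\cdot,t_m)$; an exact optimal threshold at $(s,b,t_m)$ is any $W\in\Gamma$ that attains the last optimum at $y=\ln s$. **Scheme.** A grid has $N_y$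 equal subintervals of $[y^\dagger_{\min},y^\dagger_{\max}]$ with nodes $y_n$, partitions $\{b_j\}$ of $[0,b_{\max}]$, $\{u_i\}$ of $[0,1]$, $\{W_k\}$ of $\Gamma$ (end points included), and a truncation index $N_g$. The computed $\widehat V_h,\widehat U_h$ are obtained from the same recursion at the nodes: (a) by linear interpolation in $b$ with the same extrapolation; (b) with the integral replaced by the composite trapezoidal sum $\sum_l\varphi_l\,g(y_n-y_l;N_g)\,\widehat V_h(y_l,b_j,W_k,t_{m+1}^-)$ at nodes with $y_{\min}<y_n<y_{\max}$ and the same boundary conditions at the other nodes; (c) by exhaustive search over $\{u_i\}$ and $\{W_k\}$, with bilinear interpolation in $(y,b)$ and the same extension outside $\Omega$. Write $V_h(e^{y_n},b_j,t_m)=\widehat V_h(y_n,b_j,\cdot,t_m)$; a computed optimal threshold at the node is any $W_k$ that attains the discrete optimum over the thresholds there. **Theorem.** Consider a sequence of grids with $h\to0$, i.e. $N_y,N_g\to\infty$ and the mesh sizes of $\{b_j\},\{u_i\},\{W_k\}$ tend to $0$. Let $0\le m\le M-1$ and let $(s',b')\in\widetilde\Omega_{in}$ be a state at which $V(\cdot,\cdot,t_m)$,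 restricted to $\widetilde\Omega_{in}$, is continuous. Let $(s_h,b_h)$ be grid nodes in $\widetilde\Omega_{in}$ with $(s_h,b_h)\to(s',b')$, and let $W_{m,h}^*(s_h,b_h)$ be computed optimal thresholds at these nodes. Then * $\displaystyle\lim_{h\to0}|V_h(s_h,b_h,t_m)-V(s',b',t_m)|=0$; * the sequence $W_{m,h}^*(s_h,b_h)$ has a subsequence that converges to an exact optimal threshold at $(s',b',t_m)$. -/

import Mathlib

open Filter Topology MeasureTheory ProbabilityTheory

noncomputable section

/-- The two mean-risk criteria: Mean-bPoE with disaster level `D` (to be minimized) and Mean-CVaR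
with confidence level `α` (to be maximized); `γ` is the scalarization parameter. -/
inductive Criterion where
  | bPoE (D γ : ℝ)
  | CVaR (α γ : ℝ)

namespace Criterion

/-- The payoff `f (w, W)` of terminal wealth `w` under the threshold `W`. -/
def payoff : Criterion → ℝ → ℝ → ℝ
  | bPoE D γ, w, W => γ * max (1 - (w - D) / (W - D)) 0 - w
  | CVaR α γ, w, W => γ * (W + 1 / α * min (w - W) 0) + w

/-- Optimal value over a set of attainable values: infimum for Mean-bPoE, supremum for
Mean-CVaR. -/
def opt : Criterion → Set ℝ → ℝ
  | bPoE _ _, S => sInf S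
  | CVaR _ _, S => sSup S

/-- `x` is at least as good an objective value as `y`. -/
def AsGood : Criterion → ℝ → ℝ → Prop
  | bPoE _ _, x, y => x ≤ y
  | CVaR _ _, x, y => y ≤ x

/-- Admissible parameters, together with the requirement that the smallest threshold `Wlo` of the
truncated threshold domain is feasible (`W > D`, respectively `W ≥ 0`). -/
def Admissible : Criterion → ℝ → Prop
  | bPoE D γ, Wlo => 0 < D ∧ 0 < γ ∧ D < Wlo
  | CVaR α γ, Wlo => 0 < α ∧ α < 1 ∧ 0 < γ ∧ 0 ≤ Wlo

end Criterion

/-- Data of the localized time-consistent mean-risk problem: market (Kou jump-diffusion and bank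
account), rebalancing schedule, cash flows, criterion, and localization
`Ω = [ylo, yhi] × [0, bmax]`, `Γ = [Wlo, Whi]`. -/
structure MeanRiskProblem where
  /-- investment horizon -/
  T : ℝ
  /-- number of rebalancing times -/
  M : ℕ
  /-- risk-free rate -/
  r : ℝ
  /-- drift of the risky asset -/
  μ : ℝ
  /-- volatility -/
  σ : ℝ
  /-- jump intensity -/
  lam : ℝ
  /-- probability of an upward jump -/
  pup : ℝ
  η₁ : ℝ
  η₂ : ℝ
  /-- cash flows `q m`, `m < M` -/
  q : ℕ → ℝ
  crit : Criterion
  ylo : ℝ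
  ymin : ℝ
  ymax : ℝ
  yhi : ℝ
  bmax : ℝ
  Wlo : ℝ
  Whi : ℝ
  T_pos : 0 < T
  M_pos : 0 < M
  σ_pos : 0 < σ
  lam_nonneg : 0 ≤ lam
  pup_nonneg : 0 ≤ pup
  pup_le_one : pup ≤ 1
  one_lt_η₁ : 1 < η₁
  η₂_pos : 0 < η₂
  q_nonneg : ∀ m < M, 0 ≤ q m
  ylo_lt : ylo < ymin
  ymin_lt : ymin < ymax
  ymax_lt : ymax < yhi
  bmax_large : Real.exp (ymax + |r| * T) ≤ bmax
  Wlo_lt : Wlo < Whi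
  crit_admissible : crit.Admissible Wlo

namespace MeanRiskProblem

variable (P : MeanRiskProblem)

/-- Time between rebalancing dates. -/
def Δt : ℝ := P.T / P.M

/-! ### Transition density of the log-price over one period -/

/-- Density of the logarithm of the jump multiplier (asymmetric double exponential). -/
def jumpDensity (ζ : ℝ) : ℝ :=
  if 0 ≤ ζ then P.pup * P.η₁ * Real.exp (-P.η₁ * ζ)
  else (1 - P.pup) * P.η₂ * Real.exp (P.η₂ * ζ)

/-- Law of the logarithm of the jump multiplier. -/
def jumpLaw : Measure ℝ := volume.withDensity fun ζ => ENNReal.ofReal (P.jumpDensity ζ)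

/-- Law of the sum of `ℓ` independent log-jumps. -/
def jumpSumLaw : ℕ → Measure ℝ
  | 0 => Measure.dirac 0
  | ℓ + 1 => (jumpSumLaw ℓ).conv P.jumpLaw

/-- `κ = E[ξ - 1]`. -/
def kappa : ℝ := ∫ ζ, (Real.exp ζ - 1) * P.jumpDensity ζ

/-- The contribution of exactly `ℓ` jumps to the transition density, as a function of the
displacement `x = y - y'` (old log-price minus new log-price): given `ℓ` jumps, `y' - y` is the sum
of a normal variable of mean `(μ - λκ - σ²/2)Δt` and variance `σ²Δt` and of `ℓ` independent
log-jumps, and the number of jumps is Poisson of mean `λΔt`. -/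
def densityTerm (ℓ : ℕ) (x : ℝ) : ℝ :=
  Real.exp (-(P.lam * P.Δt)) * (P.lam * P.Δt) ^ ℓ / (ℓ.factorial : ℝ) *
    ∫ z, gaussianPDFReal ((P.μ - P.lam * P.kappa - P.σ ^ 2 / 2) * P.Δt)
      (Real.toNNReal (P.σ ^ 2 * P.Δt)) (-x - z) ∂(P.jumpSumLaw ℓ)

/-- The transition density `g (x, Δt)`, at displacement `x = y - y'`. -/
def density (x : ℝ) : ℝ := ∑' ℓ, P.densityTerm ℓ x

/-- The partial sum `g (x, Δt; N)` of the series for the density. -/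
def densityTrunc (N : ℕ) (x : ℝ) : ℝ := ∑ ℓ ∈ Finset.range (N + 1), P.densityTerm ℓ x

/-! ### The exact localized problem

Functions of log-price `y`, bank account `b` and threshold `W` are written `F y b W`. -/

/-- Interest settlement: the value before settlement at `(y, b)` is the value after settlement at
`(y, b e^{rΔt})`, with linear extrapolation `F (b) = (b / bmax) F (bmax)` beyond `bmax`. -/
def settle (F : ℝ → ℝ → ℝ → ℝ) (y b W : ℝ) : ℝ :=
  max 1 (b * Real.exp (P.r * P.Δt) / P.bmax) * F y (min (b * Real.exp (P.r * P.Δt)) P.bmax) W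

/-- From the value `F` at a rebalancing time (or at the horizon) to the value just after the
previous rebalancing: truncated convolution for `ymin < y < ymax`, boundary conditions elsewhere. -/
def advance (F : ℝ → ℝ → ℝ → ℝ) (y b W : ℝ) : ℝ :=
  if y ≤ P.ymin then P.settle F y b W
  else if P.ymax ≤ y then Real.exp (P.μ * P.Δt) * P.settle F y b W
  else ∫ y' in P.ylo..P.yhi, P.settle F y' b W * P.density (y - y')

/-- A log-price in `[ylo, yhi]` for an amount `s ≥ 0` in the risky asset (nearest value). -/
def logAmount (s : ℝ) : ℝ := Real.log (max (Real.exp P.ylo) (min s (Real.exp P.yhi)))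

/-- Growth factor for amounts outside `Ω`: exponential in `y` above `yhi`, linear in `b` above
`bmax` (and constant in `y` below `ylo`). -/
def growth (s b : ℝ) : ℝ := max 1 (s / Real.exp P.yhi) * max 1 (b / P.bmax)

/-- Value of a function given on `Ω` at amounts `s, b ≥ 0`, possibly outside `Ω`. -/
def extend (F : ℝ → ℝ → ℝ → ℝ) (s b W : ℝ) : ℝ :=
  P.growth s b * F (P.logAmount s) (min b P.bmax) W

/-- Wealth at the rebalancing time `t_m` including the cash flow, in state `(y, b)`. -/
def wealth (m : ℕ) (y b : ℝ) : ℝ := Real.exp y + b + P.q m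

/-- Optimization over the rebalancing control `u ∈ [0, 1]` at `t_m`, for a fixed threshold `W`;
`F` is the value just after rebalancing. -/
def controlOpt (m : ℕ) (F : ℝ → ℝ → ℝ → ℝ) (y b W : ℝ) : ℝ :=
  P.crit.opt ((fun u => P.extend F (u * P.wealth m y b) ((1 - u) * P.wealth m y b) W) ''
    Set.Icc (0 : ℝ) 1)

/-- The exact function `V̂ (y, b, W, t_m)` with `m = M - k`, by backward recursion in the number `k`
of rebalancing times left. Control and threshold are re-optimized at every rebalancing time, so
that for `k > 0` it does not depend on its threshold argument. -/
def exactV : ℕ → ℝ → ℝ → ℝ → ℝ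
  | 0 => fun y b W => P.crit.payoff (Real.exp y + b) W
  | k + 1 => fun y b _ =>
      P.crit.opt (P.controlOpt (P.M - (k + 1)) (P.advance (exactV k)) y b '' Set.Icc P.Wlo P.Whi)

/-- The exact objective `Û (y, b, W, t_m⁺)` of the threshold optimization at `t_m`. -/
def exactObjective (m : ℕ) (y b W : ℝ) : ℝ :=
  P.controlOpt m (P.advance (P.exactV (P.M - (m + 1)))) y b W

/-- `W` is an exact optimal threshold at `t_m` in state `(s, b)`. -/
def IsOptimalThreshold (m : ℕ) (s b W : ℝ) : Prop :=
  W ∈ Set.Icc P.Wlo P.Whi ∧ ∀ W' ∈ Set.Icc P.Wlo P.Whi,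
    P.crit.AsGood (P.exactObjective m (Real.log s) b W) (P.exactObjective m (Real.log s) b W')

/-- The exact value function `V (s, b, t_m)`, in original coordinates. -/
def exactValue (m : ℕ) (s b : ℝ) : ℝ :=
  P.crit.opt (P.exactObjective m (Real.log s) b '' Set.Icc P.Wlo P.Whi)

theorem exactValue_eq {m : ℕ} (hm : m < P.M) (s b W : ℝ) :
    P.exactValue m s b = P.exactV (P.M - m) (Real.log s) b W := by
  obtain ⟨k, hk⟩ : ∃ k, P.M = m + 1 + k := ⟨P.M - (m + 1), by omega⟩
  have h1 : P.M - m = k + 1 := by omega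
  have h2 : P.M - (m + 1) = k := by omega
  have h3 : P.M - (k + 1) = m := by omega
  rw [h1]
  simp only [exactValue, exactV, h3]
  congr 2
  funext W'
  simp only [exactObjective, h2]

/-- The interior domain `{(s, b) | (ln s, b) ∈ Ω_in}`. -/
def interiorDomain : Set (ℝ × ℝ) :=
  {x | 0 < x.1 ∧ P.ymin < Real.log x.1 ∧ Real.log x.1 < P.ymax ∧ 0 ≤ x.2 ∧ x.2 ≤ P.bmax}

/-! ### The numerical scheme -/

/-- One discretization: `ny` equal subintervals of `[ylo, yhi]`, partitions of `[0, bmax]`, of the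
control set `[0, 1]` and of the threshold domain `[Wlo, Whi]` into `nb`, `nu`, `nw` subintervals,
and the truncation index `ng` of the density series. -/
structure Grid (P : MeanRiskProblem) where
  ny : ℕ
  nb : ℕ
  nu : ℕ
  nw : ℕ
  ng : ℕ
  b : ℕ → ℝ
  u : ℕ → ℝ
  W : ℕ → ℝ
  ny_pos : 0 < ny
  b_zero : b 0 = 0
  b_last : b nb = P.bmax
  b_lt : ∀ j < nb, b j < b (j + 1)
  u_zero : u 0 = 0
  u_last : u nu = 1
  u_lt : ∀ i < nu, u i < u (i + 1)
  W_zero : W 0 = P.Wlo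
  W_last : W nw = P.Whi
  W_lt : ∀ k < nw, W k < W (k + 1)

/-- The discretization parameter of the sequence of grids tends to zero: the mesh sizes tend to
zero (so that all numbers of nodes tend to infinity) and the truncation index to infinity. -/
structure Refining {P : MeanRiskProblem} (G : ℕ → P.Grid) : Prop where
  ny : Tendsto (fun k => (G k).ny) atTop atTop
  ng : Tendsto (fun k => (G k).ng) atTop atTop
  b : ∀ ε > 0, ∀ᶠ k in atTop, ∀ j < (G k).nb, (G k).b (j + 1) - (G k).b j < ε
  u : ∀ ε > 0, ∀ᶠ k in atTop, ∀ i < (G k).nu, (G k).u (i + 1) - (G k).u i < ε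
  W : ∀ ε > 0, ∀ᶠ k in atTop, ∀ i < (G k).nw, (G k).W (i + 1) - (G k).W i < ε

/-- Piecewise linear interpolation at `x` of the values `v i` at the nodes `a 0 < ⋯ < a n`
(constant outside `[a 0, a n]`). On `[a i, a (i + 1)]` the summands before the `i`-th one are full
increments, the later ones vanish. -/
def linInterp (n : ℕ) (a v : ℕ → ℝ) (x : ℝ) : ℝ :=
  v 0 + ∑ i ∈ Finset.range n, (v (i + 1) - v i) * max 0 (min 1 ((x - a i) / (a (i + 1) - a i)))

namespace Grid

variable {P : MeanRiskProblem} (G : P.Grid)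

/-- Mesh size in `y`. -/
def Δy : ℝ := (P.yhi - P.ylo) / G.ny

/-- The nodes `y 0, …, y ny` of `[ylo, yhi]`. -/
def y (n : ℕ) : ℝ := P.ylo + n * G.Δy

/-- Composite trapezoidal weights. -/
def weight (l : ℕ) : ℝ := if l = 0 ∨ l = G.ny then G.Δy / 2 else G.Δy

/-- Discrete interest settlement; grid functions are written `F n j k` for the value at
`(y n, b j, W k)`. -/
def settle (F : ℕ → ℕ → ℕ → ℝ) (n j k : ℕ) : ℝ :=
  max 1 (G.b j * Real.exp (P.r * P.Δt) / P.bmax) *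
    linInterp G.nb G.b (fun j' => F n j' k) (G.b j * Real.exp (P.r * P.Δt))

/-- Discrete convolution at the interior nodes, boundary conditions at the other ones. -/
def advance (F : ℕ → ℕ → ℕ → ℝ) (n j k : ℕ) : ℝ :=
  if G.y n ≤ P.ymin then G.settle F n j k
  else if P.ymax ≤ G.y n then Real.exp (P.μ * P.Δt) * G.settle F n j k
  else ∑ l ∈ Finset.range (G.ny + 1),
    G.weight l * P.densityTrunc G.ng (G.y n - G.y l) * G.settle F l j k

/-- Bilinear interpolation of a grid function at amounts `s, b ≥ 0`, extended outside `Ω` as in the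
exact problem. -/
def extend (F : ℕ → ℕ → ℕ → ℝ) (s b : ℝ) (k : ℕ) : ℝ :=
  P.growth s b *
    linInterp G.nb G.b (fun j => linInterp G.ny G.y (fun n => F n j k) (P.logAmount s)) b

/-- Exhaustive search over the control nodes at `t_m`, at the node `(y n, b j)` and for the
threshold `W k`. -/
def controlOpt (m : ℕ) (F : ℕ → ℕ → ℕ → ℝ) (n j k : ℕ) : ℝ :=
  P.crit.opt ((fun i => G.extend F (G.u i * P.wealth m (G.y n) (G.b j))
    ((1 - G.u i) * P.wealth m (G.y n) (G.b j)) k) '' Set.Iic G.nu)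

/-- The computed function `V̂_h (y n, b j, W k, t_m)` with `m = M - i`, by backward recursion in the
number `i` of rebalancing times left. -/
def numV : ℕ → ℕ → ℕ → ℕ → ℝ
  | 0 => fun n j k => P.crit.payoff (Real.exp (G.y n) + G.b j) (G.W k)
  | i + 1 => fun n j _ =>
      P.crit.opt (G.controlOpt (P.M - (i + 1)) (G.advance (numV i)) n j '' Set.Iic G.nw)

/-- The computed objective `Û_h (y n, b j, W k, t_m⁺)` of the threshold search at `t_m`. -/
def numObjective (m n j k : ℕ) : ℝ :=
  G.controlOpt m (G.advance (G.numV (P.M - (m + 1)))) n j k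

/-- The threshold node `W k` is optimal in the exhaustive search at `t_m`, at `(y n, b j)`. -/
def IsOptimalThreshold (m n j k : ℕ) : Prop :=
  k ≤ G.nw ∧ ∀ k' ≤ G.nw, P.crit.AsGood (G.numObjective m n j k) (G.numObjective m n j k')

/-- `(y n, b j)` is a grid node in the interior domain. -/
def IsInteriorNode (n j : ℕ) : Prop :=
  n ≤ G.ny ∧ j ≤ G.nb ∧ P.ymin < G.y n ∧ G.y n < P.ymax

end Grid

end MeanRiskProblem

end

namespace MeanRiskProblem

/-! ### Piecewise linear interpolation and partitions -/

/-! At a rebalancing date every split of the total wealth is available, so the functions of the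
backward recursion depend on `(y, b)` only through `e^y + b`. A sign turns both criteria into
minimizations. The exact and the computed recursions thus become `wealthFn` and `searchFn`.

The functions `wealthFn k` need not be continuous: the boundary conditions make `advance` jump at
`ymin` and `ymax`, and a region of risky amounts becomes available only once the wealth suffices.
But jumps go one way. Surplus wealth can be left in the bank, so a normalized value satisfies `f x'
≤ f x + C (x' - x)` for `x ≤ x'`: it can only jump downward (`Regular.objective_le_of_le`). Moreover
it is Lipschitz in both directions above a level `J` that grows by the factor `e^{|r|Δt}` per period
(`Regular.objective_le_of_ge`). The size of `bmax` ensures that whenever the cap on the bank account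
binds, the wealth has reached that level. `Regular` records these properties and
`Regular.wealthValue` passes them on.

Such an `f` is antitone up to a linear term, hence its translations are Lipschitz in L¹
(`integral_abs_shift_le`). Convolution with the Lipschitz density is therefore Lipschitz in the
state, although `f` may jump (`Regular.integral_settle_le`).

Near a jump, values at slightly different wealths compare in one direction only. The error of the
scheme is therefore measured by an enclosure with shifts, `Grid.Close`: `f (x + σ) - ε ≤ F ≤ f (x -
σ) + ε`. Interpolation, quadrature and rounding of the controls displace the wealth by multiples of
the mesh `θ`, and enlarging `σ` absorbs these displacements. One step of the scheme keeps `σ` and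
`ε` of order `θ` (`Regular.close_searchThreshold`). The computed value ends up between `v (w + Sθ) -
Tθ` and `v (w - Sθ) + Tθ`, and continuity of `v` at the limiting wealth gives the first claim.

Computed thresholds accumulate in the compact interval `Γ`. Before the last rebalancing the
continuation value no longer contains a threshold, so the exact objective is constant in `W` and any
limit is optimal. At the last rebalancing the continuation is the Lipschitz payoff, so
`Regular.objective_le_of_ge` applies with `J = 0` and controls the objective to the right of the
limiting wealth. This allows passage to the limit (`objective_le_wealthValue_of_tendsto`). -/

theorem linInterp_of_last_le {n : ℕ} {a v : ℕ → ℝ} (ha : ∀ i < n, a i < a (i + 1)) {x : ℝ}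
    (hx : a n ≤ x) : linInterp n a v x = v n := by
  induction n with
  | zero => simp [linInterp]
  | succ n ih =>
    have h1 := ha n (by omega)
    have h2 := ih (fun i hi => ha i (by omega)) (by linarith)
    simp only [linInterp, Finset.sum_range_succ] at h2 ⊢
    have h3 : 1 ≤ (x - a n) / (a (n + 1) - a n) := by
      rw [le_div_iff₀ (by linarith)]; linarith
    rw [min_eq_left h3, max_eq_right zero_le_one]
    linarith

theorem linInterp_eq_convex_combination {n : ℕ} {a v : ℕ → ℝ} (ha : ∀ i < n, a i < a (i + 1))
    (x : ℝ) :
    (x ≤ a 0 ∧ linInterp n a v x = v 0) ∨ (a n ≤ x ∧ linInterp n a v x = v n) ∨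
      ∃ i < n, ∃ t : ℝ, 0 ≤ t ∧ t ≤ 1 ∧ a i ≤ x ∧ x ≤ a (i + 1) ∧
        linInterp n a v x = (1 - t) * v i + t * v (i + 1) := by
  induction n with
  | zero => rcases le_total x (a 0) with h | h <;> simp [linInterp, h]
  | succ n ih =>
    have h1 := ha n (by omega)
    rcases le_total x (a n) with h | h
    · have hz : linInterp (n + 1) a v x = linInterp n a v x := by
        simp only [linInterp, Finset.sum_range_succ]
        have h3 : (x - a n) / (a (n + 1) - a n) ≤ 0 :=
          div_nonpos_of_nonpos_of_nonneg (by linarith) (by linarith)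
        rw [max_eq_left (min_le_of_right_le h3)]
        ring
      rw [hz]
      rcases ih (fun i hi => ha i (by omega)) with h' | h' | ⟨i, hi, t, h'⟩
      · exact Or.inl h'
      · refine Or.inr (Or.inr ⟨n, by omega, 0, le_rfl, zero_le_one, h'.1, by linarith, ?_⟩)
        rw [h'.2]; ring
      · exact Or.inr (Or.inr ⟨i, by omega, t, h'⟩)
    · rcases le_total (a (n + 1)) x with h' | h'
      · exact Or.inr (Or.inl ⟨h', linInterp_of_last_le ha h'⟩)
      · refine Or.inr (Or.inr ⟨n, by omega, (x - a n) / (a (n + 1) - a n),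
          div_nonneg (by linarith) (by linarith), ?_, h, h', ?_⟩)
        · rw [div_le_one (by linarith)]; linarith
        · have h2 := linInterp_of_last_le (v := v) (fun i hi => ha i (by omega)) h
          simp only [linInterp, Finset.sum_range_succ] at h2 ⊢
          rw [min_eq_right ((div_le_one (by linarith)).2 (by linarith)),
            max_eq_right (div_nonneg (by linarith) (by linarith))]
          linarith

theorem partition_mono {n : ℕ} {a : ℕ → ℝ} (ha : ∀ i < n, a i < a (i + 1)) {i j : ℕ}
    (hij : i ≤ j) (hj : j ≤ n) : a i ≤ a j := by
  induction j, hij using Nat.le_induction with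
  | base => exact le_rfl
  | succ k hk ih => exact (ih (by omega)).trans (ha k (by omega)).le

/-- An interpolated value is a convex combination of the values at the ends of the cell containing
the clamped point. One-sided bounds at nodes within one mesh width therefore suffice; no regularity
of the interpolated values is used. -/
theorem linInterp_le {n : ℕ} {a v : ℕ → ℝ} (ha : ∀ i < n, a i < a (i + 1)) {θ x c : ℝ}
    (hθ : 0 ≤ θ) (hmesh : ∀ i < n, a (i + 1) - a i ≤ θ)
    (hv : ∀ i ≤ n, |a i - max (a 0) (min x (a n))| ≤ θ → v i ≤ c) :
    linInterp n a v x ≤ c := by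
  have h0n := partition_mono ha (Nat.zero_le n) le_rfl
  rcases linInterp_eq_convex_combination (v := v) ha x with h | h | ⟨i, hi, t, h0, h1, h2, h3, h4⟩
  · rw [h.2]
    refine hv 0 (Nat.zero_le _) ?_
    rw [max_eq_left (min_le_of_left_le h.1)]
    simpa using hθ
  · rw [h.2]
    refine hv n le_rfl ?_
    rw [min_eq_right h.1, max_eq_right h0n]
    simpa using hθ
  · have hm := hmesh i hi
    have e1 : max (a 0) (min x (a n)) = x := by
      rw [min_eq_left (h3.trans (partition_mono ha hi le_rfl)),
        max_eq_right ((partition_mono ha (Nat.zero_le i) hi.le).trans h2)]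
    have v1 := hv i hi.le (by rw [e1, abs_le]; constructor <;> linarith)
    have v2 := hv (i + 1) hi (by rw [e1, abs_le]; constructor <;> linarith)
    rw [h4]
    nlinarith

theorem linInterp_neg {n : ℕ} {a v : ℕ → ℝ} {x : ℝ} :
    linInterp n a (fun i => -v i) x = -linInterp n a v x := by
  simp only [linInterp, neg_add, ← Finset.sum_neg_distrib]
  congr 1
  exact Finset.sum_congr rfl fun i _ => by ring

theorem linInterp_const_mul {n : ℕ} {a v : ℕ → ℝ} {x c : ℝ} :
    linInterp n a (fun i => c * v i) x = c * linInterp n a v x := by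
  simp only [linInterp, mul_add, Finset.mul_sum]
  congr 1
  exact Finset.sum_congr rfl fun i _ => by ring

theorem le_linInterp {n : ℕ} {a v : ℕ → ℝ} (ha : ∀ i < n, a i < a (i + 1)) {θ x c : ℝ}
    (hθ : 0 ≤ θ) (hmesh : ∀ i < n, a (i + 1) - a i ≤ θ)
    (hv : ∀ i ≤ n, |a i - max (a 0) (min x (a n))| ≤ θ → c ≤ v i) :
    c ≤ linInterp n a v x := by
  have := linInterp_le (v := fun i => -v i) (c := -c) ha hθ hmesh
    (fun i hi h => neg_le_neg (hv i hi h))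
  rw [linInterp_neg] at this
  linarith

/-- Rounding down to a node, used for controls and for thresholds. -/
theorem exists_partition_point {n : ℕ} {a : ℕ → ℝ} {θ x : ℝ} (hθ : 0 ≤ θ)
    (hmesh : ∀ i < n, a (i + 1) - a i ≤ θ) (h0 : a 0 ≤ x) (hn : x ≤ a n) :
    ∃ i ≤ n, a i ≤ x ∧ x ≤ a i + θ := by
  induction n with
  | zero => exact ⟨0, le_rfl, h0, by linarith⟩
  | succ n ih =>
    rcases le_total x (a n) with h | h
    · obtain ⟨i, hi, h'⟩ := ih (fun i hi => hmesh i (by omega)) h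
      exact ⟨i, by omega, h'⟩
    · exact ⟨n, by omega, h, by linarith [hmesh n (by omega)]⟩

/-- Regrouping by cells, so that the quadrature can be compared with the integral cell by cell. -/
theorem sum_trapezoid (n : ℕ) (hn : 0 < n) (D : ℝ) (p : ℕ → ℝ) :
    ∑ l ∈ Finset.range (n + 1), (if l = 0 ∨ l = n then D / 2 else D) * p l =
      ∑ l ∈ Finset.range n, D / 2 * (p l + p (l + 1)) := by
  obtain ⟨n, rfl⟩ : ∃ k, n = k + 1 := ⟨n - 1, by omega⟩
  rw [Finset.sum_range_succ, Finset.sum_range_succ']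
  have h1 : ∑ k ∈ Finset.range n, (if k + 1 = 0 ∨ k + 1 = n + 1 then D / 2 else D) * p (k + 1) =
      ∑ k ∈ Finset.range n, D * p (k + 1) := by
    refine Finset.sum_congr rfl fun k hk => ?_
    have := Finset.mem_range.1 hk
    rw [if_neg (by omega)]
  have h2 : ∑ l ∈ Finset.range (n + 1), D / 2 * (p l + p (l + 1)) =
      D / 2 * (∑ l ∈ Finset.range (n + 1), p l) +
      D / 2 * ∑ l ∈ Finset.range (n + 1), p (l + 1) := by
    rw [← mul_add, ← Finset.sum_add_distrib, Finset.mul_sum]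
  rw [h1, h2, Finset.sum_range_succ' (fun l => p l), Finset.sum_range_succ (fun l => p (l + 1)),
    ← Finset.mul_sum]
  simp
  ring

/-! ### Functions whose upward variation is controlled -/

/-- Subtracting the linear term `C x` makes `f` antitone, hence integrable although it may be
discontinuous. -/
theorem intervalIntegrable_comp_exp {f : ℝ → ℝ} {C X : ℝ}
    (hstep : ∀ x ∈ Set.Icc 0 X, ∀ x' ∈ Set.Icc 0 X, x ≤ x' → f x' ≤ f x + C * (x' - x))
    {lo hi c : ℝ} (h : lo ≤ hi) (h0 : 0 ≤ Real.exp lo + c) (h1 : Real.exp hi + c ≤ X) :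
    IntervalIntegrable (fun y => f (Real.exp y + c)) volume lo hi := by
  have hmem : ∀ y ∈ Set.uIcc lo hi, Real.exp y + c ∈ Set.Icc 0 X := by
    intro y hy
    rw [Set.uIcc_of_le h] at hy
    have := Real.exp_le_exp.2 hy.1
    have := Real.exp_le_exp.2 hy.2
    constructor <;> linarith
  have ha : AntitoneOn (fun y => f (Real.exp y + c) - C * (Real.exp y + c)) (Set.uIcc lo hi) := by
    intro y hy y' hy' hyy
    have := hstep _ (hmem y hy) _ (hmem y' hy') (by linarith [Real.exp_le_exp.2 hyy])
    simp only
    linarith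
  have h2 : IntervalIntegrable (fun y => C * (Real.exp y + c)) volume lo hi := by
    apply Continuous.intervalIntegrable
    fun_prop
  convert ha.intervalIntegrable.add h2 using 1
  funext y
  simp

theorem intervalIntegrable_of_step {f : ℝ → ℝ} {C X : ℝ}
    (hstep : ∀ x ∈ Set.Icc 0 X, ∀ x' ∈ Set.Icc 0 X, x ≤ x' → f x' ≤ f x + C * (x' - x))
    {lo hi : ℝ} (h0 : lo ∈ Set.Icc 0 X) (h1 : hi ∈ Set.Icc 0 X) :
    IntervalIntegrable f volume lo hi := by
  have hmem : Set.uIcc lo hi ⊆ Set.Icc 0 X := Set.uIcc_subset_Icc h0 h1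
  have ha : AntitoneOn (fun y => f y - C * y) (Set.uIcc lo hi) := by
    intro y hy y' hy' hyy
    have := hstep _ (hmem hy) _ (hmem hy') hyy
    simp only
    linarith
  have h2 : IntervalIntegrable (fun y => C * y) volume lo hi := by
    apply Continuous.intervalIntegrable
    fun_prop
  convert ha.intervalIntegrable.add h2 using 1
  funext y
  simp

/-- The substitution goes through the image formula for injective maps, which asks nothing of `g`.
-/
theorem intervalIntegral_exp_mul_comp_exp (g : ℝ → ℝ) {lo hi : ℝ} (h : lo ≤ hi) :
    ∫ y in lo..hi, Real.exp y * g (Real.exp y) = ∫ x in Real.exp lo..Real.exp hi, g x := by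
  have himg : Real.exp '' Set.Icc lo hi = Set.Icc (Real.exp lo) (Real.exp hi) := by
    ext x
    constructor
    · rintro ⟨y, hy, rfl⟩
      exact ⟨Real.exp_le_exp.2 hy.1, Real.exp_le_exp.2 hy.2⟩
    · intro hx
      have hx0 : 0 < x := (Real.exp_pos lo).trans_le hx.1
      exact ⟨Real.log x, ⟨(Real.le_log_iff_exp_le hx0).2 hx.1, (Real.log_le_iff_le_exp hx0).2 hx.2⟩,
        Real.exp_log hx0⟩
  have := integral_image_eq_integral_abs_deriv_smul (s := Set.Icc lo hi) measurableSet_Icc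
    (fun x _ => (Real.hasDerivAt_exp x).hasDerivWithinAt) Real.exp_injective.injOn g
  rw [himg] at this
  rw [intervalIntegral.integral_of_le h, intervalIntegral.integral_of_le (Real.exp_le_exp.2 h),
    ← integral_Icc_eq_integral_Ioc, ← integral_Icc_eq_integral_Ioc, this]
  simp [abs_of_pos (Real.exp_pos _)]

/-- The increment over a shift `d` is at most `C d`, so its absolute value is the nonnegative
quantity `φ` (the decrement plus `C d`) up to another `C d`. The integral of the decrement
telescopes to two end pieces of length `d`, each at most `C d`. These pieces give the `2` in the
constant, the term `C d` inside `φ` gives `e^hi - e^lo`, and the second `C d` gives `hi - lo`. -/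
theorem integral_abs_shift_le_of_le {f : ℝ → ℝ} {C X : ℝ} (hC : 0 ≤ C)
    (hbd : ∀ x ∈ Set.Icc 0 X, |f x| ≤ C)
    (hstep : ∀ x ∈ Set.Icc 0 X, ∀ x' ∈ Set.Icc 0 X, x ≤ x' → f x' ≤ f x + C * (x' - x))
    {lo hi c₀ c₁ : ℝ} (h : lo ≤ hi) (hc : c₀ ≤ c₁) (h0 : 0 ≤ Real.exp lo + c₀)
    (h1 : Real.exp hi + c₁ ≤ X) :
    ∫ y in lo..hi, |f (Real.exp y + c₁) - f (Real.exp y + c₀)| ≤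
      C * (hi - lo + Real.exp (-lo) * (2 + (Real.exp hi - Real.exp lo))) * (c₁ - c₀) := by
  set d := c₁ - c₀ with hd
  have hd0 : 0 ≤ d := by linarith
  have hehi : Real.exp lo ≤ Real.exp hi := Real.exp_le_exp.2 h
  have i0 := intervalIntegrable_comp_exp hstep (c := c₀) h h0 (by linarith)
  have i1 := intervalIntegrable_comp_exp hstep (c := c₁) h (by linarith) h1
  set φ : ℝ → ℝ := fun x => f (x + c₀) - f (x + c₁) + C * d with hφ
  have hφ0 : ∀ y ∈ Set.Icc lo hi, 0 ≤ φ (Real.exp y) := by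
    intro y hy
    have e1 := Real.exp_le_exp.2 hy.1
    have e2 := Real.exp_le_exp.2 hy.2
    have := hstep (Real.exp y + c₀) ⟨by linarith, by linarith⟩ (Real.exp y + c₁)
      ⟨by linarith, by linarith⟩ (by linarith)
    have e3 : Real.exp y + c₁ - (Real.exp y + c₀) = d := by rw [hd]; ring
    rw [e3] at this
    simp only [hφ]; linarith
  have iφ : IntervalIntegrable (fun y => φ (Real.exp y)) volume lo hi :=
    (i0.sub i1).add intervalIntegrable_const
  have iφe : IntervalIntegrable (fun y => Real.exp y * φ (Real.exp y)) volume lo hi :=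
    iφ.continuousOn_mul Real.continuous_exp.continuousOn
  have s1 : ∫ y in lo..hi, |f (Real.exp y + c₁) - f (Real.exp y + c₀)| ≤
      ∫ y in lo..hi, (Real.exp (-lo) * (Real.exp y * φ (Real.exp y)) + C * d) := by
    refine intervalIntegral.integral_mono_on h ((i1.sub i0).abs)
      ((iφe.const_mul _).add intervalIntegrable_const) fun y hy => ?_
    have p0 := hφ0 y hy
    -- The weight `e^(y - lo) ≥ 1` inserts the Jacobian `e^y` needed for the substitution `x = e^y`;
    -- this is where `0 ≤ φ` is used.
    have p1 : 1 ≤ Real.exp (-lo) * Real.exp y := by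
      rw [← Real.exp_add]; exact Real.one_le_exp (by linarith [hy.1])
    have p2 : φ (Real.exp y) ≤ Real.exp (-lo) * Real.exp y * φ (Real.exp y) :=
      le_mul_of_one_le_left p0 p1
    have p3 : 0 ≤ C * d := mul_nonneg hC hd0
    simp only [hφ] at p0 p2 ⊢
    rw [abs_le]
    constructor <;> nlinarith
  have m1 : Real.exp lo + c₀ ∈ Set.Icc 0 X := ⟨by linarith, by linarith⟩
  have m2 : Real.exp lo + c₁ ∈ Set.Icc 0 X := ⟨by linarith, by linarith⟩
  have m3 : Real.exp hi + c₀ ∈ Set.Icc 0 X := ⟨by linarith, by linarith⟩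
  have m4 : Real.exp hi + c₁ ∈ Set.Icc 0 X := ⟨by linarith, by linarith⟩
  have j0 : IntervalIntegrable (fun x => f (x + c₀)) volume (Real.exp lo) (Real.exp hi) := by
    simpa using (intervalIntegrable_of_step hstep m1 m3).comp_add_right c₀
  have j1 : IntervalIntegrable (fun x => f (x + c₁)) volume (Real.exp lo) (Real.exp hi) := by
    simpa using (intervalIntegrable_of_step hstep m2 m4).comp_add_right c₁
  have bnd : ∀ u ∈ Set.Icc 0 X, ∀ v ∈ Set.Icc 0 X, |∫ x in u..v, f x| ≤ C * |v - u| := by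
    intro u hu v hv
    have := intervalIntegral.norm_integral_le_of_norm_le_const (f := f) (C := C) (a := u) (b := v)
      fun x hx => hbd x (Set.uIcc_subset_Icc hu hv (Set.uIoc_subset_uIcc hx))
    simpa only [Real.norm_eq_abs] using this
  have s2 : ∫ y in lo..hi, Real.exp y * φ (Real.exp y) ≤
      C * (2 + (Real.exp hi - Real.exp lo)) * d := by
    rw [intervalIntegral_exp_mul_comp_exp φ h]
    simp only [hφ]
    rw [intervalIntegral.integral_add (j0.sub j1) intervalIntegrable_const,
      intervalIntegral.integral_sub j0 j1, intervalIntegral.integral_comp_add_right,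
      intervalIntegral.integral_comp_add_right, intervalIntegral.integral_const]
    -- Cancellation over the common part of the two shifted intervals leaves only the end pieces.
    have k1 := intervalIntegral.integral_interval_sub_interval_comm
      (intervalIntegrable_of_step hstep m1 m3) (intervalIntegrable_of_step hstep m2 m4)
      (intervalIntegrable_of_step hstep m1 m2)
    rw [k1]
    have b1 := abs_le.1 (bnd _ m1 _ m2)
    have b2 := abs_le.1 (bnd _ m3 _ m4)
    have e1 : Real.exp lo + c₁ - (Real.exp lo + c₀) = d := by rw [hd]; ring
    have e2 : Real.exp hi + c₁ - (Real.exp hi + c₀) = d := by rw [hd]; ring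
    rw [e1, abs_of_nonneg hd0] at b1
    rw [e2, abs_of_nonneg hd0] at b2
    simp only [smul_eq_mul]
    nlinarith [b1.1, b1.2, b2.1, b2.2]
  refine s1.trans ?_
  rw [intervalIntegral.integral_add (iφe.const_mul _) intervalIntegrable_const,
    intervalIntegral.integral_const_mul, intervalIntegral.integral_const, smul_eq_mul]
  have := mul_le_mul_of_nonneg_left s2 (Real.exp_pos (-lo)).le
  nlinarith

theorem integral_abs_shift_le {f : ℝ → ℝ} {C X : ℝ} (hC : 0 ≤ C)
    (hbd : ∀ x ∈ Set.Icc 0 X, |f x| ≤ C)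
    (hstep : ∀ x ∈ Set.Icc 0 X, ∀ x' ∈ Set.Icc 0 X, x ≤ x' → f x' ≤ f x + C * (x' - x))
    {lo hi c₀ c₁ : ℝ} (h : lo ≤ hi) (h0 : 0 ≤ Real.exp lo + c₀) (h0' : 0 ≤ Real.exp lo + c₁)
    (h1 : Real.exp hi + c₀ ≤ X) (h1' : Real.exp hi + c₁ ≤ X) :
    ∫ y in lo..hi, |f (Real.exp y + c₁) - f (Real.exp y + c₀)| ≤
      C * (hi - lo + Real.exp (-lo) * (2 + (Real.exp hi - Real.exp lo))) * |c₁ - c₀| := by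
  rcases le_total c₀ c₁ with hc | hc
  · rw [abs_of_nonneg (by linarith : 0 ≤ c₁ - c₀)]
    exact integral_abs_shift_le_of_le hC hbd hstep h hc h0 h1'
  · rw [abs_sub_comm c₁, abs_of_nonneg (by linarith : 0 ≤ c₀ - c₁)]
    simp_rw [abs_sub_comm (f (Real.exp _ + c₁))]
    exact integral_abs_shift_le_of_le hC hbd hstep h hc h0' h1

/-! ### The transition density -/

theorem gaussianPDFReal_le (m : ℝ) (v : NNReal) (x : ℝ) :
    gaussianPDFReal m v x ≤ (√(2 * Real.pi * v))⁻¹ := by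
  rw [gaussianPDFReal]
  refine mul_le_of_le_one_right (by positivity) (Real.exp_le_one_iff.2 ?_)
  exact div_nonpos_of_nonpos_of_nonneg (by nlinarith [sq_nonneg (x - m)]) (by positivity)

/-- With `t` the distance to the mean, the factor `|t| / v` in the derivative is at most `(1 + 1/v)
(1 + t²/(2v))`, and `e^{-x} (1 + x) ≤ 1` absorbs the quadratic term. -/
theorem abs_gaussianPDFReal_sub_le (m : ℝ) {v : NNReal} (hv : 0 < v) (x y : ℝ) :
    |gaussianPDFReal m v x - gaussianPDFReal m v y| ≤
      (√(2 * Real.pi * v))⁻¹ * (1 + 1 / (v : ℝ)) * |x - y| := by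
  have hv' : (0 : ℝ) < v := by exact_mod_cast hv
  have hd : ∀ z ∈ (Set.univ : Set ℝ), HasDerivWithinAt (gaussianPDFReal m v)
      ((√(2 * Real.pi * v))⁻¹ *
        (Real.exp (-(z - m) ^ 2 / (2 * v)) * (-(2 * (z - m)) / (2 * v)))) Set.univ z := by
    intro z _
    rw [gaussianPDFReal_def]
    have h1 : HasDerivAt (fun x : ℝ => -(x - m) ^ 2 / (2 * v)) (-(2 * (z - m)) / (2 * v)) z := by
      have := ((((hasDerivAt_id z).sub_const m).pow 2).neg).div_const (2 * (v : ℝ))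
      simpa using this
    exact (h1.exp.const_mul _).hasDerivWithinAt
  have hb : ∀ z ∈ (Set.univ : Set ℝ), ‖(√(2 * Real.pi * v))⁻¹ *
        (Real.exp (-(z - m) ^ 2 / (2 * v)) * (-(2 * (z - m)) / (2 * v)))‖ ≤
      (√(2 * Real.pi * v))⁻¹ * (1 + 1 / (v : ℝ)) := by
    intro z _
    rw [norm_mul, Real.norm_of_nonneg (by positivity : 0 ≤ (√(2 * Real.pi * v))⁻¹)]
    refine mul_le_mul_of_nonneg_left ?_ (by positivity)
    set t := z - m
    have h1 : Real.exp (-t ^ 2 / (2 * v)) * (1 + t ^ 2 / (2 * v)) ≤ 1 := by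
      have h2 := Real.add_one_le_exp (t ^ 2 / (2 * v))
      have h3 : Real.exp (-t ^ 2 / (2 * v)) * Real.exp (t ^ 2 / (2 * v)) = 1 := by
        rw [← Real.exp_add, ← Real.exp_zero]; congr 1; ring
      nlinarith [Real.exp_pos (-t ^ 2 / (2 * v))]
    have h4 : |-(2 * t) / (2 * v)| ≤ (1 + 1 / (v : ℝ)) * (1 + t ^ 2 / (2 * v)) := by
      have e : |-(2 * t) / (2 * (v : ℝ))| = |t| / v := by
        rw [abs_div, abs_neg, abs_mul, abs_of_pos (by positivity : (0 : ℝ) < 2 * v)]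
        simp; field_simp
      rw [e, ← sq_abs t]
      have h5 : |t| / v ≤ 1 / (2 * v) + |t| ^ 2 / (2 * v) := by
        rw [← add_div, div_le_div_iff₀ hv' (by positivity)]
        nlinarith [sq_nonneg (|t| - 1)]
      have h6 : (1 : ℝ) / (2 * v) ≤ 1 / v := by
        apply one_div_le_one_div_of_le hv'; linarith
      have h7 : 0 ≤ |t| ^ 2 / (2 * (v : ℝ)) := by positivity
      have h8 : 0 ≤ 1 / (v : ℝ) := by positivity
      nlinarith
    rw [norm_mul, Real.norm_of_nonneg (Real.exp_pos _).le, Real.norm_eq_abs]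
    calc _ ≤ Real.exp (-t ^ 2 / (2 * v)) * ((1 + 1 / (v : ℝ)) * (1 + t ^ 2 / (2 * v))) :=
          mul_le_mul_of_nonneg_left h4 (Real.exp_pos _).le
      _ = (1 + 1 / (v : ℝ)) * (Real.exp (-t ^ 2 / (2 * v)) * (1 + t ^ 2 / (2 * v))) := by ring
      _ ≤ (1 + 1 / (v : ℝ)) * 1 := mul_le_mul_of_nonneg_left h1 (by positivity)
      _ = _ := mul_one _
  have := convex_univ.norm_image_sub_le_of_norm_hasDerivWithin_le hd hb
    (Set.mem_univ y) (Set.mem_univ x)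
  simpa [Real.norm_eq_abs] using this

variable (P : MeanRiskProblem)

theorem integrable_jumpDensity : Integrable P.jumpDensity := by
  have h1 : IntegrableOn (fun ζ => P.pup * P.η₁ * Real.exp (-P.η₁ * ζ)) (Set.Ici 0) := by
    rw [integrableOn_Ici_iff_integrableOn_Ioi]
    exact (integrableOn_exp_mul_Ioi (by linarith [P.one_lt_η₁]) 0).const_mul _
  have h2 : IntegrableOn (fun ζ => (1 - P.pup) * P.η₂ * Real.exp (P.η₂ * ζ)) (Set.Iio 0) := by
    refine IntegrableOn.mono_set ?_ Set.Iio_subset_Iic_self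
    exact (integrableOn_exp_mul_Iic P.η₂_pos 0).const_mul _
  refine ((h1.integrable_indicator measurableSet_Ici).add
    (h2.integrable_indicator measurableSet_Iio)).congr (ae_of_all _ fun ζ => ?_)
  by_cases h : 0 ≤ ζ
  · simp [jumpDensity, h]
  · simp [jumpDensity, h, not_le.1 h]

instance isFiniteMeasure_jumpLaw : IsFiniteMeasure P.jumpLaw :=
  isFiniteMeasure_withDensity_ofReal P.integrable_jumpDensity.2

instance isFiniteMeasure_jumpSumLaw (ℓ : ℕ) : IsFiniteMeasure (P.jumpSumLaw ℓ) := by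
  induction ℓ with
  | zero => unfold jumpSumLaw; infer_instance
  | succ ℓ ih => unfold jumpSumLaw; infer_instance

/-- Masses multiply under convolution. Finite mass of the jump law is all that the estimates need,
so its being a probability is never invoked. -/
theorem jumpSumLaw_real_univ (ℓ : ℕ) :
    (P.jumpSumLaw ℓ).real Set.univ = P.jumpLaw.real Set.univ ^ ℓ := by
  induction ℓ with
  | zero => simp [jumpSumLaw]
  | succ ℓ ih =>
    rw [pow_succ, ← ih, jumpSumLaw, Measure.conv, measureReal_def,
      Measure.map_apply (by fun_prop) MeasurableSet.univ, Set.preimage_univ, ← Set.univ_prod_univ, Measure.prod_prod,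
      ENNReal.toReal_mul]
    rfl

theorem Δt_pos : 0 < P.Δt := div_pos P.T_pos (by exact_mod_cast P.M_pos)

/-- The Gaussian factor in the contributions to the transition density. -/
noncomputable def diffusionPDF : ℝ → ℝ :=
  gaussianPDFReal ((P.μ - P.lam * P.kappa - P.σ ^ 2 / 2) * P.Δt) (Real.toNNReal (P.σ ^ 2 * P.Δt))

theorem densityTerm_eq (ℓ : ℕ) (x : ℝ) : P.densityTerm ℓ x =
    Real.exp (-(P.lam * P.Δt)) * (P.lam * P.Δt) ^ ℓ / (ℓ.factorial : ℝ) *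
      ∫ z, P.diffusionPDF (-x - z) ∂(P.jumpSumLaw ℓ) := rfl

theorem exists_diffusionPDF_bounds : ∃ A : ℝ, 0 ≤ A ∧
    (∀ x, 0 ≤ P.diffusionPDF x ∧ P.diffusionPDF x ≤ A) ∧
    ∀ x y, |P.diffusionPDF x - P.diffusionPDF y| ≤ A * |x - y| := by
  have hv : 0 < Real.toNNReal (P.σ ^ 2 * P.Δt) :=
    Real.toNNReal_pos.2 (mul_pos (pow_pos P.σ_pos 2) P.Δt_pos)
  have hv' : (0 : ℝ) < Real.toNNReal (P.σ ^ 2 * P.Δt) := by exact_mod_cast hv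
  refine ⟨_, ?_, fun x => ⟨gaussianPDFReal_nonneg _ _ x, (gaussianPDFReal_le _ _ x).trans ?_⟩,
    fun x y => abs_gaussianPDFReal_sub_le _ hv x y⟩
  · positivity
  · exact le_mul_of_one_le_right (by positivity) (by
      have : 0 ≤ 1 / (Real.toNNReal (P.σ ^ 2 * P.Δt) : ℝ) := by positivity
      linarith)

theorem integrable_diffusionPDF (ℓ : ℕ) (x : ℝ) :
    Integrable (fun z => P.diffusionPDF (-x - z)) (P.jumpSumLaw ℓ) := by
  obtain ⟨A, hA, hb, -⟩ := P.exists_diffusionPDF_bounds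
  refine Integrable.of_bound (C := A) ?_ (ae_of_all _ fun z => ?_)
  · have : Measurable P.diffusionPDF := measurable_gaussianPDFReal _ _
    exact (this.comp (by fun_prop)).aestronglyMeasurable
  · rw [Real.norm_of_nonneg (hb _).1]; exact (hb _).2

/-- Averaging the bounded Lipschitz Gaussian over a measure of mass `K ^ ℓ` keeps its bounds up to
that factor. The factorial in the Poisson weight makes the constants summable, being terms of an
exponential series. -/
theorem exists_densityTerm_bounds : ∃ c : ℕ → ℝ, Summable c ∧ (∀ ℓ, 0 ≤ c ℓ) ∧
    (∀ ℓ x, 0 ≤ P.densityTerm ℓ x ∧ P.densityTerm ℓ x ≤ c ℓ) ∧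
    ∀ ℓ x y, |P.densityTerm ℓ x - P.densityTerm ℓ y| ≤ c ℓ * |x - y| := by
  obtain ⟨A, hA, hb, hl⟩ := P.exists_diffusionPDF_bounds
  have hlam : 0 ≤ P.lam * P.Δt := mul_nonneg P.lam_nonneg P.Δt_pos.le
  set K := P.jumpLaw.real Set.univ with hK
  have hK0 : 0 ≤ K := measureReal_nonneg
  have hcoef : ∀ ℓ : ℕ,
      0 ≤ Real.exp (-(P.lam * P.Δt)) * (P.lam * P.Δt) ^ ℓ / (ℓ.factorial : ℝ) :=
    fun ℓ => by positivity
  have hc : ∀ ℓ : ℕ, Real.exp (-(P.lam * P.Δt)) * (P.lam * P.Δt) ^ ℓ / (ℓ.factorial : ℝ) *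
      (A * K ^ ℓ) =
      Real.exp (-(P.lam * P.Δt)) * A * ((P.lam * P.Δt * K) ^ ℓ / (ℓ.factorial : ℝ)) := fun ℓ => by
    rw [mul_pow]; ring
  refine ⟨fun ℓ => Real.exp (-(P.lam * P.Δt)) * (P.lam * P.Δt) ^ ℓ / (ℓ.factorial : ℝ) *
      (A * K ^ ℓ), ?_, fun ℓ => by positivity, fun ℓ x => ⟨?_, ?_⟩, fun ℓ x y => ?_⟩
  · simp_rw [hc]
    exact (Real.summable_pow_div_factorial _).mul_left _
  · rw [densityTerm_eq]
    exact mul_nonneg (hcoef ℓ) (integral_nonneg fun z => (hb _).1)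
  · rw [densityTerm_eq]
    refine mul_le_mul_of_nonneg_left ?_ (hcoef ℓ)
    calc _ ≤ ∫ _, A ∂(P.jumpSumLaw ℓ) :=
          integral_mono (P.integrable_diffusionPDF ℓ x) (integrable_const _) fun z => (hb _).2
      _ = _ := by rw [integral_const, jumpSumLaw_real_univ, smul_eq_mul, mul_comm]
  · rw [densityTerm_eq, densityTerm_eq, ← mul_sub, abs_mul, abs_of_nonneg (hcoef ℓ), mul_assoc]
    refine mul_le_mul_of_nonneg_left ?_ (hcoef ℓ)
    rw [← integral_sub (P.integrable_diffusionPDF ℓ x) (P.integrable_diffusionPDF ℓ y)]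
    calc _ ≤ A * |x - y| * (P.jumpSumLaw ℓ).real Set.univ := by
          refine norm_integral_le_of_norm_le_const (μ := P.jumpSumLaw ℓ)
            (f := fun z => P.diffusionPDF (-x - z) - P.diffusionPDF (-y - z))
            (ae_of_all _ fun z => ?_)
          refine (hl _ _).trans (le_of_eq ?_)
          rw [show -x - z - (-y - z) = y - x by ring, abs_sub_comm]
      _ = _ := by rw [jumpSumLaw_real_univ]; ring

/-- The summable majorant of the terms gives boundedness and the Lipschitz constant. Its tails do
not depend on `x`, so the truncation converges uniformly. -/
theorem exists_density_bounds : ∃ A : ℝ, 0 ≤ A ∧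
    (∀ x, 0 ≤ P.density x ∧ P.density x ≤ A) ∧
    (∀ x y, |P.density x - P.density y| ≤ A * |x - y|) ∧
    (∀ N x, 0 ≤ P.densityTrunc N x) ∧
    ∀ ε > 0, ∀ᶠ N in atTop, ∀ x, |P.densityTrunc N x - P.density x| ≤ ε := by
  obtain ⟨c, hc, hc0, hb, hl⟩ := P.exists_densityTerm_bounds
  have hs : ∀ x, Summable fun ℓ => P.densityTerm ℓ x := fun x =>
    Summable.of_nonneg_of_le (fun ℓ => (hb ℓ x).1) (fun ℓ => (hb ℓ x).2) hc
  refine ⟨∑' ℓ, c ℓ, tsum_nonneg hc0, fun x => ⟨tsum_nonneg fun ℓ => (hb ℓ x).1,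
    (hs x).tsum_le_tsum (fun ℓ => (hb ℓ x).2) hc⟩, fun x y => ?_,
    fun N x => Finset.sum_nonneg fun ℓ _ => (hb ℓ x).1, fun ε hε => ?_⟩
  · rw [density, density, ← (hs x).tsum_sub (hs y), ← tsum_mul_right]
    exact tsum_of_norm_bounded (f := fun ℓ => P.densityTerm ℓ x - P.densityTerm ℓ y)
      (hc.mul_right |x - y|).hasSum fun ℓ => hl ℓ x y
  · have ht := ((hc.hasSum.tendsto_sum_nat).comp (tendsto_add_atTop_nat 1))
    filter_upwards [ht.eventually (lt_mem_nhds (by linarith : (∑' ℓ, c ℓ) - ε < ∑' ℓ, c ℓ))] with N hN x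
    have h1 := (hs x).sum_add_tsum_nat_add (N + 1)
    have h2 := hc.sum_add_tsum_nat_add (N + 1)
    have h3 : ∑' i, P.densityTerm (i + (N + 1)) x ≤ ∑' i, c (i + (N + 1)) :=
      ((summable_nat_add_iff (N + 1)).2 (hs x)).tsum_le_tsum (fun ℓ => (hb _ x).2)
        ((summable_nat_add_iff (N + 1)).2 hc)
    have h4 : 0 ≤ ∑' i, P.densityTerm (i + (N + 1)) x := tsum_nonneg fun ℓ => (hb _ x).1
    simp only [Function.comp] at hN
    rw [abs_sub_comm, abs_le, density, densityTrunc]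
    constructor <;> linarith

end MeanRiskProblem

namespace MeanRiskProblem

variable (P : MeanRiskProblem)

/-! ### One-step comparison estimates for the exact recursion -/

/-- One-period growth factor of the bank account. -/
noncomputable def accrual : ℝ := Real.exp (P.r * P.Δt)

theorem accrual_pos : 0 < P.accrual := Real.exp_pos _

/-- Amount in the bank account after interest, capped at `bmax`. -/
noncomputable def cash (b : ℝ) : ℝ := min (b * P.accrual) P.bmax

/-- Upper end of the range of wealths that matter. -/
noncomputable def wealthCap : ℝ := Real.exp P.yhi + P.bmax + 1

theorem bmax_pos : 0 < P.bmax := (Real.exp_pos _).trans_le P.bmax_large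

theorem ylo_le_yhi : P.ylo ≤ P.yhi := (P.ylo_lt.trans (P.ymin_lt.trans P.ymax_lt)).le

/-- The function of the state whose value is `f` of the wealth shifted by `τ`. -/
noncomputable def liftWealth (f : ℝ → ℝ → ℝ) (τ : ℝ) : ℝ → ℝ → ℝ → ℝ :=
  fun y b W => f (Real.exp y + b + τ) W

/-- `f`, a function of wealth and threshold, is bounded, decreases or increases slowly in the
wealth, is Lipschitz in the wealth above `J`, and is Lipschitz in the threshold. -/
structure Regular (f : ℝ → ℝ → ℝ) (J C : ℝ) : Prop where
  nonneg : 0 ≤ C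
  bound : ∀ x ∈ Set.Icc 0 P.wealthCap, ∀ W ∈ Set.Icc P.Wlo P.Whi, |f x W| ≤ C
  step : ∀ x ∈ Set.Icc 0 P.wealthCap, ∀ x' ∈ Set.Icc 0 P.wealthCap, ∀ W ∈ Set.Icc P.Wlo P.Whi,
    x ≤ x' ∨ J ≤ x' → f x' W ≤ f x W + C * |x' - x|
  threshold : ∀ x ∈ Set.Icc 0 P.wealthCap, ∀ W ∈ Set.Icc P.Wlo P.Whi,
    ∀ W' ∈ Set.Icc P.Wlo P.Whi, |f x W - f x W'| ≤ C * |W - W'|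

/-- Shifts of the wealth that keep it in the range that matters. -/
def SmallShift (τ : ℝ) : Prop := |τ| ≤ Real.exp P.ylo ∧ |τ| ≤ 1

theorem smallShift_zero : P.SmallShift 0 := by
  simp [SmallShift, (Real.exp_pos _).le]

theorem cash_nonneg {b : ℝ} (hb : 0 ≤ b) : 0 ≤ P.cash b :=
  le_min (mul_nonneg hb P.accrual_pos.le) P.bmax_pos.le

theorem cash_le (b : ℝ) : P.cash b ≤ P.bmax := min_le_right _ _

theorem cash_mono {b b' : ℝ} (h : b ≤ b') : P.cash b ≤ P.cash b' :=
  min_le_min_right _ (mul_le_mul_of_nonneg_right h P.accrual_pos.le)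

theorem abs_cash_sub_le (b b' : ℝ) : |P.cash b - P.cash b'| ≤ P.accrual * |b - b'| := by
  have h := abs_min_sub_min_le_max (b * P.accrual) P.bmax (b' * P.accrual) P.bmax
  rw [sub_self, abs_zero, max_eq_left (abs_nonneg _), ← sub_mul, abs_mul,
    abs_of_pos P.accrual_pos] at h
  rw [mul_comm]; exact h

variable {P} in
theorem SmallShift.mem {τ y c : ℝ} (h : P.SmallShift τ) (hy : y ∈ Set.Icc P.ylo P.yhi)
    (hc : c ∈ Set.Icc 0 P.bmax) : Real.exp y + c + τ ∈ Set.Icc 0 P.wealthCap := by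
  have h1 := abs_le.1 h.1
  have h2 := abs_le.1 h.2
  have h3 := Real.exp_le_exp.2 hy.1
  have h4 := Real.exp_le_exp.2 hy.2
  refine ⟨?_, ?_⟩
  · linarith [hc.1]
  · simp only [wealthCap]; linarith [hc.2]

theorem cash_mem {b : ℝ} (hb : b ∈ Set.Icc 0 P.bmax) : P.cash b ∈ Set.Icc 0 P.bmax :=
  ⟨P.cash_nonneg hb.1, P.cash_le b⟩

theorem settle_liftWealth (f : ℝ → ℝ → ℝ) (τ y b W : ℝ) : P.settle (liftWealth f τ) y b W =
    max 1 (b * P.accrual / P.bmax) * f (Real.exp y + P.cash b + τ) W := rfl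

theorem abs_max_one_sub_le (x y : ℝ) : |max 1 x - max 1 y| ≤ |x - y| := by
  simpa only [max_comm] using abs_max_sub_max_le_abs x y 1

theorem settleFactor_mem {b : ℝ} (hb : b ∈ Set.Icc 0 P.bmax) :
    max 1 (b * P.accrual / P.bmax) ∈ Set.Icc 1 (1 + P.accrual) := by
  have := P.accrual_pos
  refine ⟨le_max_left _ _, max_le (by linarith) ?_⟩
  rw [div_le_iff₀ P.bmax_pos]
  nlinarith [hb.2, P.bmax_pos]

theorem abs_settleFactor_sub_le (b b' : ℝ) :
    |max 1 (b * P.accrual / P.bmax) - max 1 (b' * P.accrual / P.bmax)| ≤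
      P.accrual / P.bmax * |b - b'| := by
  refine (abs_max_one_sub_le _ _).trans (le_of_eq ?_)
  rw [← sub_div, ← sub_mul, abs_div, abs_mul, abs_of_pos P.accrual_pos, abs_of_pos P.bmax_pos]
  ring

variable {P} {f : ℝ → ℝ → ℝ} {J C : ℝ}

/-- The disjunction on the settled wealths is exactly what `Regular.step` requires. The settlement
factor and the capped cash are Lipschitz in `b`, which accounts for the rest of the error. -/
theorem Regular.settle_le (hf : P.Regular f J C) : ∃ K : ℝ, 0 ≤ K ∧
    ∀ y₀ ∈ Set.Icc P.ylo P.yhi, ∀ y₁ ∈ Set.Icc P.ylo P.yhi, ∀ b₀ ∈ Set.Icc 0 P.bmax,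
    ∀ b₁ ∈ Set.Icc 0 P.bmax, ∀ W ∈ Set.Icc P.Wlo P.Whi, ∀ τ₀ τ₁ : ℝ, P.SmallShift τ₀ →
    P.SmallShift τ₁ →
    (Real.exp y₀ + P.cash b₀ + τ₀ ≤ Real.exp y₁ + P.cash b₁ + τ₁ ∨
      J ≤ Real.exp y₁ + P.cash b₁ + τ₁) →
    P.settle (liftWealth f τ₁) y₁ b₁ W ≤ P.settle (liftWealth f τ₀) y₀ b₀ W +
      K * (|Real.exp y₁ - Real.exp y₀| + |b₁ - b₀| + |τ₁ - τ₀|) := by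
  have ha := P.accrual_pos
  have hb := P.bmax_pos
  have hC := hf.nonneg
  refine ⟨(1 + P.accrual) * C * (1 + P.accrual) + P.accrual / P.bmax * C, by positivity, ?_⟩
  intro y₀ hy₀ y₁ hy₁ b₀ hb₀ b₁ hb₁ W hW τ₀ τ₁ hτ₀ hτ₁ hcond
  rw [settle_liftWealth, settle_liftWealth]
  have m0 := hτ₀.mem hy₀ (P.cash_mem hb₀)
  have m1 := hτ₁.mem hy₁ (P.cash_mem hb₁)
  have hs := hf.step _ m0 _ m1 W hW hcond
  have hbd := hf.bound _ m0 W hW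
  have k1 := P.settleFactor_mem hb₁
  have k0 := P.abs_settleFactor_sub_le b₁ b₀
  have hcash := P.abs_cash_sub_le b₁ b₀
  set p₁ := max 1 (b₁ * P.accrual / P.bmax)
  set p₀ := max 1 (b₀ * P.accrual / P.bmax)
  set f₁ := f (Real.exp y₁ + P.cash b₁ + τ₁) W
  set f₀ := f (Real.exp y₀ + P.cash b₀ + τ₀) W
  set D := |Real.exp y₁ - Real.exp y₀| + |b₁ - b₀| + |τ₁ - τ₀| with hD
  have d1 : |Real.exp y₁ + P.cash b₁ + τ₁ - (Real.exp y₀ + P.cash b₀ + τ₀)| ≤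
      (1 + P.accrual) * D := by
    have e : Real.exp y₁ + P.cash b₁ + τ₁ - (Real.exp y₀ + P.cash b₀ + τ₀) =
      (Real.exp y₁ - Real.exp y₀) + (P.cash b₁ - P.cash b₀) + (τ₁ - τ₀) := by ring
    rw [e]
    refine (abs_add_three _ _ _).trans ?_
    rw [hD]
    nlinarith [abs_nonneg (Real.exp y₁ - Real.exp y₀), abs_nonneg (b₁ - b₀),
      abs_nonneg (τ₁ - τ₀)]
  have d2 : |b₁ - b₀| ≤ D := by
    rw [hD]; linarith [abs_nonneg (Real.exp y₁ - Real.exp y₀), abs_nonneg (τ₁ - τ₀)]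
  have hD0 : 0 ≤ D := (abs_nonneg _).trans d2
  have s1 : p₁ * (f₁ - f₀) ≤ (1 + P.accrual) * (C * ((1 + P.accrual) * D)) := by
    have t1 : f₁ - f₀ ≤ C * ((1 + P.accrual) * D) := by
      have := mul_le_mul_of_nonneg_left d1 hC
      linarith
    have t0 : 0 ≤ C * ((1 + P.accrual) * D) := by positivity
    calc _ ≤ p₁ * (C * ((1 + P.accrual) * D)) :=
          mul_le_mul_of_nonneg_left t1 (by linarith [k1.1])
      _ ≤ _ := mul_le_mul_of_nonneg_right k1.2 t0
  have s2 : (p₁ - p₀) * f₀ ≤ P.accrual / P.bmax * D * C := by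
    refine (le_abs_self _).trans ?_
    rw [abs_mul]
    refine mul_le_mul (k0.trans ?_) hbd (abs_nonneg _) (by positivity)
    exact mul_le_mul_of_nonneg_left d2 (by positivity)
  have e : p₁ * f₁ = p₀ * f₀ + (p₁ * (f₁ - f₀) + (p₁ - p₀) * f₀) := by ring
  rw [e]
  linarith

theorem Regular.abs_settle_le (hf : P.Regular f J C) {y b W τ : ℝ} (hy : y ∈ Set.Icc P.ylo P.yhi)
    (hb : b ∈ Set.Icc 0 P.bmax) (hW : W ∈ Set.Icc P.Wlo P.Whi) (hτ : P.SmallShift τ) :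
    |P.settle (liftWealth f τ) y b W| ≤ (1 + P.accrual) * C := by
  rw [settle_liftWealth, abs_mul]
  have k := P.settleFactor_mem hb
  rw [abs_of_nonneg (by linarith [k.1])]
  exact mul_le_mul k.2 (hf.bound _ (hτ.mem hy (P.cash_mem hb)) W hW) (abs_nonneg _)
    (by linarith [P.accrual_pos])

theorem Regular.intervalIntegrable_settle (hf : P.Regular f J C) {b W τ : ℝ}
    (hb : b ∈ Set.Icc 0 P.bmax) (hW : W ∈ Set.Icc P.Wlo P.Whi) (hτ : P.SmallShift τ) :
    IntervalIntegrable (fun y => P.settle (liftWealth f τ) y b W) volume P.ylo P.yhi := by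
  simp only [settle_liftWealth, add_assoc]
  refine (intervalIntegrable_comp_exp (f := fun x => f x W) (C := C) (X := P.wealthCap)
    (fun x hx x' hx' hxx => ?_) P.ylo_le_yhi ?_ ?_).const_mul _
  · simpa [abs_of_nonneg (sub_nonneg.2 hxx)] using hf.step x hx x' hx' W hW (Or.inl hxx)
  · have := (hτ.mem (Set.left_mem_Icc.2 P.ylo_le_yhi) (P.cash_mem hb)).1
    linarith
  · have := (hτ.mem (Set.right_mem_Icc.2 P.ylo_le_yhi) (P.cash_mem hb)).2
    linarith

theorem continuous_density (P : MeanRiskProblem) : Continuous P.density := by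
  obtain ⟨A, hA, -, hl, -⟩ := P.exists_density_bounds
  exact (LipschitzWith.of_dist_le_mul (K := ⟨A, hA⟩) fun x y => hl x y).continuous

theorem intervalIntegrable_mul_density (P : MeanRiskProblem) {h : ℝ → ℝ} {lo hi : ℝ}
    (hh : IntervalIntegrable h volume lo hi) (y : ℝ) :
    IntervalIntegrable (fun y' => h y' * P.density (y - y')) volume lo hi :=
  hh.mul_continuousOn (P.continuous_density.comp (by fun_prop)).continuousOn

/-- Errors are measured in amounts `e^y`, whereas the density is Lipschitz in `y`. The lower end of
the domain bounds the cost of passing from one to the other. -/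
theorem abs_sub_le_exp {y₀ y₁ lo : ℝ} (h₀ : lo ≤ y₀) (h₁ : lo ≤ y₁) :
    |y₁ - y₀| ≤ Real.exp (-lo) * |Real.exp y₁ - Real.exp y₀| := by
  wlog h : y₀ ≤ y₁ generalizing y₀ y₁
  · rw [abs_sub_comm, abs_sub_comm (Real.exp y₁)]
    exact this h₁ h₀ (le_of_not_ge h)
  have h1 := Real.add_one_le_exp (y₁ - y₀)
  have h2 : Real.exp y₁ = Real.exp y₀ * Real.exp (y₁ - y₀) := by rw [← Real.exp_add]; congr 1; ring
  have h3 : 1 ≤ Real.exp (-lo) * Real.exp y₀ := by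
    rw [← Real.exp_add]; exact Real.one_le_exp (by linarith)
  rw [abs_of_nonneg (by linarith), abs_of_nonneg (by linarith [Real.exp_le_exp.2 h]), h2,
    show Real.exp (-lo) * (Real.exp y₀ * Real.exp (y₁ - y₀) - Real.exp y₀) =
      Real.exp (-lo) * Real.exp y₀ * (Real.exp (y₁ - y₀) - 1) by ring]
  nlinarith

/-- Integration over `y'` replaces pointwise differences by L¹ differences of translates, so no
order between the two wealths is needed, in contrast to `Regular.settle_le`. The other two sources
of error are the settlement factor and the density. -/
theorem Regular.integral_settle_le (hf : P.Regular f J C) : ∃ K : ℝ, 0 ≤ K ∧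
    ∀ y₀ ∈ Set.Icc P.ylo P.yhi, ∀ y₁ ∈ Set.Icc P.ylo P.yhi, ∀ b₀ ∈ Set.Icc 0 P.bmax,
    ∀ b₁ ∈ Set.Icc 0 P.bmax, ∀ W ∈ Set.Icc P.Wlo P.Whi, ∀ τ₀ τ₁ : ℝ, P.SmallShift τ₀ →
    P.SmallShift τ₁ →
    ∫ y' in P.ylo..P.yhi, P.settle (liftWealth f τ₁) y' b₁ W * P.density (y₁ - y') ≤
      (∫ y' in P.ylo..P.yhi, P.settle (liftWealth f τ₀) y' b₀ W * P.density (y₀ - y')) +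
      K * (|Real.exp y₁ - Real.exp y₀| + |b₁ - b₀| + |τ₁ - τ₀|) := by
  obtain ⟨A, hA, hbd, hlip, -⟩ := P.exists_density_bounds
  have ha := P.accrual_pos
  have hb := P.bmax_pos
  have hC := hf.nonneg
  have hy := P.ylo_le_yhi
  have hlen : 0 ≤ P.yhi - P.ylo := by linarith
  set V := C * (P.yhi - P.ylo + Real.exp (-P.ylo) * (2 + (Real.exp P.yhi - Real.exp P.ylo)))
    with hV
  have hV0 : 0 ≤ V := by
    have := Real.exp_le_exp.2 hy
    have : 0 ≤ Real.exp P.yhi - Real.exp P.ylo := by linarith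
    positivity
  refine ⟨A * (1 + P.accrual) * V * (1 + P.accrual) +
    (A * (P.accrual / P.bmax) * C + (1 + P.accrual) * C * A * Real.exp (-P.ylo)) *
      (P.yhi - P.ylo), by positivity, ?_⟩
  intro y₀ hy₀ y₁ hy₁ b₀ hb₀ b₁ hb₁ W hW τ₀ τ₁ hτ₀ hτ₁
  have i1 := P.intervalIntegrable_mul_density (hf.intervalIntegrable_settle hb₁ hW hτ₁) y₁
  have i0 := P.intervalIntegrable_mul_density (hf.intervalIntegrable_settle hb₀ hW hτ₀) y₀
  set D := |Real.exp y₁ - Real.exp y₀| + |b₁ - b₀| + |τ₁ - τ₀| with hD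
  have d2 : |b₁ - b₀| ≤ D := by
    rw [hD]; linarith [abs_nonneg (Real.exp y₁ - Real.exp y₀), abs_nonneg (τ₁ - τ₀)]
  have d3 : |Real.exp y₁ - Real.exp y₀| ≤ D := by
    rw [hD]; linarith [abs_nonneg (b₁ - b₀), abs_nonneg (τ₁ - τ₀)]
  have hD0 : 0 ≤ D := (abs_nonneg _).trans d2
  have hstep : ∀ x ∈ Set.Icc 0 P.wealthCap, ∀ x' ∈ Set.Icc 0 P.wealthCap, x ≤ x' →
      f x' W ≤ f x W + C * (x' - x) := fun x hx x' hx' hxx => by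
    simpa [abs_of_nonneg (sub_nonneg.2 hxx)] using hf.step x hx x' hx' W hW (Or.inl hxx)
  have hylo := Set.left_mem_Icc.2 hy
  have hyhi := Set.right_mem_Icc.2 hy
  have q0 := hτ₀.mem hylo (P.cash_mem hb₀)
  have q1 := hτ₁.mem hylo (P.cash_mem hb₁)
  have q2 := hτ₀.mem hyhi (P.cash_mem hb₀)
  have q3 := hτ₁.mem hyhi (P.cash_mem hb₁)
  have hshift := integral_abs_shift_le (f := fun x => f x W) hC (fun x hx => hf.bound x hx W hW)
    hstep (c₀ := P.cash b₀ + τ₀) (c₁ := P.cash b₁ + τ₁) hy (by linarith [q0.1]) (by linarith [q1.1])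
    (by linarith [q2.2]) (by linarith [q3.2])
  have e0 := intervalIntegrable_comp_exp hstep (c := P.cash b₀ + τ₀) hy (by linarith [q0.1])
    (by linarith [q2.2])
  have e1 := intervalIntegrable_comp_exp hstep (c := P.cash b₁ + τ₁) hy (by linarith [q1.1])
    (by linarith [q3.2])
  have dc : |P.cash b₁ + τ₁ - (P.cash b₀ + τ₀)| ≤ (1 + P.accrual) * D := by
    have e : P.cash b₁ + τ₁ - (P.cash b₀ + τ₀) = (P.cash b₁ - P.cash b₀) + (τ₁ - τ₀) := by ring
    rw [e]
    refine (abs_add_le _ _).trans ?_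
    have := P.abs_cash_sub_le b₁ b₀
    rw [hD]
    nlinarith [abs_nonneg (Real.exp y₁ - Real.exp y₀), abs_nonneg (b₁ - b₀),
      abs_nonneg (τ₁ - τ₀)]
  rw [← sub_le_iff_le_add', ← intervalIntegral.integral_sub i1 i0]
  calc _ ≤ ∫ y' in P.ylo..P.yhi, (A * (1 + P.accrual) *
        |f (Real.exp y' + (P.cash b₁ + τ₁)) W - f (Real.exp y' + (P.cash b₀ + τ₀)) W| +
        (A * (P.accrual / P.bmax) * C + (1 + P.accrual) * C * A * Real.exp (-P.ylo)) * D) := by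
        refine intervalIntegral.integral_mono_on hy (i1.sub i0)
          (((e1.sub e0).abs.const_mul _).add intervalIntegrable_const) fun y' hy' => ?_
        have s0 := hf.abs_settle_le hy' hb₀ hW hτ₀
        rw [settle_liftWealth] at s0
        rw [settle_liftWealth, settle_liftWealth]
        have k1 := P.settleFactor_mem hb₁
        have k0 := P.abs_settleFactor_sub_le b₁ b₀
        have fb := hf.bound _ (hτ₀.mem hy' (P.cash_mem hb₀)) W hW
        simp only [add_assoc] at s0 fb ⊢
        set p₁ := max 1 (b₁ * P.accrual / P.bmax)
        set p₀ := max 1 (b₀ * P.accrual / P.bmax)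
        set f₁ := f (Real.exp y' + (P.cash b₁ + τ₁)) W
        set f₀ := f (Real.exp y' + (P.cash b₀ + τ₀)) W
        have g1 := hbd (y₁ - y')
        have gl := hlip (y₁ - y') (y₀ - y')
        rw [show y₁ - y' - (y₀ - y') = y₁ - y₀ by ring] at gl
        have gl' : |P.density (y₁ - y') - P.density (y₀ - y')| ≤
            A * (Real.exp (-P.ylo) * D) := by
          refine gl.trans (mul_le_mul_of_nonneg_left ?_ hA)
          exact (abs_sub_le_exp hy₀.1 hy₁.1).trans
            (mul_le_mul_of_nonneg_left d3 (Real.exp_pos _).le)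
        set g₁ := P.density (y₁ - y')
        set g₀ := P.density (y₀ - y')
        have t1 : p₁ * (f₁ - f₀) * g₁ ≤ (1 + P.accrual) * |f₁ - f₀| * A := by
          calc _ ≤ |p₁ * (f₁ - f₀) * g₁| := le_abs_self _
            _ = p₁ * |f₁ - f₀| * g₁ := by
              rw [abs_mul, abs_mul, abs_of_nonneg g1.1, abs_of_nonneg (by linarith [k1.1])]
            _ ≤ (1 + P.accrual) * |f₁ - f₀| * A :=
              mul_le_mul (mul_le_mul_of_nonneg_right k1.2 (abs_nonneg _)) g1.2 g1.1
                (by positivity)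
        have t2 : (p₁ - p₀) * f₀ * g₁ ≤ P.accrual / P.bmax * D * C * A := by
          calc _ ≤ |(p₁ - p₀) * f₀ * g₁| := le_abs_self _
            _ = |p₁ - p₀| * |f₀| * g₁ := by rw [abs_mul, abs_mul, abs_of_nonneg g1.1]
            _ ≤ _ := by
              refine mul_le_mul (mul_le_mul (k0.trans ?_) fb (abs_nonneg _) (by positivity))
                g1.2 g1.1 (by positivity)
              exact mul_le_mul_of_nonneg_left d2 (by positivity)
        have t3 : p₀ * f₀ * (g₁ - g₀) ≤ (1 + P.accrual) * C * (A * (Real.exp (-P.ylo) * D)) := by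
          refine (le_abs_self _).trans ?_
          rw [abs_mul]
          exact mul_le_mul s0 gl' (abs_nonneg _) (by positivity)
        have e : p₁ * f₁ * g₁ - p₀ * f₀ * g₀ =
          p₁ * (f₁ - f₀) * g₁ + (p₁ - p₀) * f₀ * g₁ + p₀ * f₀ * (g₁ - g₀) := by ring
        rw [e]
        linarith
    _ ≤ _ := by
        rw [intervalIntegral.integral_add ((e1.sub e0).abs.const_mul _) intervalIntegrable_const,
          intervalIntegral.integral_const_mul, intervalIntegral.integral_const, smul_eq_mul]
        have h1 := mul_le_mul_of_nonneg_left (hshift.trans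
          (mul_le_mul_of_nonneg_left dc hV0)) (by positivity : 0 ≤ A * (1 + P.accrual))
        linarith

/-- The log-prices `y₁` and `y₀` belong to the same one of the three regions in which the
recursion has a single expression. -/
def SameRegion (P : MeanRiskProblem) (y₁ y₀ : ℝ) : Prop :=
  (y₁ ≤ P.ymin ∧ y₀ ≤ P.ymin) ∨ ((P.ymin < y₁ ∧ y₁ < P.ymax) ∧ P.ymin < y₀ ∧ y₀ < P.ymax) ∨
    (P.ymax ≤ y₁ ∧ P.ymax ≤ y₀)

/-- Inside a single region nothing jumps except `f` itself. The convolution smooths these jumps,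
which explains the first alternative of the last hypothesis; the boundary regions inherit the
one-sided comparison. -/
theorem Regular.advance_le (hf : P.Regular f J C) : ∃ K : ℝ, 0 ≤ K ∧
    ∀ y₀ ∈ Set.Icc P.ylo P.yhi, ∀ y₁ ∈ Set.Icc P.ylo P.yhi, ∀ b₀ ∈ Set.Icc 0 P.bmax,
    ∀ b₁ ∈ Set.Icc 0 P.bmax, ∀ W ∈ Set.Icc P.Wlo P.Whi, ∀ τ₀ τ₁ : ℝ, P.SmallShift τ₀ →
    P.SmallShift τ₁ → P.SameRegion y₁ y₀ →
    ((P.ymin < y₁ ∧ y₁ < P.ymax) ∨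
      Real.exp y₀ + P.cash b₀ + τ₀ ≤ Real.exp y₁ + P.cash b₁ + τ₁ ∨
      J ≤ Real.exp y₁ + P.cash b₁ + τ₁) →
    P.advance (liftWealth f τ₁) y₁ b₁ W ≤ P.advance (liftWealth f τ₀) y₀ b₀ W +
      K * (|Real.exp y₁ - Real.exp y₀| + |b₁ - b₀| + |τ₁ - τ₀|) := by
  obtain ⟨K₁, hK₁, h₁⟩ := hf.settle_le
  obtain ⟨K₂, hK₂, h₂⟩ := hf.integral_settle_le
  have he := Real.exp_pos (P.μ * P.Δt)
  refine ⟨(1 + Real.exp (P.μ * P.Δt)) * K₁ + K₂, by positivity, ?_⟩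
  intro y₀ hy₀ y₁ hy₁ b₀ hb₀ b₁ hb₁ W hW τ₀ τ₁ hτ₀ hτ₁ hreg hcond
  set D := |Real.exp y₁ - Real.exp y₀| + |b₁ - b₀| + |τ₁ - τ₀| with hD
  have hD0 : 0 ≤ D := by positivity
  have hm := P.ymin_lt
  have z1 : 0 ≤ Real.exp (P.μ * P.Δt) * K₁ * D := by positivity
  have z2 : 0 ≤ K₂ * D := by positivity
  have z3 : 0 ≤ K₁ * D := by positivity
  rcases hreg with ⟨r1, r0⟩ | ⟨⟨r1, r1'⟩, r0, r0'⟩ | ⟨r1, r0⟩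
  · simp only [advance, if_pos r1, if_pos r0]
    have := h₁ y₀ hy₀ y₁ hy₁ b₀ hb₀ b₁ hb₁ W hW τ₀ τ₁ hτ₀ hτ₁
      (hcond.resolve_left fun h => absurd h.1 (not_lt.2 r1))
    linarith
  · simp only [advance, if_neg (not_le.2 r1), if_neg (not_le.2 r1'), if_neg (not_le.2 r0),
      if_neg (not_le.2 r0')]
    have := h₂ y₀ hy₀ y₁ hy₁ b₀ hb₀ b₁ hb₁ W hW τ₀ τ₁ hτ₀ hτ₁
    linarith
  · simp only [advance, if_neg (not_le.2 (hm.trans_le r1)), if_neg (not_le.2 (hm.trans_le r0)),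
      if_pos r1, if_pos r0]
    have := h₁ y₀ hy₀ y₁ hy₁ b₀ hb₀ b₁ hb₁ W hW τ₀ τ₁ hτ₀ hτ₁
      (hcond.resolve_left fun h => absurd h.2 (not_lt.2 r1))
    have := mul_le_mul_of_nonneg_left this he.le
    linarith

/-- Stability of one step in the supremum norm. With `F' = 0` it bounds the step, and with two
thresholds for the same function it transports the Lipschitz bound in `W`. -/
theorem exists_abs_advance_sub_le (P : MeanRiskProblem) : ∃ K : ℝ, 1 ≤ K ∧
    ∀ (F F' : ℝ → ℝ → ℝ → ℝ) (b b' W W' D : ℝ), 0 ≤ D →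
    (∀ y ∈ Set.Icc P.ylo P.yhi, |P.settle F y b W - P.settle F' y b' W'| ≤ D) →
    IntervalIntegrable (fun y => P.settle F y b W) volume P.ylo P.yhi →
    IntervalIntegrable (fun y => P.settle F' y b' W') volume P.ylo P.yhi →
    ∀ y ∈ Set.Icc P.ylo P.yhi, |P.advance F y b W - P.advance F' y b' W'| ≤ K * D := by
  obtain ⟨A, hA, hbd, -⟩ := P.exists_density_bounds
  have he := Real.exp_pos (P.μ * P.Δt)
  have hlen : 0 ≤ P.yhi - P.ylo := by linarith [P.ylo_le_yhi]
  refine ⟨1 + Real.exp (P.μ * P.Δt) + A * (P.yhi - P.ylo), by nlinarith [mul_nonneg hA hlen], ?_⟩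
  intro F F' b b' W W' D hD h i i' y hy
  have z1 : 0 ≤ Real.exp (P.μ * P.Δt) * D := by positivity
  have z2 : 0 ≤ A * (P.yhi - P.ylo) * D := by positivity
  unfold advance
  split_ifs
  · linarith [h y hy]
  · rw [← mul_sub, abs_mul, abs_of_pos he]
    linarith [mul_le_mul_of_nonneg_left (h y hy) he.le]
  · rw [← intervalIntegral.integral_sub (P.intervalIntegrable_mul_density i y)
      (P.intervalIntegrable_mul_density i' y)]
    have := intervalIntegral.norm_integral_le_of_norm_le_const (a := P.ylo) (b := P.yhi)
      (C := D * A) (f := fun y' => P.settle F y' b W * P.density (y - y') -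
        P.settle F' y' b' W' * P.density (y - y')) fun y' hy' => by
        rw [Set.uIoc_of_le P.ylo_le_yhi] at hy'
        rw [← sub_mul, norm_mul, Real.norm_eq_abs, Real.norm_eq_abs,
          abs_of_nonneg (hbd (y - y')).1]
        exact mul_le_mul (h y' ⟨hy'.1.le, hy'.2⟩) (hbd _).2 (hbd _).1 hD
    rw [Real.norm_eq_abs, abs_of_nonneg hlen] at this
    linarith

theorem Regular.abs_advance_le (hf : P.Regular f J C) : ∃ K : ℝ, 0 ≤ K ∧
    ∀ y ∈ Set.Icc P.ylo P.yhi, ∀ b ∈ Set.Icc 0 P.bmax, ∀ W ∈ Set.Icc P.Wlo P.Whi,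
    ∀ τ, P.SmallShift τ → |P.advance (liftWealth f τ) y b W| ≤ K := by
  obtain ⟨K, hK, h⟩ := P.exists_abs_advance_sub_le
  have ha := P.accrual_pos
  have hC := hf.nonneg
  have hD : 0 ≤ (1 + P.accrual) * C := by positivity
  refine ⟨K * ((1 + P.accrual) * C), by positivity, fun y hy b hb W hW τ hτ => ?_⟩
  have h0 : ∀ y b W, P.advance (fun _ _ _ => 0) y b W = 0 := fun y b W => by
    simp [advance, settle]
  have hs0 : ∀ y b W, P.settle (fun _ _ _ => 0) y b W = 0 := fun y b W => by simp [settle]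
  have := h (liftWealth f τ) (fun _ _ _ => 0) b b W W _ hD
    (fun y hy => by rw [hs0, sub_zero]; exact hf.abs_settle_le hy hb hW hτ)
    (hf.intervalIntegrable_settle hb hW hτ) (by simp only [hs0]; exact intervalIntegrable_const)
    y hy
  rwa [h0, sub_zero] at this

theorem Regular.abs_advance_sub_le (hf : P.Regular f J C) : ∃ K : ℝ, 0 ≤ K ∧
    ∀ y ∈ Set.Icc P.ylo P.yhi, ∀ b ∈ Set.Icc 0 P.bmax, ∀ W ∈ Set.Icc P.Wlo P.Whi,
    ∀ W' ∈ Set.Icc P.Wlo P.Whi,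
    |P.advance (liftWealth f 0) y b W - P.advance (liftWealth f 0) y b W'| ≤ K * |W - W'| := by
  obtain ⟨K, hK, h⟩ := P.exists_abs_advance_sub_le
  have ha := P.accrual_pos
  have hC := hf.nonneg
  have hτ := P.smallShift_zero
  refine ⟨K * ((1 + P.accrual) * C), by positivity, fun y hy b hb W hW W' hW' => ?_⟩
  have := h (liftWealth f 0) (liftWealth f 0) b b W W' ((1 + P.accrual) * C * |W - W'|)
    (by positivity) (fun y hy => ?_)
    (hf.intervalIntegrable_settle hb hW hτ) (hf.intervalIntegrable_settle hb hW' hτ) y hy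
  · linarith
  · rw [settle_liftWealth, settle_liftWealth, ← mul_sub, abs_mul, mul_assoc]
    have k := P.settleFactor_mem hb
    rw [abs_of_nonneg (by linarith [k.1])]
    exact mul_le_mul k.2 (hf.threshold _ (hτ.mem hy (P.cash_mem hb)) W hW W' hW') (abs_nonneg _)
      (by linarith)

theorem exists_growth_bounds (P : MeanRiskProblem) (R : ℝ) : ∃ K : ℝ, 0 ≤ K ∧
    (∀ s ≤ R, ∀ b ≤ R, 1 ≤ P.growth s b ∧ P.growth s b ≤ K) ∧
    ∀ s₀ ≤ R, ∀ b₀ ≤ R, ∀ s₁ ≤ R, ∀ b₁ ≤ R,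
      |P.growth s₁ b₁ - P.growth s₀ b₀| ≤ K * (|s₁ - s₀| + |b₁ - b₀|) := by
  have hs := Real.exp_pos P.yhi
  have hb := P.bmax_pos
  set c := Real.exp P.yhi with hc
  set M := 1 + |R| / c + |R| / P.bmax with hM
  have q1 : 0 ≤ |R| / c := by positivity
  have q2 : 0 ≤ |R| / P.bmax := by positivity
  have f1 : ∀ s ≤ R, 1 ≤ max 1 (s / c) ∧ max 1 (s / c) ≤ M := fun s h =>
    ⟨le_max_left _ _, max_le (by linarith)
      ((div_le_div_of_nonneg_right (h.trans (le_abs_self R)) hs.le).trans (by linarith))⟩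
  have f2 : ∀ b ≤ R, 1 ≤ max 1 (b / P.bmax) ∧ max 1 (b / P.bmax) ≤ M := fun b h =>
    ⟨le_max_left _ _, max_le (by linarith)
      ((div_le_div_of_nonneg_right (h.trans (le_abs_self R)) hb.le).trans (by linarith))⟩
  have g1 : ∀ s₁ s₀ : ℝ, |max 1 (s₁ / c) - max 1 (s₀ / c)| ≤ 1 / c * |s₁ - s₀| := fun s₁ s₀ => by
    have h := abs_max_one_sub_le (s₁ / c) (s₀ / c)
    rw [← sub_div, abs_div, abs_of_pos hs] at h
    exact h.trans (le_of_eq (by ring))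
  have g2 : ∀ s₁ s₀ : ℝ, |max 1 (s₁ / P.bmax) - max 1 (s₀ / P.bmax)| ≤
      1 / P.bmax * |s₁ - s₀| := fun s₁ s₀ => by
    have h := abs_max_one_sub_le (s₁ / P.bmax) (s₀ / P.bmax)
    rw [← sub_div, abs_div, abs_of_pos hb] at h
    exact h.trans (le_of_eq (by ring))
  have hM0 : 0 ≤ M := by positivity
  refine ⟨M * M + M * (1 / c) + M * (1 / P.bmax), by positivity, fun s hsR b hbR => ⟨?_, ?_⟩, ?_⟩
  · exact one_le_mul_of_one_le_of_one_le (f1 s hsR).1 (f2 b hbR).1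
  · have := mul_le_mul (f1 s hsR).2 (f2 b hbR).2 (by linarith [(f2 b hbR).1]) hM0
    have z1 : 0 ≤ M * (1 / c) := by positivity
    have z2 : 0 ≤ M * (1 / P.bmax) := by positivity
    simp only [growth]
    linarith
  · intro s₀ hs₀ b₀ hb₀ s₁ hs₁ b₁ hb₁
    simp only [growth]
    have a1 := f1 s₀ hs₀
    have a2 := f2 b₁ hb₁
    have a3 := g1 s₁ s₀
    have a4 := g2 b₁ b₀
    rw [← hc]
    set p₁ := max 1 (s₁ / c)
    set p₀ := max 1 (s₀ / c)
    set r₁ := max 1 (b₁ / P.bmax)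
    set r₀ := max 1 (b₀ / P.bmax)
    have e : p₁ * r₁ - p₀ * r₀ = (p₁ - p₀) * r₁ + p₀ * (r₁ - r₀) := by ring
    rw [e]
    refine (abs_add_le _ _).trans ?_
    rw [abs_mul, abs_mul, abs_of_nonneg (by linarith : 0 ≤ r₁), abs_of_nonneg (by linarith : 0 ≤ p₀)]
    have b1 := mul_le_mul a3 a2.2 (by linarith) (by positivity)
    have b2 := mul_le_mul a1.2 a4 (abs_nonneg _) hM0
    have z1 : 0 ≤ M * M * |s₁ - s₀| := by positivity
    have z2 : 0 ≤ M * M * |b₁ - b₀| := by positivity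
    have z3 : 0 ≤ M * (1 / c) * |b₁ - b₀| := by positivity
    have z4 : 0 ≤ M * (1 / P.bmax) * |s₁ - s₀| := by positivity
    linarith

/-- Comparison of two values obtained by one step of the recursion. -/
theorem Regular.growth_mul_advance_le (hf : P.Regular f J C) (R : ℝ) : ∃ K : ℝ, 0 ≤ K ∧
    ∀ s₀ ≤ R, ∀ t₀ ≤ R, ∀ s₁ ≤ R, ∀ t₁ ≤ R,
    ∀ y₀ ∈ Set.Icc P.ylo P.yhi, ∀ y₁ ∈ Set.Icc P.ylo P.yhi, ∀ b₀ ∈ Set.Icc 0 P.bmax,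
    ∀ b₁ ∈ Set.Icc 0 P.bmax, ∀ W ∈ Set.Icc P.Wlo P.Whi, ∀ τ₀ τ₁ : ℝ, P.SmallShift τ₀ →
    P.SmallShift τ₁ → P.SameRegion y₁ y₀ →
    ((P.ymin < y₁ ∧ y₁ < P.ymax) ∨
      Real.exp y₀ + P.cash b₀ + τ₀ ≤ Real.exp y₁ + P.cash b₁ + τ₁ ∨
      J ≤ Real.exp y₁ + P.cash b₁ + τ₁) →
    P.growth s₁ t₁ * P.advance (liftWealth f τ₁) y₁ b₁ W ≤
      P.growth s₀ t₀ * P.advance (liftWealth f τ₀) y₀ b₀ W +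
      K * (|s₁ - s₀| + |t₁ - t₀| + |Real.exp y₁ - Real.exp y₀| + |b₁ - b₀| + |τ₁ - τ₀|) := by
  obtain ⟨K₁, hK₁, h₁⟩ := hf.advance_le
  obtain ⟨K₂, hK₂, h₂⟩ := hf.abs_advance_le
  obtain ⟨K₃, hK₃, h₃, h₃'⟩ := P.exists_growth_bounds R
  refine ⟨K₃ * K₁ + K₃ * K₂, by positivity, ?_⟩
  intro s₀ hs₀ t₀ ht₀ s₁ hs₁ t₁ ht₁ y₀ hy₀ y₁ hy₁ b₀ hb₀ b₁ hb₁ W hW τ₀ τ₁ hτ₀ hτ₁ hreg hcond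
  have a1 := h₁ y₀ hy₀ y₁ hy₁ b₀ hb₀ b₁ hb₁ W hW τ₀ τ₁ hτ₀ hτ₁ hreg hcond
  have a2 := h₂ y₀ hy₀ b₀ hb₀ W hW τ₀ hτ₀
  have a3 := h₃ s₁ hs₁ t₁ ht₁
  have a4 := h₃' s₀ hs₀ t₀ ht₀ s₁ hs₁ t₁ ht₁
  set g₁ := P.growth s₁ t₁
  set g₀ := P.growth s₀ t₀
  set A₁ := P.advance (liftWealth f τ₁) y₁ b₁ W
  set A₀ := P.advance (liftWealth f τ₀) y₀ b₀ W
  set E := |Real.exp y₁ - Real.exp y₀| + |b₁ - b₀| + |τ₁ - τ₀| with hE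
  have hE0 : 0 ≤ E := by positivity
  have t1 : g₁ * (A₁ - A₀) ≤ K₃ * (K₁ * E) :=
    (mul_le_mul_of_nonneg_left (sub_le_iff_le_add'.2 a1) (by linarith)).trans
      (mul_le_mul_of_nonneg_right a3.2 (by positivity))
  have t2 : (g₁ - g₀) * A₀ ≤ K₃ * (|s₁ - s₀| + |t₁ - t₀|) * K₂ := by
    refine (le_abs_self _).trans ?_
    rw [abs_mul]
    exact mul_le_mul a4 a2 (abs_nonneg _) (by positivity)
  have z1 : 0 ≤ K₃ * K₁ * (|s₁ - s₀| + |t₁ - t₀|) := by positivity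
  have z2 : 0 ≤ K₃ * K₂ * E := by positivity
  have e : g₁ * A₁ = g₀ * A₀ + (g₁ * (A₁ - A₀) + (g₁ - g₀) * A₀) := by ring
  have e2 : |s₁ - s₀| + |t₁ - t₀| + |Real.exp y₁ - Real.exp y₀| + |b₁ - b₀| + |τ₁ - τ₀| =
    (|s₁ - s₀| + |t₁ - t₀|) + E := by rw [hE]; ring
  rw [e, e2]
  linarith

end MeanRiskProblem

namespace MeanRiskProblem

variable (P : MeanRiskProblem)

/-! ### The objective and the value as functions of total wealth -/

/-- Optimization over the control, for a normalized (minimized) criterion, at total wealth `w`. -/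
noncomputable def objective (f : ℝ → ℝ → ℝ) (w W : ℝ) : ℝ :=
  sInf ((fun u => P.extend (P.advance (liftWealth f 0)) (u * w) ((1 - u) * w) W) ''
    Set.Icc (0 : ℝ) 1)

/-- Optimization over control and threshold, for a normalized criterion, at total wealth `w`. -/
noncomputable def wealthValue (f : ℝ → ℝ → ℝ) (w : ℝ) : ℝ :=
  sInf (P.objective f w '' Set.Icc P.Wlo P.Whi)

/-- One-period factor by which levels of wealth may shrink relative to each other. -/
noncomputable def shrink : ℝ := Real.exp (-(|P.r| * P.Δt))

theorem shrink_pos : 0 < P.shrink := Real.exp_pos _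

theorem shrink_le_one : P.shrink ≤ 1 :=
  Real.exp_le_one_iff.2 (neg_nonpos.2 (mul_nonneg (abs_nonneg _) P.Δt_pos.le))

theorem shrink_le_accrual : P.shrink ≤ P.accrual := by
  refine Real.exp_le_exp.2 ?_
  nlinarith [neg_abs_le P.r, P.Δt_pos]

theorem exp_logAmount (s : ℝ) :
    Real.exp (P.logAmount s) = max (Real.exp P.ylo) (min s (Real.exp P.yhi)) :=
  Real.exp_log ((Real.exp_pos _).trans_le (le_max_left _ _))

theorem logAmount_mem (s : ℝ) : P.logAmount s ∈ Set.Icc P.ylo P.yhi := by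
  have h := Real.exp_le_exp.2 P.ylo_le_yhi
  constructor
  · rw [← Real.exp_le_exp, exp_logAmount]; exact le_max_left _ _
  · rw [← Real.exp_le_exp, exp_logAmount]; exact max_le h (min_le_right _ _)

theorem abs_exp_logAmount_sub_le (s t : ℝ) :
    |Real.exp (P.logAmount s) - Real.exp (P.logAmount t)| ≤ |s - t| := by
  rw [exp_logAmount, exp_logAmount]
  have h1 := abs_max_sub_max_le_max (Real.exp P.ylo) (min s (Real.exp P.yhi)) (Real.exp P.ylo)
    (min t (Real.exp P.yhi))
  have h2 := abs_min_sub_min_le_max s (Real.exp P.yhi) t (Real.exp P.yhi)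
  simp only [sub_self, abs_zero, abs_nonneg, max_eq_left, max_eq_right] at h1 h2
  exact h1.trans h2

theorem logAmount_le_iff {y s : ℝ} (h0 : P.ylo ≤ y) (h1 : y < P.yhi) :
    P.logAmount s ≤ y ↔ s ≤ Real.exp y := by
  rw [← Real.exp_le_exp, exp_logAmount, max_le_iff, min_le_iff]
  have h2 := Real.exp_le_exp.2 h0
  have h3 := Real.exp_lt_exp.2 h1
  constructor
  · rintro ⟨-, h | h⟩ <;> linarith
  · intro h; exact ⟨h2, Or.inl h⟩

theorem le_logAmount_iff {y s : ℝ} (h0 : P.ylo < y) (h1 : y ≤ P.yhi) :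
    y ≤ P.logAmount s ↔ Real.exp y ≤ s := by
  rw [← Real.exp_le_exp, exp_logAmount, le_max_iff, le_min_iff]
  have := Real.exp_lt_exp.2 h0
  have := Real.exp_le_exp.2 h1
  constructor
  · rintro (h | h)
    · linarith
    · exact h.1
  · intro h; exact Or.inr ⟨h, this⟩

theorem ylo_lt_ymax : P.ylo < P.ymax := P.ylo_lt.trans P.ymin_lt

theorem ymin_lt_yhi : P.ymin < P.yhi := P.ymin_lt.trans P.ymax_lt

theorem logAmount_le_ymin {s : ℝ} : P.logAmount s ≤ P.ymin ↔ s ≤ Real.exp P.ymin :=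
  P.logAmount_le_iff P.ylo_lt.le P.ymin_lt_yhi

theorem ymin_lt_logAmount {s : ℝ} : P.ymin < P.logAmount s ↔ Real.exp P.ymin < s := by
  rw [← not_le, ← not_le, logAmount_le_ymin]

theorem ymax_le_logAmount {s : ℝ} : P.ymax ≤ P.logAmount s ↔ Real.exp P.ymax ≤ s :=
  P.le_logAmount_iff P.ylo_lt_ymax P.ymax_lt.le

theorem logAmount_lt_ymax {s : ℝ} : P.logAmount s < P.ymax ↔ s < Real.exp P.ymax := by
  rw [← not_le, ← not_le, ymax_le_logAmount]

theorem SameRegion.refl (y : ℝ) : P.SameRegion y y := by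
  unfold SameRegion
  rcases le_or_gt y P.ymin with h | h
  · exact Or.inl ⟨h, h⟩
  · rcases le_or_gt P.ymax y with h' | h'
    · exact Or.inr (Or.inr ⟨h', h'⟩)
    · exact Or.inr (Or.inl ⟨⟨h, h'⟩, h, h'⟩)

theorem min_bmax_mem {b : ℝ} (hb : 0 ≤ b) : min b P.bmax ∈ Set.Icc 0 P.bmax :=
  ⟨le_min hb P.bmax_pos.le, min_le_right _ _⟩

theorem abs_min_bmax_sub_le (b b' : ℝ) : |min b P.bmax - min b' P.bmax| ≤ |b - b'| := by
  simpa using abs_min_sub_min_le_max b P.bmax b' P.bmax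

/-- Interest shrinks cash at most by the factor `shrink`. If the cap is reached, the cash alone is
at least `shrink * bmax ≥ J`; otherwise total wealth loses at most that factor. The bound `s ≤
e^yhi` excludes truncation of the risky amount from above. -/
theorem le_exp_logAmount_add_cash {J s b : ℝ} (hJ : J ≤ P.shrink * P.bmax) (hs : 0 ≤ s)
    (hs' : s ≤ Real.exp P.yhi) (hb : 0 ≤ b) (h : J ≤ P.shrink * (s + b)) :
    J ≤ Real.exp (P.logAmount s) + P.cash (min b P.bmax) := by
  have h1 : s ≤ Real.exp (P.logAmount s) := by
    rw [exp_logAmount, min_eq_left hs']; exact le_max_right _ _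
  have h2 : 0 < Real.exp (P.logAmount s) := Real.exp_pos _
  have r0 := P.shrink_pos
  have r1 := P.shrink_le_one
  have r2 := P.shrink_le_accrual
  have hbm := P.bmax_pos
  have h3 : min (P.shrink * b) (P.shrink * P.bmax) ≤ P.cash (min b P.bmax) := by
    unfold cash
    refine le_min ?_ ?_
    · rcases le_total b P.bmax with h | h
      · rw [min_eq_left h]; refine (min_le_left _ _).trans ?_; nlinarith
      · rw [min_eq_right h]; refine (min_le_right _ _).trans ?_; nlinarith
    · refine (min_le_right _ _).trans ?_; nlinarith
  rcases min_cases (P.shrink * b) (P.shrink * P.bmax) with ⟨e, -⟩ | ⟨e, -⟩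
  · rw [e] at h3
    nlinarith
  · rw [e] at h3
    linarith

variable {P} {f : ℝ → ℝ → ℝ} {J C : ℝ}

theorem Regular.abs_extend_le (hf : P.Regular f J C) (R : ℝ) : ∃ K : ℝ, 0 ≤ K ∧
    ∀ s ≤ R, ∀ b ∈ Set.Icc 0 R, ∀ W ∈ Set.Icc P.Wlo P.Whi,
    |P.extend (P.advance (liftWealth f 0)) s b W| ≤ K := by
  obtain ⟨K₂, hK₂, h₂⟩ := hf.abs_advance_le
  obtain ⟨K₃, hK₃, h₃, -⟩ := P.exists_growth_bounds R
  refine ⟨K₃ * K₂, by positivity, fun s hs b hb W hW => ?_⟩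
  have h := h₃ s hs b hb.2
  unfold extend
  rw [abs_mul, abs_of_nonneg (by linarith)]
  exact mul_le_mul h.2 (h₂ _ (P.logAmount_mem s) _ (P.min_bmax_mem hb.1) W hW 0 P.smallShift_zero)
    (abs_nonneg _) hK₃

/-- Together with `Regular.objective_le` this replaces the control `u` by splits `s + b = w`, the
form in which competitors are built. -/
theorem le_objective {w W c : ℝ} (hw : 0 ≤ w)
    (h : ∀ s b : ℝ, 0 ≤ s → 0 ≤ b → s + b = w →
      c ≤ P.extend (P.advance (liftWealth f 0)) s b W) : c ≤ P.objective f w W := by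
  refine le_csInf ((Set.nonempty_Icc.2 zero_le_one).image _) ?_
  rintro _ ⟨u, hu, rfl⟩
  exact h _ _ (mul_nonneg hu.1 hw) (mul_nonneg (by linarith [hu.2]) hw) (by ring)

theorem Regular.objective_le (hf : P.Regular f J C) {s b W : ℝ} (hs : 0 ≤ s) (hb : 0 ≤ b)
    (hW : W ∈ Set.Icc P.Wlo P.Whi) :
    P.objective f (s + b) W ≤ P.extend (P.advance (liftWealth f 0)) s b W := by
  obtain ⟨K, -, h⟩ := hf.abs_extend_le (s + b)
  refine csInf_le ⟨-K, ?_⟩ ?_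
  · rintro _ ⟨u, hu, rfl⟩
    refine (abs_le.1 (h _ ?_ _ ⟨?_, ?_⟩ W hW)).1
    · nlinarith [hu.1, hu.2]
    · exact mul_nonneg (by linarith [hu.2]) (by linarith)
    · nlinarith [hu.1, hu.2]
  -- At zero wealth the ratio `s / (s + b)` is meaningless, but every control gives the same split.
  · rcases (add_nonneg hs hb).eq_or_lt with h0 | h0
    · have e1 : s = 0 := by linarith
      have e2 : b = 0 := by linarith
      exact ⟨0, ⟨le_rfl, zero_le_one⟩, by simp [e1, e2]⟩
    · refine ⟨s / (s + b), ⟨by positivity, by rw [div_le_one h0]; linarith⟩, ?_⟩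
      have e1 : s / (s + b) * (s + b) = s := by field_simp
      have e2 : (1 - s / (s + b)) * (s + b) = b := by rw [sub_mul, e1]; ring
      simp only [e1, e2]

theorem Regular.abs_objective_le (hf : P.Regular f J C) (R : ℝ) : ∃ K : ℝ, 0 ≤ K ∧
    ∀ w ∈ Set.Icc 0 R, ∀ W ∈ Set.Icc P.Wlo P.Whi, |P.objective f w W| ≤ K := by
  obtain ⟨K, hK, h⟩ := hf.abs_extend_le R
  refine ⟨K, hK, fun w hw W hW => abs_le.2 ⟨?_, ?_⟩⟩
  · refine le_objective hw.1 fun s b hs hb e => ?_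
    exact (abs_le.1 (h s (by linarith [hw.2]) b ⟨hb, by linarith [hw.2]⟩ W hW)).1
  · have := hf.objective_le le_rfl hw.1 hW
    rw [zero_add] at this
    exact this.trans (abs_le.1 (h 0 (by linarith [hw.1, hw.2]) w ⟨hw.1, hw.2⟩ W hW)).2

theorem Regular.abs_objective_sub_le (hf : P.Regular f J C) (R : ℝ) : ∃ K : ℝ, 0 ≤ K ∧
    ∀ w ∈ Set.Icc 0 R, ∀ W ∈ Set.Icc P.Wlo P.Whi, ∀ W' ∈ Set.Icc P.Wlo P.Whi,
    |P.objective f w W - P.objective f w W'| ≤ K * |W - W'| := by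
  obtain ⟨K₂, hK₂, h₂⟩ := hf.abs_advance_sub_le
  obtain ⟨K₃, hK₃, h₃, -⟩ := P.exists_growth_bounds R
  have key : ∀ w ∈ Set.Icc 0 R, ∀ W ∈ Set.Icc P.Wlo P.Whi, ∀ W' ∈ Set.Icc P.Wlo P.Whi,
      P.objective f w W ≤ P.objective f w W' + K₃ * K₂ * |W - W'| := by
    intro w hw W hW W' hW'
    rw [← sub_le_iff_le_add]
    refine le_objective hw.1 fun s b hs hb e => ?_
    have h1 := hf.objective_le hs hb hW
    rw [e] at h1
    have h2 := h₃ s (by linarith [hw.2]) b (by linarith [hw.2])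
    have h3 := h₂ _ (P.logAmount_mem s) _ (P.min_bmax_mem hb) W hW W' hW'
    unfold extend at h1 ⊢
    have h5 : P.growth s b * (P.advance (liftWealth f 0) (P.logAmount s) (min b P.bmax) W -
        P.advance (liftWealth f 0) (P.logAmount s) (min b P.bmax) W') ≤ K₃ * (K₂ * |W - W'|) :=
      (mul_le_mul_of_nonneg_left ((le_abs_self _).trans h3) (by linarith)).trans
        (mul_le_mul_of_nonneg_right h2.2 (by positivity))
    linarith
  refine ⟨K₃ * K₂, by positivity, fun w hw W hW W' hW' => abs_le.2 ⟨?_, ?_⟩⟩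
  · have := key w hw W' hW' W hW
    rw [abs_sub_comm] at this
    linarith
  · linarith [key w hw W hW W' hW']

/-- Version without shifts of `Regular.growth_mul_advance_le`, stated in terms of amounts. Clamping
to the domain is 1-Lipschitz in each amount, so distances between clamped amounts merge with those
between the amounts. -/
theorem Regular.extend_le (hf : P.Regular f J C) (R : ℝ) : ∃ K : ℝ, 0 ≤ K ∧
    ∀ s₀ ≤ R, ∀ b₀ ∈ Set.Icc 0 R, ∀ s₁ ≤ R, ∀ b₁ ∈ Set.Icc 0 R, ∀ W ∈ Set.Icc P.Wlo P.Whi,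
    P.SameRegion (P.logAmount s₁) (P.logAmount s₀) →
    ((Real.exp P.ymin < s₁ ∧ s₁ < Real.exp P.ymax) ∨
      Real.exp (P.logAmount s₀) + P.cash (min b₀ P.bmax) ≤
        Real.exp (P.logAmount s₁) + P.cash (min b₁ P.bmax) ∨
      J ≤ Real.exp (P.logAmount s₁) + P.cash (min b₁ P.bmax)) →
    P.extend (P.advance (liftWealth f 0)) s₁ b₁ W ≤
      P.extend (P.advance (liftWealth f 0)) s₀ b₀ W + K * (|s₁ - s₀| + |b₁ - b₀|) := by
  obtain ⟨K, hK, h⟩ := hf.growth_mul_advance_le R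
  refine ⟨2 * K, by positivity, ?_⟩
  intro s₀ hs₀ b₀ hb₀ s₁ hs₁ b₁ hb₁ W hW hreg hcond
  have h1 := h s₀ hs₀ b₀ hb₀.2 s₁ hs₁ b₁ hb₁.2 _ (P.logAmount_mem s₀) _ (P.logAmount_mem s₁)
    _ (P.min_bmax_mem hb₀.1) _ (P.min_bmax_mem hb₁.1) W hW 0 0 P.smallShift_zero P.smallShift_zero
    hreg (by simpa only [add_zero, P.ymin_lt_logAmount, P.logAmount_lt_ymax] using hcond)
  have h2 := mul_le_mul_of_nonneg_left (P.abs_exp_logAmount_sub_le s₁ s₀) hK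
  have h3 := mul_le_mul_of_nonneg_left (P.abs_min_bmax_sub_le b₁ b₀) hK
  rw [sub_self, abs_zero] at h1
  unfold extend
  linarith

/-- The surplus `w' - w` is put into the bank. The risky amount, hence the region, is unchanged and
the settled wealth does not decrease. No restriction on the wealth is therefore needed. -/
theorem Regular.objective_le_of_le (hf : P.Regular f J C) (R : ℝ) : ∃ K : ℝ, 0 ≤ K ∧
    ∀ w ∈ Set.Icc 0 R, ∀ w' ∈ Set.Icc 0 R, ∀ W ∈ Set.Icc P.Wlo P.Whi, w ≤ w' →
    P.objective f w' W ≤ P.objective f w W + K * (w' - w) := by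
  obtain ⟨K, hK, h⟩ := hf.extend_le R
  refine ⟨K, hK, fun w hw w' hw' W hW hww => ?_⟩
  rw [← sub_le_iff_le_add]
  refine le_objective hw.1 fun s b hs hb e => ?_
  have h1 := hf.objective_le hs (by linarith : 0 ≤ b + (w' - w)) hW
  rw [show s + (b + (w' - w)) = w' by linarith] at h1
  have h2 := h s (by linarith [hw.2]) b ⟨hb, by linarith [hw.2]⟩ s (by linarith [hw.2])
    (b + (w' - w)) ⟨by linarith, by linarith [hw'.2]⟩ W hW (SameRegion.refl P _)
    (Or.inr (Or.inl (by
      gcongr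
      exact P.cash_mono (min_le_min_right _ (by linarith)))))
  rw [sub_self, abs_zero, zero_add, show b + (w' - w) - b = w' - w by ring,
    abs_of_nonneg (sub_nonneg.2 hww)] at h2
  linarith

/-- The objective is Lipschitz in the wealth, away from the boundaries between the regions and
above the level at which irregularities may occur. -/
theorem Regular.objective_le_of_ge (hf : P.Regular f J C) (hJ : J ≤ P.shrink * P.bmax) (R : ℝ) :
    ∃ K : ℝ, 0 ≤ K ∧
    ∀ w ∈ Set.Icc 0 R, ∀ w' ∈ Set.Icc 0 R, ∀ W ∈ Set.Icc P.Wlo P.Whi, w ≤ w' →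
    Real.exp P.ymin < w → (Real.exp P.ymax ≤ w ∨ w' < Real.exp P.ymax) → J ≤ P.shrink * w →
    P.objective f w W ≤ P.objective f w' W + K * (w' - w) := by
  obtain ⟨K, hK, h⟩ := hf.extend_le R
  refine ⟨K * 5, by positivity, fun w hw w' hw' W hW hww hmin hmax hJw => ?_⟩
  rw [← sub_le_iff_le_add]
  refine le_objective hw'.1 fun s' b' hs' hb' e => ?_
  have hyy := Real.exp_lt_exp.2 P.ymin_lt
  have hyh := Real.exp_lt_exp.2 P.ymax_lt
  have hsl := Real.exp_pos P.ymin
  -- A competitor at the smaller wealth `w` must keep the region of `s'` and move by `O(w' - w)`. It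
  -- must also be interior, keep the settled wealth from decreasing, or reach the level `J`.
  suffices H : ∃ s, 0 ≤ s ∧ s ≤ w ∧ |s - s'| ≤ 2 * (w' - w) ∧
      P.SameRegion (P.logAmount s) (P.logAmount s') ∧
      ((Real.exp P.ymin < s ∧ s < Real.exp P.ymax) ∨
        Real.exp (P.logAmount s') + P.cash (min b' P.bmax) ≤
          Real.exp (P.logAmount s) + P.cash (min (w - s) P.bmax) ∨
        J ≤ Real.exp (P.logAmount s) + P.cash (min (w - s) P.bmax)) by
    obtain ⟨s, hs0, hsw, hd, hreg, hcond⟩ := H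
    have h1 := hf.objective_le hs0 (sub_nonneg.2 hsw) hW
    rw [show s + (w - s) = w by ring] at h1
    have h2 := h s' (by linarith [hw'.2]) b' ⟨hb', by linarith [hw'.2]⟩ s (by linarith [hw.2])
      (w - s) ⟨by linarith, by linarith [hw.2]⟩ W hW hreg hcond
    have h3 : |w - s - b'| ≤ 3 * (w' - w) := by
      have := abs_le.1 hd
      rw [abs_le]
      constructor <;> linarith
    have h4 := mul_le_mul_of_nonneg_left (add_le_add hd h3) hK
    linarith
  -- Below `ymin` the risky amount is kept and only the cash reduced, which is possible because `w`
  -- exceeds `e^ymin`.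
  rcases le_or_gt s' (Real.exp P.ymin) with c1 | c1
  · refine ⟨s', hs', by linarith, by rw [sub_self, abs_zero]; linarith, SameRegion.refl P _,
      Or.inr (Or.inr ?_)⟩
    exact P.le_exp_logAmount_add_cash hJ hs' (by linarith) (by linarith) (by simpa using hJw)
  · rcases lt_or_ge s' (Real.exp P.ymax) with c2 | c2
    · have c3 : Real.exp P.ymin < min s' w := lt_min c1 hmin
      have c4 : min s' w < Real.exp P.ymax := (min_le_left _ _).trans_lt c2
      refine ⟨min s' w, by linarith, min_le_right _ _, ?_, Or.inr (Or.inl ⟨⟨?_, ?_⟩, ?_, ?_⟩),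
        Or.inl ⟨c3, c4⟩⟩
      · rcases le_total s' w with q | q
        · rw [min_eq_left q, sub_self, abs_zero]; linarith
        · rw [min_eq_right q, abs_le]; constructor <;> linarith
      · exact P.ymin_lt_logAmount.2 c3
      · exact P.logAmount_lt_ymax.2 c4
      · exact P.ymin_lt_logAmount.2 c1
      · exact P.logAmount_lt_ymax.2 c2
    · have hw1 : Real.exp P.ymax ≤ w := hmax.resolve_right (by linarith)
      -- If the risky amount is far beyond `yhi`, it can pay for the whole loss: the clamped
      -- log-price and the cash stay the same, so the settled wealth is unchanged. Otherwise it is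
      -- brought down to at most `e^yhi`, where the level `J` can be checked.
      by_cases c3 : Real.exp P.yhi ≤ s' - (w' - w)
      · refine ⟨s' - (w' - w), by linarith, by linarith, ?_,
          Or.inr (Or.inr ⟨P.ymax_le_logAmount.2 (by linarith), P.ymax_le_logAmount.2 c2⟩),
          Or.inr (Or.inl ?_)⟩
        · rw [abs_le]; constructor <;> linarith
        · rw [exp_logAmount, exp_logAmount, min_eq_right c3,
            min_eq_right (by linarith : Real.exp P.yhi ≤ s'),
            show w - (s' - (w' - w)) = b' by linarith]
      · have c4 : Real.exp P.ymax ≤ min w (min s' (Real.exp P.yhi)) :=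
          le_min hw1 (le_min c2 hyh.le)
        refine ⟨min w (min s' (Real.exp P.yhi)), by linarith, min_le_left _ _, ?_,
          Or.inr (Or.inr ⟨P.ymax_le_logAmount.2 c4, P.ymax_le_logAmount.2 c2⟩),
          Or.inr (Or.inr ?_)⟩
        · have q1 : min w (min s' (Real.exp P.yhi)) ≤ s' :=
            (min_le_right _ _).trans (min_le_left _ _)
          have q2 : s' - (w' - w) ≤ min w (min s' (Real.exp P.yhi)) :=
            le_min (by linarith) (le_min (by linarith) (by linarith))
          rw [abs_le]; constructor <;> linarith
        · exact P.le_exp_logAmount_add_cash hJ (by linarith)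
            ((min_le_right _ _).trans (min_le_right _ _))
            (sub_nonneg.2 (min_le_left _ _)) (by simpa using hJw)

theorem Regular.wealthValue_le (hf : P.Regular f J C) {w W : ℝ} (hw : 0 ≤ w)
    (hW : W ∈ Set.Icc P.Wlo P.Whi) : P.wealthValue f w ≤ P.objective f w W := by
  obtain ⟨K, -, h⟩ := hf.abs_objective_le w
  refine csInf_le ⟨-K, ?_⟩ ⟨W, hW, rfl⟩
  rintro _ ⟨W', hW', rfl⟩
  exact (abs_le.1 (h w ⟨hw, le_rfl⟩ W' hW')).1

theorem le_wealthValue {w c : ℝ} (h : ∀ W ∈ Set.Icc P.Wlo P.Whi, c ≤ P.objective f w W) :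
    c ≤ P.wealthValue f w := by
  refine le_csInf ((Set.nonempty_Icc.2 P.Wlo_lt.le).image _) ?_
  rintro _ ⟨W, hW, rfl⟩
  exact h W hW

theorem Regular.wealthValue_le_of_le (hf : P.Regular f J C) (R : ℝ) : ∃ K : ℝ, 0 ≤ K ∧
    ∀ w ∈ Set.Icc 0 R, ∀ w' ∈ Set.Icc 0 R, w ≤ w' →
    P.wealthValue f w' ≤ P.wealthValue f w + K * (w' - w) := by
  obtain ⟨K, hK, h⟩ := hf.objective_le_of_le R
  refine ⟨K, hK, fun w hw w' hw' hww => ?_⟩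
  rw [← sub_le_iff_le_add]
  refine le_wealthValue fun W hW => ?_
  linarith [h w hw w' hw' W hW hww, hf.wealthValue_le hw'.1 hW]

/-- The value after one more rebalancing, as a function of the wealth before the cash flow. -/
theorem Regular.wealthValue (hf : P.Regular f J C) (hJ : J ≤ P.shrink * P.bmax) {J' q : ℝ}
    (hq : 0 ≤ q) (hJ' : Real.exp P.ymax ≤ J') (hJJ' : J ≤ P.shrink * J') :
    ∃ C', P.Regular (fun x _ => P.wealthValue f (x + q)) J' C' := by
  set R := P.wealthCap + q with hR
  obtain ⟨K₁, hK₁, h₁⟩ := hf.abs_objective_le R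
  obtain ⟨K₂, hK₂, h₂⟩ := hf.wealthValue_le_of_le R
  obtain ⟨K₃, hK₃, h₃⟩ := hf.objective_le_of_ge hJ R
  have hmem : ∀ x ∈ Set.Icc 0 P.wealthCap, x + q ∈ Set.Icc 0 R := fun x hx =>
    ⟨by linarith [hx.1], by linarith [hx.2]⟩
  have hWlo : P.Wlo ∈ Set.Icc P.Wlo P.Whi := Set.left_mem_Icc.2 P.Wlo_lt.le
  refine ⟨K₁ + K₂ + K₃, by positivity, fun x hx W hW => ?_, fun x hx x' hx' W hW hc => ?_,
    fun x hx W hW W' hW' => ?_⟩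
  · have hx' := hmem x hx
    rw [abs_le]
    constructor
    · refine le_wealthValue fun W hW => ?_
      linarith [(abs_le.1 (h₁ _ hx' W hW)).1]
    · linarith [hf.wealthValue_le hx'.1 hWlo, (abs_le.1 (h₁ _ hx' _ hWlo)).2]
  · rcases le_or_gt x x' with h | h
    · rw [abs_of_nonneg (sub_nonneg.2 h)]
      have := h₂ _ (hmem x hx) _ (hmem x' hx') (by linarith)
      have z : 0 ≤ (K₁ + K₃) * (x' - x) := mul_nonneg (by positivity) (by linarith)
      linarith
    -- Decreasing wealth is allowed only above `J'`. There the wealth is at least `e^ymax`, so all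
    -- three regions are available on both sides and the first alternative on the region applies.
    · have hJx : J' ≤ x' := hc.resolve_left (by linarith)
      rw [abs_sub_comm, abs_of_nonneg (by linarith), ← sub_le_iff_le_add]
      refine le_wealthValue fun W hW => ?_
      have hr := P.shrink_pos
      have := h₃ _ (hmem x' hx') _ (hmem x hx) W hW (by linarith)
        (by linarith [Real.exp_lt_exp.2 P.ymin_lt]) (Or.inl (by linarith)) (by nlinarith)
      have h4 := hf.wealthValue_le (hmem x' hx').1 hW
      have z : 0 ≤ (K₁ + K₂) * (x - x') := mul_nonneg (by positivity) (by linarith)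
      linarith
  · rw [sub_self, abs_zero]
    positivity

end MeanRiskProblem

namespace MeanRiskProblem

variable {P : MeanRiskProblem}

/-! ### One-step comparison of the scheme with the exact recursion -/

theorem abs_exp_sub_le {y₀ y₁ hi : ℝ} (h₀ : y₀ ≤ hi) (h₁ : y₁ ≤ hi) :
    |Real.exp y₁ - Real.exp y₀| ≤ Real.exp hi * |y₁ - y₀| := by
  wlog h : y₀ ≤ y₁ generalizing y₀ y₁
  · rw [abs_sub_comm, abs_sub_comm y₁]
    exact this h₁ h₀ (le_of_not_ge h)
  have h1 := Real.add_one_le_exp (y₀ - y₁)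
  have h2 : Real.exp y₀ = Real.exp y₁ * Real.exp (y₀ - y₁) := by rw [← Real.exp_add]; congr 1; ring
  have h3 := Real.exp_le_exp.2 h₁
  rw [abs_of_nonneg (by linarith [Real.exp_le_exp.2 h]), abs_of_nonneg (by linarith), h2]
  nlinarith [Real.exp_pos y₁]

theorem SmallShift.neg {τ : ℝ} (h : P.SmallShift τ) : P.SmallShift (-τ) := by
  simpa [SmallShift] using h

theorem SmallShift.mono {τ τ' : ℝ} (h : P.SmallShift τ) (h0 : 0 ≤ τ') (hle : τ' ≤ τ) :
    P.SmallShift τ' := by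
  unfold SmallShift at *
  rw [abs_of_nonneg h0]
  rw [abs_of_nonneg (h0.trans hle)] at h
  exact ⟨hle.trans h.1, hle.trans h.2⟩

namespace Grid

variable (G : P.Grid)

/-- All discretization errors of the grid are at most `θ`; `Q` bounds the cash flows. -/
structure Fine (Q θ : ℝ) : Prop where
  y : G.Δy ≤ θ
  exp_y : Real.exp P.yhi * G.Δy ≤ θ
  b : ∀ j < G.nb, G.b (j + 1) - G.b j ≤ θ
  u : ∀ i < G.nu, G.u (i + 1) - G.u i ≤ θ / (P.wealthCap + Q)
  W : ∀ k < G.nw, G.W (k + 1) - G.W k ≤ θ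
  trunc : ∀ x, |P.densityTrunc G.ng x - P.density x| ≤ θ

/-- The grid function `F` agrees with the function `f` of the wealth, up to a shift `σ` of the
wealth and an error `ε`. -/
def Close (f : ℝ → ℝ → ℝ) (F : ℕ → ℕ → ℕ → ℝ) (σ ε : ℝ) : Prop :=
  ∀ n ≤ G.ny, ∀ j ≤ G.nb, ∀ k ≤ G.nw,
    f (Real.exp (G.y n) + G.b j + σ) (G.W k) - ε ≤ F n j k ∧
    F n j k ≤ f (Real.exp (G.y n) + G.b j - σ) (G.W k) + ε

theorem Δy_pos : 0 < G.Δy :=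
  div_pos (by linarith [P.ylo_lt, P.ymin_lt, P.ymax_lt]) (by exact_mod_cast G.ny_pos)

theorem y_zero : G.y 0 = P.ylo := by simp [y]

theorem y_last : G.y G.ny = P.yhi := by
  have : (G.ny : ℝ) ≠ 0 := by exact_mod_cast G.ny_pos.ne'
  simp only [y, Δy]
  field_simp
  ring

theorem y_succ (n : ℕ) : G.y (n + 1) = G.y n + G.Δy := by
  simp only [y]; push_cast; ring

theorem y_lt (n : ℕ) : G.y n < G.y (n + 1) := by
  rw [y_succ]; linarith [G.Δy_pos]

theorem y_mem {n : ℕ} (hn : n ≤ G.ny) : G.y n ∈ Set.Icc P.ylo P.yhi := by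
  rw [← G.y_zero, ← G.y_last]
  exact ⟨partition_mono (fun i _ => G.y_lt i) (Nat.zero_le n) hn,
    partition_mono (fun i _ => G.y_lt i) hn le_rfl⟩

theorem b_mem {j : ℕ} (hj : j ≤ G.nb) : G.b j ∈ Set.Icc 0 P.bmax := by
  rw [← G.b_zero, ← G.b_last]
  exact ⟨partition_mono G.b_lt (Nat.zero_le j) hj, partition_mono G.b_lt hj le_rfl⟩

theorem W_mem {k : ℕ} (hk : k ≤ G.nw) : G.W k ∈ Set.Icc P.Wlo P.Whi := by
  rw [← G.W_zero, ← G.W_last]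
  exact ⟨partition_mono G.W_lt (Nat.zero_le k) hk, partition_mono G.W_lt hk le_rfl⟩

theorem u_mem {i : ℕ} (hi : i ≤ G.nu) : G.u i ∈ Set.Icc (0 : ℝ) 1 := by
  rw [← G.u_zero, ← G.u_last]
  exact ⟨partition_mono G.u_lt (Nat.zero_le i) hi, partition_mono G.u_lt hi le_rfl⟩

theorem settle_eq (F : ℕ → ℕ → ℕ → ℝ) (n j k : ℕ) : G.settle F n j k =
    max 1 (G.b j * P.accrual / P.bmax) *
      linInterp G.nb G.b (fun j' => F n j' k) (G.b j * P.accrual) := rfl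

theorem clamp_b {x : ℝ} (hx : 0 ≤ x) : max (G.b 0) (min x (G.b G.nb)) = min x P.bmax := by
  rw [G.b_zero, G.b_last, max_eq_right (le_min hx P.bmax_pos.le)]

variable {G} {f : ℝ → ℝ → ℝ} {J C : ℝ}

/-- Of the added shift `2 * θ`, one `θ` puts the exact wealth on the favourable side of the
interpolation nodes in `b`, and the other allows `y` to vary over the cells adjacent to the node.
The bound for all such `y` is what the quadrature estimate requires. -/
theorem _root_.MeanRiskProblem.Regular.grid_settle_bounds (hf : P.Regular f J C) :
    ∃ K : ℝ, 0 ≤ K ∧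
    ∀ (G : P.Grid) (Q θ σ ε : ℝ) (F : ℕ → ℕ → ℕ → ℝ), 0 ≤ θ → G.Fine Q θ → 0 ≤ σ → 0 ≤ ε →
    P.SmallShift (σ + 2 * θ) → G.Close f F σ ε →
    ∀ n ≤ G.ny, ∀ j ≤ G.nb, ∀ k ≤ G.nw, ∀ y ∈ Set.Icc P.ylo P.yhi, |y - G.y n| ≤ G.Δy →
    P.settle (liftWealth f (σ + 2 * θ)) y (G.b j) (G.W k) - K * (ε + θ) ≤ G.settle F n j k ∧
    G.settle F n j k ≤
      P.settle (liftWealth f (-(σ + 2 * θ))) y (G.b j) (G.W k) + K * (ε + θ) := by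
  obtain ⟨K, hK, h⟩ := hf.settle_le
  have ha := P.accrual_pos
  have hC := hf.nonneg
  refine ⟨(1 + P.accrual) * (1 + 2 * C) + 2 * K, by positivity, ?_⟩
  intro G Q θ σ ε F hθ hG hσ hε hτ hF n hn j hj k hk y hy hyn
  have hyn' := G.y_mem hn
  have hbj := G.b_mem hj
  have hWk := G.W_mem hk
  have hcash := P.cash_mem hbj
  have hτ1 : P.SmallShift (σ + θ) := hτ.mono (by linarith) (by linarith)
  have hτ0 : P.SmallShift σ := hτ.mono (by linarith) (by linarith)
  have hexp : |Real.exp y - Real.exp (G.y n)| ≤ θ := by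
    refine (abs_exp_sub_le hyn'.2 hy.2).trans (le_trans ?_ hG.exp_y)
    exact mul_le_mul_of_nonneg_left hyn (Real.exp_pos _).le
  have hexp' := abs_le.1 hexp
  have hfac := P.settleFactor_mem hbj
  have hE : 0 ≤ ε + 2 * C * θ := by positivity
  have hclamp : max (G.b 0) (min (G.b j * P.accrual) (G.b G.nb)) = P.cash (G.b j) :=
    G.clamp_b (mul_nonneg hbj.1 ha.le)
  have z1 : 0 ≤ (1 + P.accrual) * (2 * C) * ε := by positivity
  have z2 : 0 ≤ (1 + P.accrual) * θ := by positivity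
  have z3 : 0 ≤ 2 * K * ε := by positivity
  constructor
  · have s1 : f (Real.exp (G.y n) + P.cash (G.b j) + (σ + θ)) (G.W k) - (ε + 2 * C * θ) ≤
        linInterp G.nb G.b (fun j' => F n j' k) (G.b j * P.accrual) := by
      refine le_linInterp G.b_lt hθ hG.b fun i hi hd => ?_
      rw [hclamp] at hd
      have hd' := abs_le.1 hd
      have := hf.step _ (hτ0.mem hyn' (G.b_mem hi)) _ (hτ1.mem hyn' hcash) _ hWk
        (Or.inl (by linarith))
      have hx : |Real.exp (G.y n) + P.cash (G.b j) + (σ + θ) - (Real.exp (G.y n) + G.b i + σ)| ≤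
          2 * θ := by
        rw [abs_le]; constructor <;> linarith
      linarith [(hF n hn i hi k hk).1, mul_le_mul_of_nonneg_left hx hC]
    have s2 : P.settle (liftWealth f (σ + θ)) (G.y n) (G.b j) (G.W k) -
        (1 + P.accrual) * (ε + 2 * C * θ) ≤ G.settle F n j k := by
      rw [settle_liftWealth, settle_eq]
      have := mul_le_mul_of_nonneg_left s1 (by linarith [hfac.1] :
        0 ≤ max 1 (G.b j * P.accrual / P.bmax))
      have := mul_le_mul_of_nonneg_right hfac.2 hE
      linarith
    have s3 := h _ hyn' _ hy _ hbj _ hbj _ hWk (σ + θ) (σ + 2 * θ) hτ1 hτ (Or.inl (by linarith))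
    have e : |σ + 2 * θ - (σ + θ)| = θ := by
      rw [show σ + 2 * θ - (σ + θ) = θ by ring, abs_of_nonneg hθ]
    rw [e, sub_self, abs_zero, add_zero] at s3
    have := mul_le_mul_of_nonneg_left hexp hK
    linarith
  · have s1 : linInterp G.nb G.b (fun j' => F n j' k) (G.b j * P.accrual) ≤
        f (Real.exp (G.y n) + P.cash (G.b j) + -(σ + θ)) (G.W k) + (ε + 2 * C * θ) := by
      refine linInterp_le G.b_lt hθ hG.b fun i hi hd => ?_
      rw [hclamp] at hd
      have hd' := abs_le.1 hd
      have := hf.step _ (hτ1.neg.mem hyn' hcash) _ (hτ0.neg.mem hyn' (G.b_mem hi)) _ hWk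
        (Or.inl (by linarith))
      have hx : |Real.exp (G.y n) + G.b i + -σ - (Real.exp (G.y n) + P.cash (G.b j) + -(σ + θ))| ≤
          2 * θ := by
        rw [abs_le]; constructor <;> linarith
      have hF' := (hF n hn i hi k hk).2
      rw [sub_eq_add_neg] at hF'
      linarith [mul_le_mul_of_nonneg_left hx hC]
    have s2 : G.settle F n j k ≤ P.settle (liftWealth f (-(σ + θ))) (G.y n) (G.b j) (G.W k) +
        (1 + P.accrual) * (ε + 2 * C * θ) := by
      rw [settle_liftWealth, settle_eq]
      have := mul_le_mul_of_nonneg_left s1 (by linarith [hfac.1] :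
        0 ≤ max 1 (G.b j * P.accrual / P.bmax))
      have := mul_le_mul_of_nonneg_right hfac.2 hE
      linarith
    have s3 := h _ hy _ hyn' _ hbj _ hbj _ hWk (-(σ + 2 * θ)) (-(σ + θ)) hτ.neg hτ1.neg
      (Or.inl (by linarith))
    have e : |-(σ + θ) - -(σ + 2 * θ)| = θ := by
      rw [show -(σ + θ) - -(σ + 2 * θ) = θ by ring, abs_of_nonneg hθ]
    rw [e, sub_self, abs_zero, add_zero, abs_sub_comm] at s3
    have := mul_le_mul_of_nonneg_left hexp hK
    linarith

/-- Each nodal value is dominated by `e` throughout the adjacent cells, so each trapezoid is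
dominated by the integral over its cell. The integrand need not be continuous. Only an upper bound
is stated; the lower one follows by changing signs. -/
theorem _root_.MeanRiskProblem.exists_sum_weight_le (P : MeanRiskProblem) : ∃ K : ℝ, 0 ≤ K ∧
    ∀ (G : P.Grid) (Q θ B c x : ℝ) (h : ℕ → ℝ) (e : ℝ → ℝ), θ ≤ 1 → G.Fine Q θ → 0 ≤ B → 0 ≤ c →
    IntervalIntegrable e volume P.ylo P.yhi → (∀ y ∈ Set.Icc P.ylo P.yhi, |e y| ≤ B) →
    (∀ l ≤ G.ny, ∀ y ∈ Set.Icc P.ylo P.yhi, |y - G.y l| ≤ G.Δy → h l ≤ e y + c) →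
    ∑ l ∈ Finset.range (G.ny + 1), G.weight l * P.densityTrunc G.ng (x - G.y l) * h l ≤
      (∫ y in P.ylo..P.yhi, e y * P.density (x - y)) + K * (B * θ + c) := by
  obtain ⟨A, hA, hbd, hlip, htr, -⟩ := P.exists_density_bounds
  have hlen : 0 ≤ P.yhi - P.ylo := by linarith [P.ylo_le_yhi]
  refine ⟨(1 + A) * (P.yhi - P.ylo), by positivity, ?_⟩
  intro G Q θ B c x h e hθ1 hG hB hc he heB hh
  have hD := G.Δy_pos
  have hθ : 0 ≤ θ := hD.le.trans hG.y
  set E := (1 + A) * (B * θ + c) with hE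
  set p : ℕ → ℝ := fun l => P.densityTrunc G.ng (x - G.y l) * h l with hp
  have hpt : ∀ l ≤ G.ny, ∀ y ∈ Set.Icc P.ylo P.yhi, |y - G.y l| ≤ G.Δy →
      p l ≤ e y * P.density (x - y) + E := by
    intro l hl y hy hd
    have h1 := hh l hl y hy hd
    have h2 := htr G.ng (x - G.y l)
    have h3 := hG.trunc (x - G.y l)
    have h4 := hlip (x - G.y l) (x - y)
    rw [show x - G.y l - (x - y) = y - G.y l by ring] at h4
    have h5 := hbd (x - G.y l)
    have h6 := heB y hy
    simp only [hp]
    set g := P.densityTrunc G.ng (x - G.y l)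
    set g' := P.density (x - G.y l)
    set g'' := P.density (x - y)
    have h7 : |g - g''| ≤ (1 + A) * θ := by
      have := abs_sub_le g g' g''
      have := mul_le_mul_of_nonneg_left (hd.trans hG.y) hA
      linarith
    have h8 : g ≤ 1 + A := by linarith [(abs_le.1 h3).2]
    have h9 : (g - g'') * e y ≤ (1 + A) * θ * B := by
      refine (le_abs_self _).trans ?_
      rw [abs_mul]
      exact mul_le_mul h7 h6 (abs_nonneg _) (by positivity)
    have h10 := mul_le_mul_of_nonneg_left h1 h2
    have h11 := mul_le_mul_of_nonneg_right h8 hc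
    rw [hE]
    linarith
  have hsum : ∑ l ∈ Finset.range (G.ny + 1), G.weight l * P.densityTrunc G.ng (x - G.y l) * h l =
      ∑ l ∈ Finset.range G.ny, G.Δy / 2 * (p l + p (l + 1)) := by
    rw [← sum_trapezoid G.ny G.ny_pos]
    exact Finset.sum_congr rfl fun l _ => by simp only [weight, hp, mul_assoc]
  have hint : IntervalIntegrable (fun y => e y * P.density (x - y) + E) volume P.ylo P.yhi :=
    (P.intervalIntegrable_mul_density he x).add intervalIntegrable_const
  have hint' : ∀ l < G.ny, IntervalIntegrable (fun y => e y * P.density (x - y) + E) volume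
      (G.y l) (G.y (l + 1)) := fun l hl => by
    refine hint.mono_set ?_
    rw [Set.uIcc_of_le P.ylo_le_yhi]
    exact Set.uIcc_subset_Icc (G.y_mem hl.le) (G.y_mem hl)
  have hcell : ∀ l < G.ny, G.Δy / 2 * (p l + p (l + 1)) ≤
      ∫ y in G.y l..G.y (l + 1), (e y * P.density (x - y) + E) := by
    intro l hl
    have hc1 : ∫ _ in G.y l..G.y (l + 1), (p l + p (l + 1)) / 2 =
        G.Δy / 2 * (p l + p (l + 1)) := by
      rw [intervalIntegral.integral_const, y_succ, smul_eq_mul]; ring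
    rw [← hc1]
    refine intervalIntegral.integral_mono_on (G.y_lt l).le intervalIntegrable_const (hint' l hl)
      fun y hy => ?_
    have hy' : y ∈ Set.Icc P.ylo P.yhi :=
      ⟨(G.y_mem hl.le).1.trans hy.1, hy.2.trans (G.y_mem hl).2⟩
    have hs := G.y_succ l
    have h1 := hpt l hl.le y hy' (by rw [abs_le]; constructor <;> linarith [hy.1, hy.2])
    have h2 := hpt (l + 1) hl y hy' (by rw [abs_le]; constructor <;> linarith [hy.1, hy.2])
    linarith
  rw [hsum]
  calc _ ≤ ∑ l ∈ Finset.range G.ny, ∫ y in G.y l..G.y (l + 1), (e y * P.density (x - y) + E) :=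
        Finset.sum_le_sum fun l hl => hcell l (Finset.mem_range.1 hl)
    _ = ∫ y in P.ylo..P.yhi, (e y * P.density (x - y) + E) := by
        rw [intervalIntegral.sum_integral_adjacent_intervals fun l hl => hint' l hl, y_zero, y_last]
    _ = _ := by
        rw [intervalIntegral.integral_add (P.intervalIntegrable_mul_density he x)
          intervalIntegrable_const, intervalIntegral.integral_const, smul_eq_mul, hE]
        ring

/-- Both recursions branch on the same node `y n`, so their branches agree. In the interior the
quadrature estimate is applied to the settled values and to their negatives. -/
theorem _root_.MeanRiskProblem.Regular.grid_advance_bounds (hf : P.Regular f J C) :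
    ∃ K : ℝ, 0 ≤ K ∧
    ∀ (G : P.Grid) (Q θ σ ε : ℝ) (F : ℕ → ℕ → ℕ → ℝ), θ ≤ 1 → G.Fine Q θ → 0 ≤ σ → 0 ≤ ε →
    P.SmallShift (σ + 2 * θ) → G.Close f F σ ε →
    ∀ n ≤ G.ny, ∀ j ≤ G.nb, ∀ k ≤ G.nw,
    P.advance (liftWealth f (σ + 2 * θ)) (G.y n) (G.b j) (G.W k) - K * (ε + θ) ≤
      G.advance F n j k ∧
    G.advance F n j k ≤
      P.advance (liftWealth f (-(σ + 2 * θ))) (G.y n) (G.b j) (G.W k) + K * (ε + θ) := by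
  obtain ⟨K₁, hK₁, h₁⟩ := hf.grid_settle_bounds
  obtain ⟨K₂, hK₂, h₂⟩ := P.exists_sum_weight_le
  have ha := P.accrual_pos
  have hC := hf.nonneg
  have hm := Real.exp_pos (P.μ * P.Δt)
  set B := (1 + P.accrual) * C with hB
  have hB0 : 0 ≤ B := by positivity
  refine ⟨(1 + Real.exp (P.μ * P.Δt)) * K₁ + K₂ * (B + K₁), by positivity, ?_⟩
  intro G Q θ σ ε F hθ1 hG hσ hε hτ hF n hn j hj k hk
  have hD := G.Δy_pos
  have hθ : 0 ≤ θ := hD.le.trans hG.y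
  have hs := h₁ G Q θ σ ε F hθ hG hσ hε hτ hF
  have hn' := hs n hn j hj k hk (G.y n) (G.y_mem hn) (by rw [sub_self, abs_zero]; exact hD.le)
  have z1 : 0 ≤ Real.exp (P.μ * P.Δt) * K₁ * (ε + θ) := by positivity
  have z2 : 0 ≤ K₂ * (B + K₁) * (ε + θ) := by positivity
  have z3 : 0 ≤ K₁ * (ε + θ) := by positivity
  have z4 : 0 ≤ K₂ * B * ε := by positivity
  unfold Grid.advance MeanRiskProblem.advance
  split_ifs
  · constructor <;> linarith [hn'.1, hn'.2]
  · have t1 := mul_le_mul_of_nonneg_left hn'.1 hm.le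
    have t2 := mul_le_mul_of_nonneg_left hn'.2 hm.le
    constructor <;> linarith
  · constructor
    · have := h₂ G Q θ B (K₁ * (ε + θ)) (G.y n) (fun l => -G.settle F l j k)
        (fun y => -P.settle (liftWealth f (σ + 2 * θ)) y (G.b j) (G.W k)) hθ1 hG hB0 z3
        (hf.intervalIntegrable_settle (G.b_mem hj) (G.W_mem hk) hτ).neg
        (fun y hy => by rw [abs_neg]; exact hf.abs_settle_le hy (G.b_mem hj) (G.W_mem hk) hτ)
        (fun l hl y hy hd => by linarith [(hs l hl j hj k hk y hy hd).1])
      simp only [mul_neg, neg_mul, Finset.sum_neg_distrib, intervalIntegral.integral_neg] at this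
      linarith
    · have := h₂ G Q θ B (K₁ * (ε + θ)) (G.y n) (fun l => G.settle F l j k)
        (fun y => P.settle (liftWealth f (-(σ + 2 * θ))) y (G.b j) (G.W k)) hθ1 hG hB0 z3
        (hf.intervalIntegrable_settle (G.b_mem hj) (G.W_mem hk) hτ.neg)
        (fun y hy => hf.abs_settle_le hy (G.b_mem hj) (G.W_mem hk) hτ.neg)
        (fun l hl y hy hd => (hs l hl j hj k hk y hy hd).2)
      linarith

end Grid

end MeanRiskProblem

namespace MeanRiskProblem

variable {P : MeanRiskProblem}

/-! ### Competitors that respect the regions, and one step of the control search -/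

/-- A lead `ℓ` in cash survives settlement, scaled by `accrual`, unless the cap interferes. In that
case the settled cash is close to or above `shrink * bmax`, the level from which `Regular` gives a
comparison without any order. -/
theorem cash_add_le_or {c₀ c₁ ℓ ℓ' : ℝ} (hℓ' : 0 ≤ ℓ')
    (h : c₀ + ℓ ≤ c₁ ∨ P.bmax - ℓ' ≤ c₁) :
    P.cash c₀ + P.accrual * ℓ ≤ P.cash c₁ ∨ P.shrink * P.bmax - P.accrual * ℓ' ≤ P.cash c₁ := by
  have ha := P.accrual_pos
  have h1 := P.shrink_le_one
  have h2 := P.shrink_le_accrual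
  have hb := P.bmax_pos
  have h3 : P.shrink * P.bmax ≤ P.bmax := mul_le_of_le_one_left hb.le h1
  have h4 : P.shrink * P.bmax ≤ P.accrual * P.bmax := mul_le_mul_of_nonneg_right h2 hb.le
  have h5 : 0 ≤ P.accrual * ℓ' := by positivity
  have h6 : P.cash c₀ ≤ c₀ * P.accrual := min_le_left _ _
  rcases min_cases (c₁ * P.accrual) P.bmax with ⟨e, -⟩ | ⟨e, -⟩
  · unfold cash at h6 ⊢
    rw [e]
    rcases h with h | h
    · left; nlinarith
    · right; nlinarith
  · right
    unfold cash
    rw [e]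
    linarith

/-- Any amount can be moved slightly so that a neighbourhood of it stays in the same region. -/
theorem exists_amount_sameRegion {θ s₀ : ℝ} (hθ : 0 < θ)
    (h1 : Real.exp P.ylo + θ ≤ Real.exp P.ymin) (h2 : Real.exp P.ymin + 6 * θ ≤ Real.exp P.ymax)
    (h3 : Real.exp P.ymax + θ ≤ Real.exp P.yhi) (hs₀ : 0 ≤ s₀) :
    ∃ t, 0 ≤ t ∧ t ≤ s₀ + 4 * θ ∧ ∀ s, 0 ≤ s → t - θ ≤ s → s ≤ t → |s - s₀| ≤ 4 * θ ∧
      ∀ y, |Real.exp y - Real.exp (P.logAmount s)| ≤ θ → P.SameRegion y (P.logAmount s₀) := by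
  have hlo := Real.exp_pos P.ylo
  simp only [exp_logAmount]
  rcases le_or_gt s₀ (Real.exp P.ymin) with c1 | c1
  · refine ⟨max (s₀ - θ) 0, le_max_right _ _, max_le (by linarith) (by linarith), ?_⟩
    intro s hs hts hst
    refine ⟨?_, fun y hy => Or.inl ⟨?_, P.logAmount_le_ymin.2 c1⟩⟩
    · have q1 := le_max_left (s₀ - θ) 0
      have q2 : max (s₀ - θ) 0 ≤ s₀ := max_le (by linarith) hs₀
      rw [abs_le]; constructor <;> linarith
    · have q1 : s ≤ Real.exp P.ymin - θ := hst.trans (max_le (by linarith) (by linarith))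
      have q2 : max (Real.exp P.ylo) (min s (Real.exp P.yhi)) ≤ Real.exp P.ymin - θ :=
        max_le (by linarith) ((min_le_left _ _).trans q1)
      rw [← Real.exp_le_exp]
      linarith [(abs_le.1 hy).2]
  · rcases lt_or_ge s₀ (Real.exp P.ymax) with c2 | c2
    · have q0 : Real.exp P.ymin + 3 * θ ≤ Real.exp P.ymax - 2 * θ := by linarith
      -- The margins leave room for rounding the control down by `θ` and for passing to an
      -- interpolation node at distance `θ`, with strict inequalities remaining.
      set t := max (Real.exp P.ymin + 3 * θ) (min s₀ (Real.exp P.ymax - 2 * θ)) with ht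
      have q1 : Real.exp P.ymin + 3 * θ ≤ t := le_max_left _ _
      have q2 : t ≤ Real.exp P.ymax - 2 * θ := max_le q0 (min_le_right _ _)
      have q3 : t ≤ s₀ + 3 * θ := max_le (by linarith) ((min_le_left _ _).trans (by linarith))
      have q4 : s₀ - 2 * θ ≤ t := le_trans (le_min (by linarith) (by linarith)) (le_max_right _ _)
      refine ⟨t, by linarith [Real.exp_pos P.ymin], by linarith, fun s hs hts hst => ⟨?_, ?_⟩⟩
      · rw [abs_le]; constructor <;> linarith
      · intro y hy
        have e : max (Real.exp P.ylo) (min s (Real.exp P.yhi)) = s := by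
          rw [min_eq_left (by linarith), max_eq_right (by linarith)]
        rw [e] at hy
        have := abs_le.1 hy
        refine Or.inr (Or.inl ⟨⟨?_, ?_⟩, P.ymin_lt_logAmount.2 c1, P.logAmount_lt_ymax.2 c2⟩)
        · rw [← Real.exp_lt_exp]; linarith
        · rw [← Real.exp_lt_exp]; linarith
    · refine ⟨s₀ + 2 * θ, by linarith, by linarith, fun s hs hts hst => ⟨?_, ?_⟩⟩
      · rw [abs_le]; constructor <;> linarith
      · intro y hy
        refine Or.inr (Or.inr ⟨?_, P.ymax_le_logAmount.2 c2⟩)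
        have q : Real.exp P.ymax + θ ≤ max (Real.exp P.ylo) (min s (Real.exp P.yhi)) :=
          le_trans (le_min (by linarith) h3) (le_max_right _ _)
        rw [← Real.exp_le_exp]
        linarith [(abs_le.1 hy).1]

/-- A log-price near that of an amount is, up to the region, the log-price of a nearby amount. -/
theorem exists_amount_of_logPrice {θ s y : ℝ}
    (h1 : Real.exp P.ylo + θ ≤ Real.exp P.ymin) (h3 : Real.exp P.ymax + θ ≤ Real.exp P.yhi)
    (hs : 0 ≤ s) (hy : y ∈ Set.Icc P.ylo P.yhi)
    (hd : |Real.exp y - Real.exp (P.logAmount s)| ≤ θ) :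
    ∃ s₁, 0 ≤ s₁ ∧ |s₁ - s| ≤ θ ∧ |Real.exp (P.logAmount s₁) - Real.exp y| ≤ θ ∧
      P.SameRegion (P.logAmount s₁) y := by
  have hθ : 0 ≤ θ := (abs_nonneg _).trans hd
  have hlh := Real.exp_le_exp.2 P.ylo_le_yhi
  have hd' := abs_le.1 hd
  rw [exp_logAmount] at hd'
  rcases le_or_gt s (Real.exp P.ylo) with c | c
  · refine ⟨s, hs, by simpa using hθ, by rwa [abs_sub_comm], Or.inl ⟨?_, ?_⟩⟩
    · exact P.logAmount_le_ymin.2 (by linarith)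
    · rw [max_eq_left ((min_le_left _ _).trans c)] at hd'
      rw [← Real.exp_le_exp]; linarith
  · rcases le_or_gt s (Real.exp P.yhi) with c' | c'
    · rw [min_eq_left c', max_eq_right c.le] at hd'
      have e : P.logAmount (Real.exp y) = y := by
        rw [← Real.exp_eq_exp, exp_logAmount, min_eq_left (Real.exp_le_exp.2 hy.2),
          max_eq_right (Real.exp_le_exp.2 hy.1)]
      refine ⟨Real.exp y, (Real.exp_pos y).le, abs_le.2 hd', ?_, ?_⟩
      · rw [e, sub_self, abs_zero]; exact hθ
      · rw [e]; exact SameRegion.refl P y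
    · refine ⟨s, hs, by simpa using hθ, by rwa [abs_sub_comm], Or.inr (Or.inr ⟨?_, ?_⟩)⟩
      · exact P.ymax_le_logAmount.2 (by linarith)
      · rw [min_eq_right c'.le, max_eq_right hlh] at hd'
        rw [← Real.exp_le_exp]; linarith

namespace Grid

variable {G : P.Grid} {f : ℝ → ℝ → ℝ} {J C : ℝ}

/-- Exhaustive search over the control nodes, for a normalized criterion. -/
noncomputable def searchControl (G : P.Grid) (m : ℕ) (F : ℕ → ℕ → ℕ → ℝ) (n j k : ℕ) : ℝ :=
  sInf ((fun i => G.extend (G.advance F) (G.u i * P.wealth m (G.y n) (G.b j))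
    ((1 - G.u i) * P.wealth m (G.y n) (G.b j)) k) '' Set.Iic G.nu)

/-- Exhaustive search over control and threshold nodes, for a normalized criterion. -/
noncomputable def searchThreshold (G : P.Grid) (m : ℕ) (F : ℕ → ℕ → ℕ → ℝ) (n j : ℕ) : ℝ :=
  sInf (G.searchControl m F n j '' Set.Iic G.nw)

theorem searchControl_le {m n j k i : ℕ} {F : ℕ → ℕ → ℕ → ℝ} (hi : i ≤ G.nu) :
    G.searchControl m F n j k ≤ G.extend (G.advance F) (G.u i * P.wealth m (G.y n) (G.b j))
      ((1 - G.u i) * P.wealth m (G.y n) (G.b j)) k :=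
  csInf_le ((Set.finite_Iic _).image _).bddBelow ⟨i, hi, rfl⟩

theorem searchThreshold_le {m n j k : ℕ} {F : ℕ → ℕ → ℕ → ℝ} (hk : k ≤ G.nw) :
    G.searchThreshold m F n j ≤ G.searchControl m F n j k :=
  csInf_le ((Set.finite_Iic _).image _).bddBelow ⟨k, hk, rfl⟩

theorem one_le_growth (P : MeanRiskProblem) (s b : ℝ) : 1 ≤ P.growth s b :=
  one_le_mul_of_one_le_of_one_le (le_max_left _ _) (le_max_left _ _)

theorem clamp_y (G : P.Grid) (s : ℝ) :
    max (G.y 0) (min (P.logAmount s) (G.y G.ny)) = P.logAmount s := by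
  have := P.logAmount_mem s
  rw [G.y_zero, G.y_last, min_eq_left this.2, max_eq_right this.1]

theorem extend_le {A : ℕ → ℕ → ℕ → ℝ} {s b c θ Q : ℝ} {k : ℕ} (hG : G.Fine Q θ) (hb : 0 ≤ b)
    (h : ∀ n ≤ G.ny, ∀ j ≤ G.nb, |G.y n - P.logAmount s| ≤ G.Δy → |G.b j - min b P.bmax| ≤ θ →
      P.growth s b * A n j k ≤ c) : G.extend A s b k ≤ c := by
  have hD := G.Δy_pos
  have hg := one_le_growth P s b
  have hθ : 0 ≤ θ := hD.le.trans hG.y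
  unfold extend
  rw [← linInterp_const_mul]
  refine linInterp_le G.b_lt hθ hG.b fun j hj hjd => ?_
  rw [G.clamp_b hb] at hjd
  rw [← linInterp_const_mul]
  refine linInterp_le (fun i _ => G.y_lt i) hD.le (fun i _ => by rw [y_succ]; linarith)
    fun n hn hnd => ?_
  rw [clamp_y] at hnd
  exact h n hn j hj hnd hjd

theorem le_extend {A : ℕ → ℕ → ℕ → ℝ} {s b c θ Q : ℝ} {k : ℕ} (hG : G.Fine Q θ) (hb : 0 ≤ b)
    (h : ∀ n ≤ G.ny, ∀ j ≤ G.nb, |G.y n - P.logAmount s| ≤ G.Δy → |G.b j - min b P.bmax| ≤ θ →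
      c ≤ P.growth s b * A n j k) : c ≤ G.extend A s b k := by
  have hD := G.Δy_pos
  have hθ : 0 ≤ θ := hD.le.trans hG.y
  unfold extend
  rw [← linInterp_const_mul]
  refine le_linInterp G.b_lt hθ hG.b fun j hj hjd => ?_
  rw [G.clamp_b hb] at hjd
  rw [← linInterp_const_mul]
  refine le_linInterp (fun i _ => G.y_lt i) hD.le (fun i _ => by rw [y_succ]; linarith)
    fun n hn hnd => ?_
  rw [clamp_y] at hnd
  exact h n hn j hj hnd hjd

theorem Fine.abs_exp_sub_le {Q θ : ℝ} (hG : G.Fine Q θ) {n : ℕ} (hn : n ≤ G.ny) {y : ℝ}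
    (hy : y ∈ Set.Icc P.ylo P.yhi) (hd : |G.y n - y| ≤ G.Δy) :
    |Real.exp (G.y n) - Real.exp y| ≤ θ :=
  (MeanRiskProblem.abs_exp_sub_le hy.2 (G.y_mem hn).2).trans
    ((mul_le_mul_of_nonneg_left hd (Real.exp_pos _).le).trans hG.exp_y)

/-- The control mesh is scaled by the largest wealth, so rounding the fraction down changes the
risky amount by at most `θ`. -/
theorem Fine.exists_control {Q θ w t : ℝ} (hG : G.Fine Q θ) (hθ : 0 ≤ θ) (hw : 0 < w)
    (hwU : w ≤ P.wealthCap + Q) (ht : 0 ≤ t) (htw : t ≤ w) :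
    ∃ i ≤ G.nu, t - θ ≤ G.u i * w ∧ G.u i * w ≤ t := by
  obtain ⟨i, hi, h1, h2⟩ := exists_partition_point (a := G.u) (n := G.nu)
    (θ := θ / (P.wealthCap + Q)) (x := t / w) (div_nonneg hθ (hw.le.trans hwU)) hG.u
    (by rw [G.u_zero]; positivity) (by rw [G.u_last, div_le_one hw]; exact htw)
  refine ⟨i, hi, ?_, (le_div_iff₀ hw).1 h1⟩
  have h3 := (div_le_iff₀ hw).1 h2
  have h4 : θ / (P.wealthCap + Q) * w ≤ θ := by
    rw [div_mul_eq_mul_div, div_le_iff₀ (hw.trans_le hwU)]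
    exact mul_le_mul_of_nonneg_left hwU hθ
  linarith

theorem _root_.MeanRiskProblem.wealthCap_pos (P : MeanRiskProblem) : 0 < P.wealthCap := by
  have := P.bmax_pos
  have := Real.exp_pos P.yhi
  unfold wealthCap; linarith

theorem wealth_bounds {m n j : ℕ} (hn : n ≤ G.ny) (hj : j ≤ G.nb) {Q : ℝ} (hq : 0 ≤ P.q m)
    (hQ : P.q m ≤ Q) : Real.exp P.ylo ≤ P.wealth m (G.y n) (G.b j) ∧
      P.wealth m (G.y n) (G.b j) ≤ P.wealthCap + Q - 1 := by
  have h1 := Real.exp_le_exp.2 (G.y_mem hn).1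
  have h2 := Real.exp_le_exp.2 (G.y_mem hn).2
  have h3 := G.b_mem hj
  unfold wealth wealthCap
  constructor <;> linarith [h3.1, h3.2]

theorem exists_threshold_le {a b : ℝ} (hab : a < b) (c : ℝ) : ∃ θ > 0, a + c * θ ≤ b := by
  refine ⟨(b - a) / (|c| + 1), by have := sub_pos.2 hab; positivity, ?_⟩
  have h : c * ((b - a) / (|c| + 1)) ≤ b - a := by
    rw [← mul_div_assoc, div_le_iff₀ (by positivity)]
    nlinarith [le_abs_self c, sub_pos.2 hab]
  linarith

/-- The smallness conditions collected here leave room inside each region and keep shifted wealths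
in range. The last one lets `e^ylo` pay for the shift and the rounding of cash when the cap on the
bank account binds. -/
theorem exists_small (P : MeanRiskProblem) (S L : ℝ) (hS : 0 ≤ S) (hL : 0 ≤ L) :
    ∃ θ₀ > 0, ∀ θ, 0 < θ → θ ≤ θ₀ → θ ≤ 1 ∧ P.SmallShift (S * θ + 2 * θ) ∧
      Real.exp P.ylo + θ ≤ Real.exp P.ymin ∧ Real.exp P.ymin + 6 * θ ≤ Real.exp P.ymax ∧
      Real.exp P.ymax + θ ≤ Real.exp P.yhi ∧ L * θ ≤ 1 ∧ L * θ ≤ Real.exp P.ylo ∧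
      P.accrual * θ + (S * θ + 2 * θ) ≤ Real.exp P.ylo := by
  have e0 := Real.exp_pos P.ylo
  have ha := P.accrual_pos
  obtain ⟨t1, p1, h1⟩ := exists_threshold_le (Real.exp_lt_exp.2 P.ylo_lt) 1
  obtain ⟨t2, p2, h2⟩ := exists_threshold_le (Real.exp_lt_exp.2 P.ymin_lt) 6
  obtain ⟨t3, p3, h3⟩ := exists_threshold_le (Real.exp_lt_exp.2 P.ymax_lt) 1
  obtain ⟨t4, p4, h4⟩ := exists_threshold_le (zero_lt_one (α := ℝ)) (L + S + 3)
  obtain ⟨t5, p5, h5⟩ := exists_threshold_le e0 (L + S + 2 + P.accrual)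
  refine ⟨min (min t1 t2) (min t3 (min t4 t5)), by positivity, fun θ hθ hle => ?_⟩
  simp only [le_min_iff] at hle
  obtain ⟨⟨l1, l2⟩, l3, l4, l5⟩ := hle
  have m4 := mul_le_mul_of_nonneg_left l4 (by positivity : 0 ≤ L + S + 3)
  have m5 := mul_le_mul_of_nonneg_left l5 (by positivity : 0 ≤ L + S + 2 + P.accrual)
  have n1 : 0 ≤ L * θ := by positivity
  have n2 : 0 ≤ S * θ := by positivity
  have n3 : 0 ≤ P.accrual * θ := by positivity
  refine ⟨by linarith, ⟨?_, ?_⟩, by linarith, by linarith, by linarith, by linarith, by linarith,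
    by linarith⟩
  · rw [abs_of_nonneg (by positivity)]; linarith
  · rw [abs_of_nonneg (by positivity)]; linarith

/-- Shift of the wealth, in units of the mesh, caused by one step of the scheme. -/
noncomputable def stepShift (P : MeanRiskProblem) (S : ℝ) : ℝ := 5 + (7 + S) / P.accrual

theorem five_le_stepShift (P : MeanRiskProblem) {S : ℝ} (hS : 0 ≤ S) : 5 ≤ stepShift P S := by
  have := P.accrual_pos
  have : 0 ≤ (7 + S) / P.accrual := by positivity
  unfold stepShift; linarith

/-- The cash lead is `Λ - 5`: moving the risky amount costs up to 4 units and interpolation in `b`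
one more. After interest the lead is `7 + S`, which covers a displacement of 5 in `e^y` and the
shift `S + 2` from the settlement and the convolution. -/
theorem accrual_mul_stepShift (P : MeanRiskProblem) (S : ℝ) :
    P.accrual * (stepShift P S - 5) = 7 + S := by
  have := P.accrual_pos
  unfold stepShift; field_simp; ring

/-- The search over the controls does not beat the exact optimization by much. -/
theorem _root_.MeanRiskProblem.Regular.objective_le_searchControl (hf : P.Regular f J C)
    (hJ : J ≤ P.shrink * P.bmax) {m : ℕ} {Q S T : ℝ} (hq : 0 ≤ P.q m) (hQ : P.q m ≤ Q)
    (hS : 0 ≤ S) (hT : 0 ≤ T) : ∃ E : ℝ, 0 ≤ E ∧ ∃ θ₀ > 0,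
    ∀ (G : P.Grid) (θ : ℝ) (F : ℕ → ℕ → ℕ → ℝ), 0 < θ → θ ≤ θ₀ → G.Fine Q θ →
    G.Close f F (S * θ) (T * θ) → ∀ n ≤ G.ny, ∀ j ≤ G.nb, ∀ k ≤ G.nw,
    P.objective f (P.wealth m (G.y n) (G.b j) + stepShift P S * θ) (G.W k) - E * θ ≤
      G.searchControl m F n j k := by
  have ha := P.accrual_pos
  set R := P.wealthCap + Q with hR
  obtain ⟨K₁, hK₁, h₁⟩ := hf.grid_advance_bounds
  obtain ⟨K₂, hK₂, h₂⟩ := hf.growth_mul_advance_le R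
  obtain ⟨K₃, hK₃, h₃, -⟩ := P.exists_growth_bounds R
  have hΛ5 := five_le_stepShift P hS
  have hΛa := accrual_mul_stepShift P S
  set Λ := stepShift P S
  set E := K₂ * (4 + (Λ + 4) + 5 + (Λ + 5) + (S + 2)) + K₃ * (K₁ * (T + 1)) with hE
  obtain ⟨θ₀, hθ₀, hsmall⟩ := exists_small P S Λ hS (by positivity)
  refine ⟨E, by positivity, θ₀, hθ₀, ?_⟩
  intro G θ F hθ hθle hG hF n hn j hj k hk
  obtain ⟨hθ1, hshift, g1, g2, g3, g4, g5, g6⟩ := hsmall θ hθ hθle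
  have hw := wealth_bounds (G := G) (m := m) hn hj hq hQ
  set w := P.wealth m (G.y n) (G.b j) with hwdef
  have hsl := Real.exp_pos P.ylo
  have hWk := G.W_mem hk
  have hadv := h₁ G Q θ (S * θ) (T * θ) F hθ1 hG (by positivity) (by positivity) hshift hF
  set η := S * θ + 2 * θ with hη
  have hη0 : 0 ≤ η := by positivity
  have hΛθ : 5 * θ ≤ Λ * θ := mul_le_mul_of_nonneg_right hΛ5 hθ.le
  refine le_csInf (Set.nonempty_Iic.image _) ?_
  rintro _ ⟨i, hi, rfl⟩
  have hu := G.u_mem hi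
  simp only [← hwdef]
  set s := G.u i * w with hs
  have hb' : (1 - G.u i) * w = w - s := by rw [hs]; ring
  rw [hb']
  have hs0 : 0 ≤ s := mul_nonneg hu.1 (by linarith)
  have hsw : s ≤ w := mul_le_of_le_one_left (by linarith) hu.2
  -- Every interpolation corner is compared separately. A corner may lie in another region than `s`,
  -- so the competitor `s₁` is chosen in the region of the corner.
  refine le_extend hG (by linarith) fun n' hn' j' hj' hnd hjd => ?_
  have hexp := hG.abs_exp_sub_le hn' (P.logAmount_mem s) hnd
  obtain ⟨s₁, hs₁, hs₁s, hs₁y, hreg⟩ := exists_amount_of_logPrice g1 g3 hs0 (G.y_mem hn') hexp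
  have q1 := abs_le.1 hs₁s
  have q2 := abs_le.1 hjd
  have q3 := abs_le.1 hs₁y
  have hb₁ : 0 ≤ w + Λ * θ - s₁ := by linarith
  have hobj := hf.objective_le hs₁ hb₁ hWk
  rw [show s₁ + (w + Λ * θ - s₁) = w + Λ * θ by ring] at hobj
  have hcash := cash_add_le_or (P := P) (c₀ := G.b j') (ℓ := (Λ - 5) * θ)
    (c₁ := min (w + Λ * θ - s₁) P.bmax) (ℓ' := 0) le_rfl (by
      rcases le_total (w + Λ * θ - s₁) P.bmax with c | c
      · left
        rw [min_eq_left c]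
        linarith [min_le_left (w - s) P.bmax]
      · right
        rw [min_eq_right c]; linarith)
  have hm := h₂ s (by linarith) (w - s) (by linarith) s₁ (by linarith) (w + Λ * θ - s₁)
    (by linarith) (G.y n') (G.y_mem hn') (P.logAmount s₁) (P.logAmount_mem s₁) (G.b j')
    (G.b_mem hj') _ (P.min_bmax_mem hb₁) _ hWk η 0 hshift P.smallShift_zero hreg (by
      right
      rcases hcash with c | c
      · left
        have : P.accrual * ((Λ - 5) * θ) = (7 + S) * θ := by rw [← mul_assoc, hΛa]
        linarith
      · right
        linarith [Real.exp_pos (P.logAmount s₁)])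
  have d1 : |w + Λ * θ - s₁ - (w - s)| ≤ (Λ + 4) * θ := by
    rw [abs_le]; constructor <;> linarith
  have d2 : |min (w + Λ * θ - s₁) P.bmax - G.b j'| ≤ (Λ + 5) * θ := by
    have := abs_sub_le (min (w + Λ * θ - s₁) P.bmax) (min (w - s) P.bmax) (G.b j')
    have := P.abs_min_bmax_sub_le (w + Λ * θ - s₁) (w - s)
    rw [abs_sub_comm (G.b j')] at hjd
    linarith
  have d3 : |0 - η| = (S + 2) * θ := by
    rw [zero_sub, abs_neg, abs_of_nonneg hη0, hη]; ring
  have hD : |s₁ - s| + |w + Λ * θ - s₁ - (w - s)| +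
      |Real.exp (P.logAmount s₁) - Real.exp (G.y n')| +
      |min (w + Λ * θ - s₁) P.bmax - G.b j'| + |0 - η| ≤
      (4 + (Λ + 4) + 5 + (Λ + 5) + (S + 2)) * θ := by
    rw [d3]; linarith
  have hD' := mul_le_mul_of_nonneg_left hD hK₂
  have hA := (hadv n' hn' j' hj' k hk).1
  have hgr := h₃ s (by linarith) (w - s) (by linarith)
  have z0 : 0 ≤ K₁ * (T * θ + θ) := by positivity
  have hA' := mul_le_mul_of_nonneg_left hA (by linarith [hgr.1] : 0 ≤ P.growth s (w - s))
  have hA'' := mul_le_mul_of_nonneg_right hgr.2 z0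
  rw [mul_sub] at hA'
  have hobj' : P.objective f (w + Λ * θ) (G.W k) ≤ P.growth s₁ (w + Λ * θ - s₁) *
    P.advance (liftWealth f 0) (P.logAmount s₁) (min (w + Λ * θ - s₁) P.bmax) (G.W k) := hobj
  rw [hE]
  linarith

/-- The search over the controls is almost as good as the exact optimization. -/
theorem _root_.MeanRiskProblem.Regular.searchControl_le_objective (hf : P.Regular f J C)
    (hJ : J ≤ P.shrink * P.bmax) {m : ℕ} {Q S T : ℝ} (hq : 0 ≤ P.q m) (hQ : P.q m ≤ Q)
    (hS : 0 ≤ S) (hT : 0 ≤ T) : ∃ E : ℝ, 0 ≤ E ∧ ∃ θ₀ > 0,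
    ∀ (G : P.Grid) (θ : ℝ) (F : ℕ → ℕ → ℕ → ℝ), 0 < θ → θ ≤ θ₀ → G.Fine Q θ →
    G.Close f F (S * θ) (T * θ) → ∀ n ≤ G.ny, ∀ j ≤ G.nb, ∀ k ≤ G.nw,
    G.searchControl m F n j k ≤
      P.objective f (P.wealth m (G.y n) (G.b j) - stepShift P S * θ) (G.W k) + E * θ := by
  have ha := P.accrual_pos
  set R := P.wealthCap + Q with hR
  obtain ⟨K₁, hK₁, h₁⟩ := hf.grid_advance_bounds
  obtain ⟨K₂, hK₂, h₂⟩ := hf.growth_mul_advance_le R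
  obtain ⟨K₃, hK₃, h₃, -⟩ := P.exists_growth_bounds R
  have hΛ5 := five_le_stepShift P hS
  have hΛa := accrual_mul_stepShift P S
  set Λ := stepShift P S
  set E := K₂ * (4 + (Λ + 4) + 5 + (Λ + 5) + (S + 2)) + K₃ * (K₁ * (T + 1)) with hE
  obtain ⟨θ₀, hθ₀, hsmall⟩ := exists_small P S Λ hS (by positivity)
  refine ⟨E, by positivity, θ₀, hθ₀, ?_⟩
  intro G θ F hθ hθle hG hF n hn j hj k hk
  obtain ⟨hθ1, hshift, g1, g2, g3, g4, g5, g6⟩ := hsmall θ hθ hθle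
  have hw := wealth_bounds (G := G) (m := m) hn hj hq hQ
  set w := P.wealth m (G.y n) (G.b j) with hwdef
  have hsl := Real.exp_pos P.ylo
  have hWk := G.W_mem hk
  have hadv := h₁ G Q θ (S * θ) (T * θ) F hθ1 hG (by positivity) (by positivity) hshift hF
  set η := S * θ + 2 * θ with hη
  have hη0 : 0 ≤ η := by positivity
  have hΛθ : 5 * θ ≤ Λ * θ := mul_le_mul_of_nonneg_right hΛ5 hθ.le
  rw [← sub_le_iff_le_add]
  refine le_objective (by linarith) fun s₀ b₀ hs₀ hb₀ hsum => ?_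
  rw [sub_le_iff_le_add]
  -- A good split must be imitated by a single control node, all of whose interpolation corners lie
  -- in the region of `s₀`. For this the target amount is first moved away from the region
  -- boundaries.
  obtain ⟨t, ht0, hts₀, ht⟩ := exists_amount_sameRegion hθ g1 g2 g3 hs₀
  obtain ⟨i, hi, hti, hit⟩ := hG.exists_control (w := w) (t := t) hθ.le (by linarith)
    (by linarith) ht0 (by linarith)
  refine (searchControl_le hi).trans ?_
  have hu := G.u_mem hi
  simp only [← hwdef]
  set s := G.u i * w with hs
  have hb' : (1 - G.u i) * w = w - s := by rw [hs]; ring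
  rw [hb']
  have hs0 : 0 ≤ s := mul_nonneg hu.1 (by linarith)
  have hsw : s ≤ w := mul_le_of_le_one_left (by linarith) hu.2
  obtain ⟨hss₀, hregion⟩ := ht s hs0 hti hit
  refine extend_le hG (by linarith) fun n' hn' j' hj' hnd hjd => ?_
  have hexp := hG.abs_exp_sub_le hn' (P.logAmount_mem s) hnd
  have hreg := hregion (G.y n') hexp
  have q1 := abs_le.1 hss₀
  have q2 := abs_le.1 hjd
  have q3 := abs_le.1 ((P.abs_exp_logAmount_sub_le s s₀).trans hss₀)
  have q4 := abs_le.1 hexp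
  have q5 := Real.exp_le_exp.2 (G.y_mem hn').1
  have hcash := cash_add_le_or (P := P) (c₀ := min b₀ P.bmax) (ℓ := (Λ - 5) * θ)
    (c₁ := G.b j') (ℓ' := θ) hθ.le (by
      rcases le_total (w - s) P.bmax with c | c
      · left
        rw [min_eq_left c] at q2
        linarith [min_le_left b₀ P.bmax]
      · right
        rw [min_eq_right c] at q2; linarith)
  have hm := h₂ s₀ (by linarith) b₀ (by linarith) s (by linarith) (w - s)
    (by linarith) (P.logAmount s₀) (P.logAmount_mem s₀) (G.y n') (G.y_mem hn') _
    (P.min_bmax_mem hb₀) (G.b j') (G.b_mem hj') _ hWk 0 (-η) P.smallShift_zero hshift.neg hreg (by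
      right
      rcases hcash with c | c
      · left
        have : P.accrual * ((Λ - 5) * θ) = (7 + S) * θ := by rw [← mul_assoc, hΛa]
        linarith
      · right
        linarith)
  have d0 : |Real.exp (G.y n') - Real.exp (P.logAmount s₀)| ≤ 5 * θ := by
    rw [abs_le]; constructor <;> linarith
  have d1 : |w - s - b₀| ≤ (Λ + 4) * θ := by
    rw [abs_le]; constructor <;> linarith
  have d2 : |G.b j' - min b₀ P.bmax| ≤ (Λ + 5) * θ := by
    have := abs_sub_le (G.b j') (min (w - s) P.bmax) (min b₀ P.bmax)
    have := P.abs_min_bmax_sub_le (w - s) b₀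
    linarith
  have d3 : |-η - 0| = (S + 2) * θ := by
    rw [sub_zero, abs_neg, abs_of_nonneg hη0, hη]; ring
  have hD : |s - s₀| + |w - s - b₀| + |Real.exp (G.y n') - Real.exp (P.logAmount s₀)| +
      |G.b j' - min b₀ P.bmax| + |-η - 0| ≤
      (4 + (Λ + 4) + 5 + (Λ + 5) + (S + 2)) * θ := by
    rw [d3]; linarith
  have hD' := mul_le_mul_of_nonneg_left hD hK₂
  have hA := (hadv n' hn' j' hj' k hk).2
  have hgr := h₃ s (by linarith) (w - s) (by linarith)
  have z0 : 0 ≤ K₁ * (T * θ + θ) := by positivity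
  have hA' := mul_le_mul_of_nonneg_left hA (by linarith [hgr.1] : 0 ≤ P.growth s (w - s))
  have hA'' := mul_le_mul_of_nonneg_right hgr.2 z0
  rw [mul_add] at hA'
  change _ ≤ P.growth s₀ b₀ * P.advance (liftWealth f 0) (P.logAmount s₀) (min b₀ P.bmax) (G.W k)
    + E * θ
  rw [hE]
  linarith

end Grid

end MeanRiskProblem

namespace MeanRiskProblem

variable {P : MeanRiskProblem} {f : ℝ → ℝ → ℝ} {J C : ℝ}

namespace Grid

/-- One step of the scheme stays close to one step of the exact recursion. -/
theorem _root_.MeanRiskProblem.Regular.close_searchThreshold (hf : P.Regular f J C)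
    (hJ : J ≤ P.shrink * P.bmax) {m : ℕ} {Q S T : ℝ} (hq : 0 ≤ P.q m) (hQ : P.q m ≤ Q)
    (hS : 0 ≤ S) (hT : 0 ≤ T) : ∃ S' T' : ℝ, 0 ≤ S' ∧ 0 ≤ T' ∧ ∃ θ₀ > 0,
    ∀ (G : P.Grid) (θ : ℝ) (F : ℕ → ℕ → ℕ → ℝ), 0 < θ → θ ≤ θ₀ → G.Fine Q θ →
    G.Close f F (S * θ) (T * θ) →
    G.Close (fun x _ => P.wealthValue f (x + P.q m)) (fun n j _ => G.searchThreshold m F n j)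
      (S' * θ) (T' * θ) := by
  obtain ⟨E₁, hE₁, θ₁, hθ₁, h₁⟩ := hf.objective_le_searchControl hJ hq hQ hS hT
  obtain ⟨E₂, hE₂, θ₂, hθ₂, h₂⟩ := hf.searchControl_le_objective hJ hq hQ hS hT
  obtain ⟨K, hK, h₃⟩ := hf.abs_objective_sub_le (P.wealthCap + Q)
  have hΛ := five_le_stepShift P hS
  set Λ := stepShift P S
  obtain ⟨θ₃, hθ₃, h₄⟩ := exists_small P S Λ hS (by linarith)
  refine ⟨Λ, E₁ + E₂ + K, by linarith, by positivity, min θ₁ (min θ₂ θ₃), by positivity, ?_⟩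
  intro G θ F hθ hle hG hF n hn j hj k₀ hk₀
  simp only [le_min_iff] at hle
  obtain ⟨-, -, -, -, -, -, hΛlo, -⟩ := h₄ θ hθ hle.2.2
  have hw := wealth_bounds (G := G) (m := m) hn hj hq hQ
  have ew : Real.exp (G.y n) + G.b j + P.q m = P.wealth m (G.y n) (G.b j) := rfl
  have ew1 : Real.exp (G.y n) + G.b j + Λ * θ + P.q m =
    P.wealth m (G.y n) (G.b j) + Λ * θ := by rw [← ew]; ring
  have ew2 : Real.exp (G.y n) + G.b j - Λ * θ + P.q m =
    P.wealth m (G.y n) (G.b j) - Λ * θ := by rw [← ew]; ring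
  simp only [ew1, ew2]
  set w := P.wealth m (G.y n) (G.b j)
  have hlo := Real.exp_pos P.ylo
  have zΛ : 0 ≤ Λ * θ := mul_nonneg (by linarith) hθ.le
  have z1 : 0 ≤ E₁ * θ := by positivity
  have z2 : 0 ≤ E₂ * θ := by positivity
  have z3 : 0 ≤ K * θ := by positivity
  constructor
  · refine le_csInf (Set.nonempty_Iic.image _) ?_
    rintro _ ⟨k, hk, rfl⟩
    have a1 := h₁ G θ F hθ hle.1 hG hF n hn j hj k hk
    have a2 := hf.wealthValue_le (w := w + Λ * θ) (by linarith) (G.W_mem hk)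
    linarith
  · rw [← sub_le_iff_le_add]
    refine le_wealthValue fun W hW => ?_
    obtain ⟨k, hk, hk1, hk2⟩ := exists_partition_point (a := G.W) (n := G.nw) (x := W) hθ.le hG.W
      (by rw [G.W_zero]; exact hW.1) (by rw [G.W_last]; exact hW.2)
    have a1 := h₂ G θ F hθ hle.2.1 hG hF n hn j hj k hk
    have a2 := searchThreshold_le (G := G) (m := m) (n := n) (j := j) (F := F) hk
    have a3 := (abs_le.1 (h₃ (w - Λ * θ) ⟨by linarith, by linarith⟩ _ (G.W_mem hk) W hW)).2
    have a4 : |G.W k - W| ≤ θ := by rw [abs_le]; constructor <;> linarith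
    have a5 := mul_le_mul_of_nonneg_left a4 hK
    linarith

/-! ### Refining grids are eventually fine -/

theorem _root_.MeanRiskProblem.Refining.eventually_fine {G : ℕ → P.Grid} (hG : Refining G)
    {Q θ : ℝ} (hQ : 0 ≤ Q) (hθ : 0 < θ) : ∀ᶠ i in atTop, (G i).Fine Q θ := by
  obtain ⟨A, -, -, -, -, htr⟩ := P.exists_density_bounds
  have hdy : Tendsto (fun i => (G i).Δy) atTop (𝓝 0) :=
    tendsto_const_nhds.div_atTop (tendsto_natCast_atTop_atTop.comp hG.ny)
  have hdy' : Tendsto (fun i => Real.exp P.yhi * (G i).Δy) atTop (𝓝 0) := by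
    simpa using hdy.const_mul (Real.exp P.yhi)
  have hU : 0 < θ / (P.wealthCap + Q) := div_pos hθ (by linarith [P.wealthCap_pos])
  filter_upwards [hdy.eventually (gt_mem_nhds hθ), hdy'.eventually (gt_mem_nhds hθ), hG.b θ hθ,
    hG.u _ hU, hG.W θ hθ, hG.ng.eventually (htr θ hθ)] with i h1 h2 h3 h4 h5 h6
  exact ⟨h1.le, h2.le, fun j hj => (h3 j hj).le, fun j hj => (h4 j hj).le,
    fun j hj => (h5 j hj).le, h6⟩

end Grid

/-! ### Normalization of the criterion -/

/-- The sign that turns the criterion into a minimization. -/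
noncomputable def _root_.Criterion.sign : Criterion → ℝ
  | .bPoE _ _ => 1
  | .CVaR _ _ => -1

theorem _root_.Criterion.sign_mul_sign (c : Criterion) : c.sign * c.sign = 1 := by
  cases c <;> simp [Criterion.sign]

theorem _root_.Criterion.sign_mul_cancel (c : Criterion) (x : ℝ) : c.sign * (c.sign * x) = x := by
  rw [← mul_assoc, c.sign_mul_sign, one_mul]

theorem _root_.Criterion.asGood_iff (c : Criterion) (x y : ℝ) :
    c.AsGood (c.sign * x) (c.sign * y) ↔ x ≤ y := by
  cases c <;> simp [Criterion.sign, Criterion.AsGood]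

/-- For real sets `sInf` is defined by reflecting `sSup`, so the identity needs no boundedness or
nonemptiness. -/
theorem _root_.Criterion.opt_image {α : Type*} (c : Criterion) (g : α → ℝ) (s : Set α) :
    c.opt ((fun x => c.sign * g x) '' s) = c.sign * sInf (g '' s) := by
  cases c with
  | bPoE D γ => simp [Criterion.sign, Criterion.opt]
  | CVaR a γ =>
    simp only [Criterion.sign, Criterion.opt, neg_mul, one_mul]
    rw [Real.sInf_def, neg_neg, ← Set.image_neg_eq_neg, Set.image_image]

theorem settle_const_mul (F : ℝ → ℝ → ℝ → ℝ) (c y b W : ℝ) :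
    P.settle (fun y b W => c * F y b W) y b W = c * P.settle F y b W := by
  simp only [settle]; ring

theorem advance_const_mul (F : ℝ → ℝ → ℝ → ℝ) (c : ℝ) :
    P.advance (fun y b W => c * F y b W) = fun y b W => c * P.advance F y b W := by
  funext y b W
  simp only [advance, settle_const_mul]
  split_ifs
  · rfl
  · ring
  · rw [← intervalIntegral.integral_const_mul]
    congr 1
    funext y'
    ring

theorem controlOpt_sign_mul (m : ℕ) (y b W : ℝ) :
    P.controlOpt m (P.advance (fun y b W => P.crit.sign * liftWealth f 0 y b W)) y b W =
      P.crit.sign * P.objective f (P.wealth m y b) W := by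
  rw [controlOpt, objective, ← Criterion.opt_image, advance_const_mul]
  congr 2
  funext u
  simp only [extend]
  ring

variable (P) in
/-- The exact recursion as a function of wealth and threshold, for the normalized criterion. -/
noncomputable def wealthFn : ℕ → ℝ → ℝ → ℝ
  | 0 => fun x W => P.crit.sign * P.crit.payoff x W
  | k + 1 => fun x _ => P.wealthValue (wealthFn k) (x + P.q (P.M - (k + 1)))

/-- The set of splits depends only on the total wealth, and the recursion commutes with
multiplication by the sign. -/
theorem exactV_eq (k : ℕ) :
    P.exactV k = fun y b W => P.crit.sign * liftWealth (P.wealthFn k) 0 y b W := by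
  induction k with
  | zero =>
    funext y b W
    simp only [exactV, liftWealth, wealthFn, add_zero, Criterion.sign_mul_cancel]
  | succ k ih =>
    funext y b W
    simp only [exactV, ih]
    have : P.controlOpt (P.M - (k + 1))
        (P.advance fun y b W => P.crit.sign * liftWealth (P.wealthFn k) 0 y b W) y b =
        fun W => P.crit.sign * P.objective (P.wealthFn k) (P.wealth (P.M - (k + 1)) y b) W := by
      funext W; exact controlOpt_sign_mul _ _ _ _
    rw [this, Criterion.opt_image]
    simp only [liftWealth, wealthFn, add_zero, wealthValue, wealth]

theorem exactObjective_eq (m : ℕ) (y b W : ℝ) : P.exactObjective m y b W =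
    P.crit.sign * P.objective (P.wealthFn (P.M - (m + 1))) (P.wealth m y b) W := by
  rw [exactObjective, exactV_eq, controlOpt_sign_mul]

theorem exactValue_eq_sign_mul (m : ℕ) (s b : ℝ) : P.exactValue m s b =
    P.crit.sign * P.wealthValue (P.wealthFn (P.M - (m + 1))) (P.wealth m (Real.log s) b) := by
  rw [exactValue, wealthValue, ← Criterion.opt_image]
  congr 2
  funext W
  exact exactObjective_eq _ _ _ _

namespace Grid

variable {G : P.Grid}

theorem settle_const_mul (F : ℕ → ℕ → ℕ → ℝ) (c : ℝ) (n j k : ℕ) :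
    G.settle (fun n j k => c * F n j k) n j k = c * G.settle F n j k := by
  simp only [settle, linInterp_const_mul]; ring

theorem advance_const_mul (F : ℕ → ℕ → ℕ → ℝ) (c : ℝ) :
    G.advance (fun n j k => c * F n j k) = fun n j k => c * G.advance F n j k := by
  funext n j k
  simp only [advance, settle_const_mul]
  split_ifs
  · rfl
  · ring
  · rw [Finset.mul_sum]
    exact Finset.sum_congr rfl fun l _ => by ring

theorem controlOpt_sign_mul (m : ℕ) (F : ℕ → ℕ → ℕ → ℝ) (n j k : ℕ) :
    G.controlOpt m (G.advance (fun n j k => P.crit.sign * F n j k)) n j k =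
      P.crit.sign * G.searchControl m F n j k := by
  rw [controlOpt, searchControl, ← Criterion.opt_image, advance_const_mul]
  congr 2
  funext i
  simp only [extend, linInterp_const_mul]
  ring

variable (G) in
/-- The computed function for the normalized criterion. -/
noncomputable def searchFn : ℕ → ℕ → ℕ → ℕ → ℝ
  | 0 => fun n j k => P.crit.sign * P.crit.payoff (Real.exp (G.y n) + G.b j) (G.W k)
  | i + 1 => fun n j _ => G.searchThreshold (P.M - (i + 1)) (searchFn i) n j

theorem numV_eq (i : ℕ) : G.numV i = fun n j k => P.crit.sign * G.searchFn i n j k := by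
  induction i with
  | zero =>
    funext n j k
    simp only [numV, searchFn, Criterion.sign_mul_cancel]
  | succ i ih =>
    funext n j k
    simp only [numV, ih]
    have : G.controlOpt (P.M - (i + 1))
        (G.advance fun n j k => P.crit.sign * G.searchFn i n j k) n j =
        fun k => P.crit.sign * G.searchControl (P.M - (i + 1)) (G.searchFn i) n j k := by
      funext k; exact controlOpt_sign_mul _ _ _ _ _
    rw [this, Criterion.opt_image]
    simp only [searchFn, searchThreshold]

theorem numObjective_eq (m n j k : ℕ) : G.numObjective m n j k =
    P.crit.sign * G.searchControl m (G.searchFn (P.M - (m + 1))) n j k := by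
  rw [numObjective, numV_eq, controlOpt_sign_mul]

end Grid

/-! ### The terminal payoff -/

theorem abs_max_one_sub_zero_sub_le (a b : ℝ) : |max (1 - a) 0 - max (1 - b) 0| ≤ |a - b| := by
  refine (abs_max_sub_max_le_abs _ _ _).trans (le_of_eq ?_)
  rw [show 1 - a - (1 - b) = b - a by ring, abs_sub_comm]

theorem abs_min_zero_sub_le (a b : ℝ) : |min a 0 - min b 0| ≤ |a - b| := by
  simpa using abs_min_sub_min_le_max a 0 b 0

/-- The payoffs are piecewise linear in wealth. Dependence on the threshold is Lipschitz because `W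
- D` stays above `Wlo - D > 0` for bPoE, and because `W` enters piecewise linearly for CVaR. -/
theorem exists_payoff_bounds (P : MeanRiskProblem) : ∃ C : ℝ, 0 ≤ C ∧
    ∀ x ∈ Set.Icc 0 P.wealthCap, ∀ W ∈ Set.Icc P.Wlo P.Whi, |P.crit.payoff x W| ≤ C ∧
      (∀ x' ∈ Set.Icc 0 P.wealthCap, |P.crit.payoff x' W - P.crit.payoff x W| ≤ C * |x' - x|) ∧
      ∀ W' ∈ Set.Icc P.Wlo P.Whi, |P.crit.payoff x W - P.crit.payoff x W'| ≤ C * |W - W'| := by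
  have hadm := P.crit_admissible
  have hX := P.wealthCap_pos
  have hW := P.Wlo_lt
  cases hc : P.crit with
  | bPoE D γ =>
    rw [hc] at hadm
    obtain ⟨hD, hγ, hDW⟩ := hadm
    set d := P.Wlo - D with hd
    have hd0 : 0 < d := by linarith
    refine ⟨γ * (1 + (P.wealthCap + D) / d) + P.wealthCap + (γ / d + 1) +
      γ * ((P.wealthCap + D) / (d * d)), by positivity, fun x hx W hW => ⟨?_, fun x' hx' => ?_,
      fun W' hW' => ?_⟩⟩
    all_goals simp only [Criterion.payoff]
    · have hWd : d ≤ W - D := by linarith [hW.1]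
      have h1 : |(x - D) / (W - D)| ≤ (P.wealthCap + D) / d := by
        rw [abs_div, abs_of_pos (by linarith : 0 < W - D)]
        exact div_le_div₀ (by linarith) (abs_le.2 ⟨by linarith [hx.1], by linarith [hx.2]⟩)
          hd0 hWd
      have h2 : |max (1 - (x - D) / (W - D)) 0| ≤ 1 + (P.wealthCap + D) / d := by
        rw [abs_of_nonneg (le_max_right _ _)]
        exact max_le (by linarith [(abs_le.1 h1).1]) (by positivity)
      have h3 := mul_le_mul_of_nonneg_left h2 hγ.le
      have z1 : 0 ≤ γ / d := by positivity
      have z2 : 0 ≤ γ * ((P.wealthCap + D) / (d * d)) := by positivity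
      refine (abs_sub _ _).trans ?_
      rw [abs_mul, abs_of_pos hγ, abs_of_nonneg hx.1]
      linarith [hx.2]
    · have hWd : d ≤ W - D := by linarith [hW.1]
      have h1 := abs_max_one_sub_zero_sub_le ((x' - D) / (W - D)) ((x - D) / (W - D))
      have h2 : |(x' - D) / (W - D) - (x - D) / (W - D)| ≤ |x' - x| / d := by
        rw [← sub_div, abs_div, abs_of_pos (by linarith : 0 < W - D),
          show x' - D - (x - D) = x' - x by ring]
        exact div_le_div_of_nonneg_left (abs_nonneg _) hd0 hWd
      have h3 := mul_le_mul_of_nonneg_left (h1.trans h2) hγ.le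
      set p' := max (1 - (x' - D) / (W - D)) 0
      set p := max (1 - (x - D) / (W - D)) 0
      have e : γ * p' - x' - (γ * p - x) = γ * (p' - p) + (x - x') := by ring
      rw [e]
      refine (abs_add_le _ _).trans ?_
      rw [abs_mul, abs_of_pos hγ, abs_sub_comm x]
      have z : 0 ≤ (γ * (1 + (P.wealthCap + D) / d) + P.wealthCap +
        γ * ((P.wealthCap + D) / (d * d))) * |x' - x| := by positivity
      have e2 : γ * (|x' - x| / d) = γ / d * |x' - x| := by ring
      linarith
    · have hWd : d ≤ W - D := by linarith [hW.1]
      have hWd' : d ≤ W' - D := by linarith [hW'.1]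
      have h1 := abs_max_one_sub_zero_sub_le ((x - D) / (W - D)) ((x - D) / (W' - D))
      have h2 : |(x - D) / (W - D) - (x - D) / (W' - D)| ≤
          (P.wealthCap + D) / (d * d) * |W - W'| := by
        have e : (x - D) / (W - D) - (x - D) / (W' - D) =
            (x - D) / ((W - D) * (W' - D)) * (W' - W) := by
          have : W - D ≠ 0 := by linarith
          have : W' - D ≠ 0 := by linarith
          field_simp
          ring
        rw [e, abs_mul, abs_sub_comm W', abs_div, abs_mul, abs_of_pos (by linarith : 0 < W - D),
          abs_of_pos (by linarith : 0 < W' - D)]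
        refine mul_le_mul_of_nonneg_right ?_ (abs_nonneg _)
        exact div_le_div₀ (by linarith) (abs_le.2 ⟨by linarith [hx.1], by linarith [hx.2]⟩)
          (by positivity) (mul_le_mul hWd hWd' hd0.le (by linarith))
      have h3 := mul_le_mul_of_nonneg_left (h1.trans h2) hγ.le
      set p' := max (1 - (x - D) / (W - D)) 0
      set p := max (1 - (x - D) / (W' - D)) 0
      have e : γ * p' - x - (γ * p - x) = γ * (p' - p) := by ring
      rw [e, abs_mul, abs_of_pos hγ]
      have z : 0 ≤ (γ * (1 + (P.wealthCap + D) / d) + P.wealthCap + (γ / d + 1)) *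
        |W - W'| := by positivity
      linarith
  | CVaR a γ =>
    rw [hc] at hadm
    obtain ⟨ha, ha1, hγ, hWlo⟩ := hadm
    have hWhi : 0 ≤ P.Whi := by linarith
    refine ⟨γ * (P.Whi + 1 / a * (P.wealthCap + P.Whi)) + P.wealthCap + (γ * (1 / a) + 1) +
      γ * (1 + 1 / a), by positivity, fun x hx W hW => ⟨?_, fun x' hx' => ?_,
      fun W' hW' => ?_⟩⟩
    all_goals simp only [Criterion.payoff]
    · have h1 : |min (x - W) 0| ≤ P.wealthCap + P.Whi := by
        rw [abs_le]
        refine ⟨le_min (by linarith [hx.1, hW.2]) (by linarith), (min_le_right _ _).trans ?_⟩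
        positivity
      have h2 := mul_le_mul_of_nonneg_left h1 (by positivity : 0 ≤ 1 / a)
      have h3 : |W + 1 / a * min (x - W) 0| ≤ P.Whi + 1 / a * (P.wealthCap + P.Whi) := by
        refine (abs_add_le _ _).trans ?_
        rw [abs_mul, abs_of_nonneg (by linarith [hW.1] : 0 ≤ W),
          abs_of_pos (by positivity : 0 < 1 / a)]
        linarith [hW.2]
      have h4 := mul_le_mul_of_nonneg_left h3 hγ.le
      refine (abs_add_le _ _).trans ?_
      rw [abs_mul, abs_of_pos hγ, abs_of_nonneg hx.1]
      have z : 0 ≤ (γ * (1 / a) + 1) + γ * (1 + 1 / a) := by positivity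
      linarith [hx.2]
    · have h1 := abs_min_zero_sub_le (x' - W) (x - W)
      rw [show x' - W - (x - W) = x' - x by ring] at h1
      set p' := min (x' - W) 0
      set p := min (x - W) 0
      have e : γ * (W + 1 / a * p') + x' - (γ * (W + 1 / a * p) + x) =
        γ * (1 / a) * (p' - p) + (x' - x) := by ring
      rw [e]
      refine (abs_add_le _ _).trans ?_
      rw [abs_mul, abs_of_pos (by positivity : 0 < γ * (1 / a))]
      have h2 := mul_le_mul_of_nonneg_left h1 (by positivity : 0 ≤ γ * (1 / a))
      have z : 0 ≤ (γ * (P.Whi + 1 / a * (P.wealthCap + P.Whi)) + P.wealthCap +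
        γ * (1 + 1 / a)) * |x' - x| := by positivity
      linarith
    · have h1 := abs_min_zero_sub_le (x - W) (x - W')
      rw [show x - W - (x - W') = W' - W by ring, abs_sub_comm W'] at h1
      set p' := min (x - W) 0
      set p := min (x - W') 0
      have e : γ * (W + 1 / a * p') + x - (γ * (W' + 1 / a * p) + x) =
        γ * (W - W') + γ * (1 / a) * (p' - p) := by ring
      rw [e]
      refine (abs_add_le _ _).trans ?_
      rw [abs_mul, abs_mul (γ * (1 / a)), abs_of_pos (by positivity : 0 < γ * (1 / a)),
        abs_of_pos hγ]
      have h2 := mul_le_mul_of_nonneg_left h1 (by positivity : 0 ≤ γ * (1 / a))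
      have z : 0 ≤ (γ * (P.Whi + 1 / a * (P.wealthCap + P.Whi)) + P.wealthCap +
        (γ * (1 / a) + 1)) * |W - W'| := by positivity
      linarith

theorem _root_.Criterion.abs_sign (c : Criterion) : |c.sign| = 1 := by
  cases c <;> simp [Criterion.sign]

theorem exists_regular_wealthFn_zero (P : MeanRiskProblem) (J : ℝ) :
    ∃ C, P.Regular (P.wealthFn 0) J C := by
  obtain ⟨C, hC, h⟩ := P.exists_payoff_bounds
  refine ⟨C, hC, fun x hx W hW => ?_, fun x hx x' hx' W hW _ => ?_, fun x hx W hW W' hW' => ?_⟩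
  · simp only [wealthFn, abs_mul, Criterion.abs_sign, one_mul]
    exact (h x hx W hW).1
  · have := (h x hx W hW).2.1 x' hx'
    have e : |P.wealthFn 0 x' W - P.wealthFn 0 x W| ≤ C * |x' - x| := by
      simp only [wealthFn, ← mul_sub, abs_mul, Criterion.abs_sign, one_mul]
      exact this
    linarith [(abs_le.1 e).2]
  · simp only [wealthFn, ← mul_sub, abs_mul, Criterion.abs_sign, one_mul]
    exact (h x hx W hW).2.2 W' hW'

/-! ### Convergence of the scheme -/

variable (P) in
/-- Wealth level above which `wealthFn k` is Lipschitz. -/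
noncomputable def regularLevel (k : ℕ) : ℝ :=
  if k = 0 then 0 else Real.exp (P.ymax + |P.r| * (k * P.Δt))

theorem regularLevel_le (k : ℕ) : P.regularLevel k ≤ Real.exp (P.ymax + |P.r| * (k * P.Δt)) := by
  unfold regularLevel
  split_ifs
  · exact (Real.exp_pos _).le
  · exact le_rfl

theorem shrink_mul_exp (k : ℕ) :
    P.shrink * Real.exp (P.ymax + |P.r| * ((k + 1 : ℕ) * P.Δt)) =
      Real.exp (P.ymax + |P.r| * (k * P.Δt)) := by
  rw [shrink, ← Real.exp_add]
  congr 1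
  push_cast
  ring

/-- This is where the lower bound on `bmax` enters: the level gains a factor `1 / shrink` per
period, starting from `e^ymax`, over at most `M` periods of total length `T`. -/
theorem regularLevel_le_shrink_mul_bmax {k : ℕ} (hk : k + 1 ≤ P.M) :
    P.regularLevel k ≤ P.shrink * P.bmax := by
  refine (regularLevel_le k).trans ?_
  rw [← shrink_mul_exp]
  refine mul_le_mul_of_nonneg_left (le_trans (Real.exp_le_exp.2 ?_) P.bmax_large) P.shrink_pos.le
  have hM : (0 : ℝ) < P.M := by exact_mod_cast P.M_pos
  have h1 : ((k + 1 : ℕ) : ℝ) * P.Δt ≤ P.T := by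
    have h2 : ((k + 1 : ℕ) : ℝ) ≤ P.M := by exact_mod_cast hk
    calc _ ≤ (P.M : ℝ) * P.Δt := mul_le_mul_of_nonneg_right h2 P.Δt_pos.le
      _ = P.T := by unfold Δt; field_simp
  linarith [mul_le_mul_of_nonneg_left h1 (abs_nonneg P.r)]

variable (P) in
/-- Total of the cash flows. -/
noncomputable def totalCash : ℝ := ∑ m ∈ Finset.range P.M, P.q m

theorem totalCash_nonneg : 0 ≤ P.totalCash :=
  Finset.sum_nonneg fun m hm => P.q_nonneg m (Finset.mem_range.1 hm)

theorem q_le_totalCash {m : ℕ} (hm : m < P.M) : P.q m ≤ P.totalCash :=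
  Finset.single_le_sum (fun i hi => P.q_nonneg i (Finset.mem_range.1 hi)) (Finset.mem_range.2 hm)

theorem exists_regular_wealthFn (k : ℕ) (hk : k ≤ P.M) :
    ∃ C, P.Regular (P.wealthFn k) (P.regularLevel k) C := by
  induction k with
  | zero => exact P.exists_regular_wealthFn_zero _
  | succ k ih =>
    obtain ⟨C, hC⟩ := ih (by omega)
    refine hC.wealthValue (regularLevel_le_shrink_mul_bmax hk) (P.q_nonneg _ (by omega)) ?_ ?_
    · rw [regularLevel, if_neg (by omega)]
      refine Real.exp_le_exp.2 ?_
      have := mul_nonneg (abs_nonneg P.r) (mul_nonneg (Nat.cast_nonneg (k + 1)) P.Δt_pos.le)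
      linarith
    · rw [regularLevel.eq_def P (k + 1), if_neg (by omega), shrink_mul_exp]
      exact regularLevel_le k

/-- At the horizon the two functions agree at the nodes, so the induction starts with zero shift and
zero error. `S` and `T` depend on the number of steps but not on the grid. -/
theorem exists_close_searchFn (k : ℕ) (hk : k ≤ P.M) :
    ∃ S T : ℝ, 0 ≤ S ∧ 0 ≤ T ∧ ∃ θ₀ > 0, ∀ (G : P.Grid) (θ : ℝ), 0 < θ → θ ≤ θ₀ →
      G.Fine P.totalCash θ → G.Close (P.wealthFn k) (G.searchFn k) (S * θ) (T * θ) := by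
  induction k with
  | zero =>
    refine ⟨0, 0, le_rfl, le_rfl, 1, one_pos, fun G θ _ _ _ n hn j hj k hk => ?_⟩
    simp [wealthFn, Grid.searchFn]
  | succ k ih =>
    obtain ⟨S, T, hS, hT, θ₁, hθ₁, h₁⟩ := ih (by omega)
    obtain ⟨C, hC⟩ := exists_regular_wealthFn (P := P) k (by omega)
    have hm : P.M - (k + 1) < P.M := by omega
    obtain ⟨S', T', hS', hT', θ₂, hθ₂, h₂⟩ := hC.close_searchThreshold
      (regularLevel_le_shrink_mul_bmax hk) (P.q_nonneg _ hm) (q_le_totalCash hm) hS hT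
    refine ⟨S', T', hS', hT', min θ₁ θ₂, by positivity, fun G θ hθ hle hG => ?_⟩
    rw [le_min_iff] at hle
    exact h₂ G θ _ hθ hle.2 hG (h₁ G θ hθ hle.1 hG)

end MeanRiskProblem

namespace MeanRiskProblem

variable {P : MeanRiskProblem}

/-! ### Passage to the limit -/

theorem sub_add_one_eq {m M : ℕ} (hm : m < M) :
    M - m = M - (m + 1) + 1 ∧ M - (M - (m + 1) + 1) = m := by
  omega

theorem Grid.numV_eq_searchThreshold {G : P.Grid} {m : ℕ} (hm : m < P.M) (n j k : ℕ) :
    G.numV (P.M - m) n j k =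
      P.crit.sign * G.searchThreshold m (G.searchFn (P.M - (m + 1))) n j := by
  obtain ⟨h1, h2⟩ := sub_add_one_eq hm
  rw [h1, Grid.numV_eq]
  simp only [Grid.searchFn, h2]

/-- Continuity of the value function in the state is continuity in the total wealth. -/
theorem continuousAt_wealthValue {m : ℕ} {s' b' : ℝ} (hx : (s', b') ∈ P.interiorDomain)
    (hcont : ContinuousWithinAt (fun x : ℝ × ℝ => P.exactValue m x.1 x.2) P.interiorDomain
      (s', b')) :
    ContinuousAt (P.wealthValue (P.wealthFn (P.M - (m + 1)))) (P.wealth m (Real.log s') b') := by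
  obtain ⟨hs, hlo, hhi, hb, hb'⟩ := hx
  simp only at hs hlo hhi hb hb'
  set w' := P.wealth m (Real.log s') b' with hw'
  have hw'e : w' = s' + b' + P.q m := by rw [hw', wealth, Real.exp_log hs]
  -- Only the risky amount is varied. It is strictly inside its range, so wealth is reached from
  -- both sides even when `b'` is an end point of `[0, bmax]`.
  have hφc : Tendsto (fun w : ℝ => s' + (w - w')) (𝓝 w') (𝓝 s') := by
    have : ContinuousAt (fun w : ℝ => s' + (w - w')) w' := by fun_prop
    simpa [ContinuousAt] using this
  have hpos : ∀ᶠ w in 𝓝 w', 0 < s' + (w - w') := hφc.eventually (lt_mem_nhds hs)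
  have h1 : ∀ᶠ w in 𝓝 w', Real.exp P.ymin < s' + (w - w') :=
    hφc.eventually (lt_mem_nhds ((Real.lt_log_iff_exp_lt hs).1 hlo))
  have h2 : ∀ᶠ w in 𝓝 w', s' + (w - w') < Real.exp P.ymax :=
    hφc.eventually (gt_mem_nhds ((Real.log_lt_iff_lt_exp hs).1 hhi))
  have hφ : Tendsto (fun w : ℝ => (s' + (w - w'), b')) (𝓝 w') (𝓝[P.interiorDomain] (s', b')) := by
    refine tendsto_nhdsWithin_iff.2 ⟨hφc.prodMk_nhds tendsto_const_nhds, ?_⟩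
    filter_upwards [hpos, h1, h2] with w p0 p1 p2
    exact ⟨p0, (Real.lt_log_iff_exp_lt p0).2 p1, (Real.log_lt_iff_lt_exp p0).2 p2, hb, hb'⟩
  have h3 := (hcont.tendsto.comp hφ).const_mul P.crit.sign
  simp only [exactValue_eq_sign_mul, Criterion.sign_mul_cancel, Function.comp_def] at h3
  refine Tendsto.congr' ?_ h3
  filter_upwards [hpos] with w p0
  congr 1
  rw [wealth, Real.exp_log p0, hw'e]
  ring

/-- The enclosure holds at wealths shifted by `S * θ` in either direction, and continuity of the
exact value at `w'` closes the gap. The function enclosed has no threshold dependence left, so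
threshold index `0` serves. -/
theorem tendsto_searchThreshold {G : ℕ → P.Grid} (hG : Refining G) {m : ℕ} (hm : m < P.M)
    {w' : ℝ} (hv : ContinuousAt (P.wealthValue (P.wealthFn (P.M - (m + 1)))) w')
    {n j : ℕ → ℕ} (hn : ∀ i, n i ≤ (G i).ny) (hj : ∀ i, j i ≤ (G i).nb)
    (hw : Tendsto (fun i => P.wealth m ((G i).y (n i)) ((G i).b (j i))) atTop (𝓝 w')) :
    Tendsto (fun i => (G i).searchThreshold m ((G i).searchFn (P.M - (m + 1))) (n i) (j i)) atTop
      (𝓝 (P.wealthValue (P.wealthFn (P.M - (m + 1))) w')) := by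
  obtain ⟨e1, e2⟩ := sub_add_one_eq hm
  obtain ⟨S, T, hS, hT, θ₀, hθ₀, hclose⟩ := exists_close_searchFn (P := P) (P.M - m) (by omega)
  rw [e1] at hclose
  simp only [wealthFn, Grid.searchFn, e2] at hclose
  set v := P.wealthValue (P.wealthFn (P.M - (m + 1)))
  rw [Metric.tendsto_nhds]
  intro ε hε
  obtain ⟨δ, hδ, hvδ⟩ := Metric.continuousAt_iff.1 hv (ε / 2) (by positivity)
  obtain ⟨θ₁, hθ₁, h₁⟩ := Grid.exists_threshold_le (by positivity : 0 < δ / 2) (S + 1)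
  obtain ⟨θ₂, hθ₂, h₂⟩ := Grid.exists_threshold_le (by positivity : 0 < ε / 2) (T + 1)
  set θ := min θ₀ (min θ₁ θ₂) with hθ
  have hθpos : 0 < θ := by positivity
  have l₁ : θ ≤ θ₁ := (min_le_right _ _).trans (min_le_left _ _)
  have l₂ : θ ≤ θ₂ := (min_le_right _ _).trans (min_le_right _ _)
  have b₁ : S * θ < δ / 2 := by
    linarith [mul_le_mul_of_nonneg_left l₁ (by positivity : 0 ≤ S + 1)]
  have b₂ : T * θ < ε / 2 := by
    linarith [mul_le_mul_of_nonneg_left l₂ (by positivity : 0 ≤ T + 1)]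
  have z₁ : 0 ≤ S * θ := by positivity
  filter_upwards [hG.eventually_fine totalCash_nonneg hθpos,
    Metric.tendsto_nhds.1 hw (δ / 2) (by positivity)] with i hfine hwi
  obtain ⟨c₁, c₂⟩ := hclose (G i) θ hθpos (min_le_left _ _) hfine (n i) (hn i) (j i) (hj i) 0
    (Nat.zero_le _)
  have ew : P.wealth m ((G i).y (n i)) ((G i).b (j i)) =
    Real.exp ((G i).y (n i)) + (G i).b (j i) + P.q m := rfl
  rw [Real.dist_eq, abs_lt, ew] at hwi
  have v₁ := hvδ (x := Real.exp ((G i).y (n i)) + (G i).b (j i) + S * θ + P.q m)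
    (by rw [Real.dist_eq, abs_lt]; constructor <;> linarith [hwi.1, hwi.2])
  have v₂ := hvδ (x := Real.exp ((G i).y (n i)) + (G i).b (j i) - S * θ + P.q m)
    (by rw [Real.dist_eq, abs_lt]; constructor <;> linarith [hwi.1, hwi.2])
  rw [Real.dist_eq, abs_lt] at v₁ v₂ ⊢
  constructor <;> linarith [v₁.1, v₂.2]

/-- At the last rebalancing time, limits of computed optimal thresholds are optimal. -/
theorem objective_le_wealthValue_of_tendsto {G : ℕ → P.Grid} (hG : Refining G) {m : ℕ}
    (hm : m < P.M) {w' W : ℝ} (hmin : Real.exp P.ymin < w') {n j κ : ℕ → ℕ}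
    (hn : ∀ i, n i ≤ (G i).ny) (hj : ∀ i, j i ≤ (G i).nb) (hκ : ∀ i, κ i ≤ (G i).nw)
    (hw : Tendsto (fun i => P.wealth m ((G i).y (n i)) ((G i).b (j i))) atTop (𝓝 w'))
    (hW : W ∈ Set.Icc P.Wlo P.Whi) (hWκ : Tendsto (fun i => (G i).W (κ i)) atTop (𝓝 W))
    (hopt : Tendsto (fun i => (G i).searchControl m ((G i).searchFn 0) (n i) (j i) (κ i)) atTop
      (𝓝 (P.wealthValue (P.wealthFn 0) w'))) :
    P.objective (P.wealthFn 0) w' W ≤ P.wealthValue (P.wealthFn 0) w' := by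
  obtain ⟨C, hf⟩ := P.exists_regular_wealthFn_zero 0
  have hJ : 0 ≤ P.shrink * P.bmax := mul_nonneg P.shrink_pos.le P.bmax_pos.le
  have hw'0 : 0 < w' := (Real.exp_pos _).trans hmin
  obtain ⟨E, hE, θ₀, hθ₀, hbound⟩ := hf.objective_le_searchControl (m := m) hJ
    (P.q_nonneg m hm) (q_le_totalCash hm) (le_refl (0 : ℝ)) (le_refl (0 : ℝ))
  have hΛ := Grid.five_le_stepShift P (le_refl (0 : ℝ))
  set Λ := Grid.stepShift P 0
  obtain ⟨K₁, hK₁, h₁⟩ := hf.objective_le_of_ge hJ (w' + 1)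
  obtain ⟨K₂, hK₂, h₂⟩ := hf.abs_objective_sub_le (w' + 1)
  obtain ⟨K₃, hK₃, h₃⟩ := hf.objective_le_of_le (w' + 1)
  -- A move to the right must not cross `e^ymax`, where a new region opens; starting at `e^ymax`
  -- itself is harmless.
  obtain ⟨d, hd, hregion⟩ : ∃ d > 0, ∀ δ < d, Real.exp P.ymax ≤ w' ∨ w' + δ < Real.exp P.ymax := by
    rcases le_or_gt (Real.exp P.ymax) w' with h | h
    · exact ⟨1, one_pos, fun _ _ => Or.inl h⟩
    · exact ⟨Real.exp P.ymax - w', by linarith, fun δ hδ => Or.inr (by linarith)⟩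
  refine le_of_forall_pos_le_add fun ε hε => ?_
  obtain ⟨δ₁, hδ₁, l₁⟩ := Grid.exists_threshold_le hε (K₁ + K₂ + 2 * K₃ + E + 1)
  set δ := min (min δ₁ 1) (d / 2) with hδ
  have hδ0 : 0 < δ := by positivity
  have m₁ : δ ≤ δ₁ := (min_le_left _ _).trans (min_le_left _ _)
  have m₂ : δ ≤ 1 := (min_le_left _ _).trans (min_le_right _ _)
  have m₃ : δ < d := (min_le_right _ _).trans_lt (by linarith)
  obtain ⟨θ₁, hθ₁, l₂⟩ := Grid.exists_threshold_le (by positivity : 0 < δ / 2) Λ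
  set θ := min (min θ₀ δ) θ₁ with hθ
  have hθ0 : 0 < θ := by positivity
  have k₁ : θ ≤ θ₀ := (min_le_left _ _).trans (min_le_left _ _)
  have k₂ : θ ≤ δ := (min_le_left _ _).trans (min_le_right _ _)
  have k₃ : Λ * θ ≤ δ / 2 := by
    linarith [mul_le_mul_of_nonneg_left (min_le_right (min θ₀ δ) θ₁) (by linarith : 0 ≤ Λ)]
  have k₄ : 0 ≤ Λ * θ := mul_nonneg (by linarith) hθ0.le
  obtain ⟨i, hfine, hwi, hvi, hWi⟩ := ((hG.eventually_fine totalCash_nonneg hθ0).and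
    ((Metric.tendsto_nhds.1 hw (δ / 2) (by positivity)).and
    ((Metric.tendsto_nhds.1 hopt δ hδ0).and (Metric.tendsto_nhds.1 hWκ δ hδ0)))).exists
  have hclose : (G i).Close (P.wealthFn 0) ((G i).searchFn 0) (0 * θ) (0 * θ) := by
    intro n hn j hj k hk
    simp [wealthFn, Grid.searchFn]
  have a := hbound (G i) θ _ hθ0 k₁ hfine hclose (n i) (hn i) (j i) (hj i) (κ i) (hκ i)
  have hwlo := (Grid.wealth_bounds (G := G i) (m := m) (hn i) (hj i) (P.q_nonneg m hm) le_rfl).1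
  set wi := P.wealth m ((G i).y (n i)) ((G i).b (j i))
  have hWm := (G i).W_mem (hκ i)
  rw [Real.dist_eq, abs_lt] at hwi hvi hWi
  have hlo := Real.exp_pos P.ylo
  -- The chain goes right from `w'` to `w' + δ`, then from `W` to the computed threshold, then back
  -- down to `wi + Λ * θ`, where the scheme dominates the exact objective. The last move costs only
  -- the upward variation.
  have r₁ := h₁ w' ⟨hw'0.le, by linarith⟩ (w' + δ) ⟨by linarith, by linarith⟩ W hW (by linarith)
    hmin (hregion δ m₃) (mul_nonneg P.shrink_pos.le hw'0.le)
  have r₂ := (abs_le.1 (h₂ (w' + δ) ⟨by linarith, by linarith⟩ W hW _ hWm)).2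
  have r₃ := h₃ (wi + Λ * θ) ⟨by linarith, by linarith [hwi.2]⟩ (w' + δ)
    ⟨by linarith, by linarith⟩ _ hWm (by linarith [hwi.2])
  have hWabs : |W - (G i).W (κ i)| ≤ δ := by
    rw [abs_le]; constructor <;> linarith [hWi.1, hWi.2]
  have t₁ : K₁ * (w' + δ - w') = K₁ * δ := by ring
  have t₂ := mul_le_mul_of_nonneg_left hWabs hK₂
  have t₃ : K₃ * (w' + δ - (wi + Λ * θ)) ≤ K₃ * (2 * δ) :=
    mul_le_mul_of_nonneg_left (by linarith [hwi.1]) hK₃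
  have t₄ := mul_le_mul_of_nonneg_left k₂ hE
  have t₅ := mul_le_mul_of_nonneg_left m₁ (by positivity : 0 ≤ K₁ + K₂ + 2 * K₃ + E + 1)
  linarith [hvi.2]

theorem isOptimalThreshold_iff {m : ℕ} {s b W : ℝ} : P.IsOptimalThreshold m s b W ↔
    W ∈ Set.Icc P.Wlo P.Whi ∧ ∀ W' ∈ Set.Icc P.Wlo P.Whi,
      P.objective (P.wealthFn (P.M - (m + 1))) (P.wealth m (Real.log s) b) W ≤
        P.objective (P.wealthFn (P.M - (m + 1))) (P.wealth m (Real.log s) b) W' := by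
  simp only [IsOptimalThreshold, exactObjective_eq, Criterion.asGood_iff]

theorem Grid.isOptimalThreshold_iff {G : P.Grid} {m n j k : ℕ} : G.IsOptimalThreshold m n j k ↔
    k ≤ G.nw ∧ G.searchControl m (G.searchFn (P.M - (m + 1))) n j k =
      G.searchThreshold m (G.searchFn (P.M - (m + 1))) n j := by
  simp only [IsOptimalThreshold, numObjective_eq, Criterion.asGood_iff]
  refine and_congr_right fun hk => ⟨fun h => le_antisymm ?_ (searchThreshold_le hk), fun h => ?_⟩
  · refine le_csInf (Set.nonempty_Iic.image _) ?_
    rintro _ ⟨k', hk', rfl⟩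
    exact h k' hk'
  · intro k' hk'
    rw [h]
    exact searchThreshold_le hk'

end MeanRiskProblem

theorem theorem7p2 (P : MeanRiskProblem) (G : ℕ → P.Grid) (hG : MeanRiskProblem.Refining G)
    (m : ℕ) (hm : m < P.M) (s' b' : ℝ) (hx : (s', b') ∈ P.interiorDomain)
    (hcont : ContinuousWithinAt (fun x : ℝ × ℝ => P.exactValue m x.1 x.2) P.interiorDomain (s', b'))
    (n j : ℕ → ℕ) (hnode : ∀ i, (G i).IsInteriorNode (n i) (j i))
    (hs : Tendsto (fun i => Real.exp ((G i).y (n i))) atTop (𝓝 s'))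
    (hb : Tendsto (fun i => (G i).b (j i)) atTop (𝓝 b'))
    (κ : ℕ → ℕ) (hκ : ∀ i, (G i).IsOptimalThreshold m (n i) (j i) (κ i)) :
    Tendsto (fun i => |(G i).numV (P.M - m) (n i) (j i) (κ i) - P.exactValue m s' b'|)
      atTop (𝓝 0) ∧
    ∃ W, P.IsOptimalThreshold m s' b' W ∧
      ∃ ψ : ℕ → ℕ, StrictMono ψ ∧ Tendsto (fun i => (G (ψ i)).W (κ (ψ i))) atTop (𝓝 W) := by
  have hv := MeanRiskProblem.continuousAt_wealthValue hx hcont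
  have hs0 : 0 < s' := hx.1
  have hw : Tendsto (fun i => P.wealth m ((G i).y (n i)) ((G i).b (j i))) atTop
      (𝓝 (P.wealth m (Real.log s') b')) := by
    simp only [MeanRiskProblem.wealth, Real.exp_log hs0]
    exact (hs.add hb).add_const _
  have hn : ∀ i, n i ≤ (G i).ny := fun i => (hnode i).1
  have hj : ∀ i, j i ≤ (G i).nb := fun i => (hnode i).2.1
  have hκ' := fun i => MeanRiskProblem.Grid.isOptimalThreshold_iff.1 (hκ i)
  have hmain := MeanRiskProblem.tendsto_searchThreshold hG hm hv hn hj hw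
  refine ⟨?_, ?_⟩
  · have h := ((hmain.const_mul P.crit.sign).sub_const (P.exactValue m s' b')).abs
    rw [← MeanRiskProblem.exactValue_eq_sign_mul, sub_self, abs_zero] at h
    refine h.congr fun i => ?_
    rw [MeanRiskProblem.Grid.numV_eq_searchThreshold hm]
  · obtain ⟨W, hW, ψ, hψ, hlim⟩ := (isCompact_Icc (a := P.Wlo) (b := P.Whi)).tendsto_subseq
      (fun i => (G i).W_mem (hκ' i).1)
    refine ⟨W, MeanRiskProblem.isOptimalThreshold_iff.2 ⟨hW, fun W' hW' => ?_⟩, ψ, hψ, hlim⟩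
    have hw0 : 0 ≤ P.wealth m (Real.log s') b' := by
      have := hx.2.2.2.1
      have := P.q_nonneg m hm
      have := Real.exp_pos (Real.log s')
      unfold MeanRiskProblem.wealth
      linarith
    -- `zero` is the last rebalancing time. In the other case `wealthFn (k + 1)` ignores its
    -- threshold, so the two objectives coincide definitionally.
    rcases hk : P.M - (m + 1) with _ | k
    · obtain ⟨C, hf⟩ := P.exists_regular_wealthFn_zero 0
      refine le_trans ?_ (hf.wealthValue_le hw0 hW')
      simp only [hk] at hmain hκ'
      refine MeanRiskProblem.objective_le_wealthValue_of_tendsto (G := fun i => G (ψ i))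
        (n := fun i => n (ψ i)) (j := fun i => j (ψ i)) (κ := fun i => κ (ψ i))
        ⟨hG.ny.comp hψ.tendsto_atTop, hG.ng.comp hψ.tendsto_atTop,
          fun ε hε => hψ.tendsto_atTop.eventually (hG.b ε hε),
          fun ε hε => hψ.tendsto_atTop.eventually (hG.u ε hε),
          fun ε hε => hψ.tendsto_atTop.eventually (hG.W ε hε)⟩ hm ?_ (fun i => hn _)
        (fun i => hj _) (fun i => (hκ' _).1) (hw.comp hψ.tendsto_atTop) hW hlim ?_
      · have h1 := (Real.lt_log_iff_exp_lt hs0).1 hx.2.1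
        have h2 : 0 ≤ b' := hx.2.2.2.1
        have h3 := P.q_nonneg m hm
        simp only [MeanRiskProblem.wealth, Real.exp_log hs0]
        linarith
      · exact (hmain.comp hψ.tendsto_atTop).congr fun i => (hκ' _).2.symm
    · exact le_of_eq rfl
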